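/- Let $\Sigma$ and $\Gamma$ be finite alphabets. An origin-graph from $\Sigma$ to $\Gamma$ is a triple $(u,(v,o))$ with $u\in\Sigma^+$, $v\in\Gamma^*$ and $o:\mathrm{dom}(v)\to\mathrm{dom}(u)$ a map from the positions of $v$ to the positions of $u$. It is regarded as a structure with universe $\mathrm{dom}(u)\uplus\mathrm{dom}(v)$, with the letter predicates, the linear orders $\le_{\mathrm{in}}$ on $\mathrm{dom}(u)$ and $\le_{\mathrm{out}}$ on $\mathrm{dom}(v)$, and a unary function $\mathtt{o}$ which is $o$ on $\mathrm{dom}(v)$ and the identity on $\mathrm{dom}(u)$. An $o$-transduction is a set $\tau$ of origin-graphs; its input domain is $\{u\in\Sigma^+ : (u,(v,o))\in\tau \text{ for some } v, o\}$. The logic $\mathcal L_T$ is the two-variable fragment of first-order logic (two variable names, which can be reused) over equality, the output letter predicates $\gamma(x)$ for $\gamma\in\Gamma$, the order $\le_{\mathrm{out}}$, the function $\mathtt{o}$, and all predicates $\{\psi\}$ of arity $r\in\{0,1,2\}$, where $\psi$ is a formula of monadic second-order logic over the input word (letters of $\Sigma$ and $\le_{\mathrm{in}}$) with at most $r$ free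 first-order variables; $\{\psi\}$ denotes the relation on input positions that $\psi$ defines in $u$. A sentence of $\exists\mathcal L_T$ has the form $\exists X_1\cdots\exists X_n\,\varphi$, where the $X_i$ range over sets of input and output positions and $\varphi$ is a sentence of $\mathcal L_T$ that may in addition use the $X_i$ as unary predicates, also inside the predicates $\{\psi\}$, where $X_i$ stands for its set of input positions. An $\mathcal L_T$-transduction (resp. $\exists\mathcal L_T$-transduction) is the set of origin-graphs that satisfy some sentence of $\mathcal L_T$ (resp. $\exists\mathcal L_T$). Proposition. The input domain of every $\mathcal L_T$-transduction, and of every $\exists\mathcal L_T$-transduction, is a regular language over $\Sigma$, and effectively so: there is an algorithm which, given a sentence of $\mathcal L_T$ (resp. of $\exists\mathcal L_T$) together with its two finite alphabets, outputs a finite automaton that recognises the input domain of the $o$-transduction which the sentence defines. -/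

import Mathlib

/-- An origin-graph `(u, (v, o))`: a nonempty input word `u` over `A`, an output word `v` over `B`,
and an origin mapping from the positions of `v` to the positions of `u`. -/
structure OGraph (A B : Type*) where
  input : List A
  input_ne : input ≠ []
  output : List B
  origin : Fin output.length → Fin input.length

/-- The universe of an origin-graph seen as a structure: the disjoint union of the input
positions and of the output positions. -/
abbrev OGraph.Pos {A B : Type*} (g : OGraph A B) : Type :=
  Fin g.input.length ⊕ Fin g.output.length

/-- The interpretation of the unary function symbol for the origin: the origin mapping on output
positions, the identity on input positions. -/
def OGraph.orig {A B : Type*} (g : OGraph A B) : g.Pos → g.Pos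
  | Sum.inl p => Sum.inl p
  | Sum.inr q => Sum.inl (g.origin q)

/-- The (input) domain of an o-transduction, that is, of a set of origin-graphs. -/
def inputDomain {A B : Type*} (τ : Set (OGraph A B)) : Language A :=
  {u : List A | ∃ g ∈ τ, g.input = u}

/-- Monadic second-order formulas over words on the alphabet `A` (letter predicates and the linear
order on positions), with first-order variables `Fin n` and set variables `Fin m` in scope.
A quantifier binds the variable of index `0` of its body and shifts the others by one.
The remaining Boolean operators and universal quantifiers are the usual abbreviations. -/
inductive WordMSO (A : Type*) : ℕ → ℕ → Type _
  | letter {n m : ℕ} (a : A) (x : Fin n) : WordMSO A n m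
  | le {n m : ℕ} (x y : Fin n) : WordMSO A n m
  | eq {n m : ℕ} (x y : Fin n) : WordMSO A n m
  | mem {n m : ℕ} (x : Fin n) (i : Fin m) : WordMSO A n m
  | neg {n m : ℕ} (φ : WordMSO A n m) : WordMSO A n m
  | and {n m : ℕ} (φ ψ : WordMSO A n m) : WordMSO A n m
  | ex {n m : ℕ} (φ : WordMSO A (n + 1) m) : WordMSO A n m
  | exSet {n m : ℕ} (φ : WordMSO A n (m + 1)) : WordMSO A n m

/-- Satisfaction of an MSO formula in the word `u`. -/
def WordMSO.Holds {A : Type*} (u : List A) : {n m : ℕ} → WordMSO A n m →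
    (Fin n → Fin u.length) → (Fin m → Set (Fin u.length)) → Prop
  | _, _, .letter a x, ν, _ => u.get (ν x) = a
  | _, _, .le x y, ν, _ => ν x ≤ ν y
  | _, _, .eq x y, ν, _ => ν x = ν y
  | _, _, .mem x i, ν, S => ν x ∈ S i
  | _, _, .neg φ, ν, S => ¬ φ.Holds u ν S
  | _, _, .and φ ψ, ν, S => φ.Holds u ν S ∧ ψ.Holds u ν S
  | _, _, .ex φ, ν, S => ∃ p : Fin u.length, φ.Holds u (Fin.cons p ν) S
  | _, _, .exSet φ, ν, S => ∃ P : Set (Fin u.length), φ.Holds u ν (Fin.cons P S)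

/-- Terms over the two first-order variables and the origin function symbol. -/
inductive LTTerm
  | var (x : Fin 2) : LTTerm
  | orig (t : LTTerm) : LTTerm

/-- The value of a term in an origin-graph. -/
def LTTerm.eval {A B : Type*} (g : OGraph A B) (ν : Fin 2 → g.Pos) : LTTerm → g.Pos
  | .var x => ν x
  | .orig t => g.orig (t.eval g ν)

/-- The variable of a term. -/
def LTTerm.fvar : LTTerm → Fin 2
  | .var x => x
  | .orig t => t.fvar

/-- Formulas of the logic `L_T`, the two-variable fragment of first-order logic over the output
letters, the order of the output positions, the origin function and all at most binary
predicates definable in MSO over the input word, with `n` additional monadic second-order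
variables. There are two variable names, which can be reused. For `n = 0` these are the formulas
of `L_T` itself. `input0 ψ`, `input1 ψ t` and `input2 ψ s t` are the predicates written
`{ψ}`, `{ψ}(t)` and `{ψ}(s, t)`. -/
inductive LTFormula (A B : Type*) (n : ℕ)
  | letter (b : B) (t : LTTerm) : LTFormula A B n
  | leOut (s t : LTTerm) : LTFormula A B n
  | eq (s t : LTTerm) : LTFormula A B n
  | mem (t : LTTerm) (i : Fin n) : LTFormula A B n
  | input0 (ψ : WordMSO A 0 n) : LTFormula A B n
  | input1 (ψ : WordMSO A 1 n) (t : LTTerm) : LTFormula A B n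
  | input2 (ψ : WordMSO A 2 n) (s t : LTTerm) : LTFormula A B n
  | neg (φ : LTFormula A B n) : LTFormula A B n
  | and (φ ψ : LTFormula A B n) : LTFormula A B n
  | ex (x : Fin 2) (φ : LTFormula A B n) : LTFormula A B n

/-- The free first-order variables of a formula. -/
def LTFormula.freeVars {A B : Type*} {n : ℕ} : LTFormula A B n → Finset (Fin 2)
  | .letter _ t => {t.fvar}
  | .leOut s t => {s.fvar, t.fvar}
  | .eq s t => {s.fvar, t.fvar}
  | .mem t _ => {t.fvar}
  | .input0 _ => ∅
  | .input1 _ t => {t.fvar}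
  | .input2 _ s t => {s.fvar, t.fvar}
  | .neg φ => φ.freeVars
  | .and φ ψ => φ.freeVars ∪ ψ.freeVars
  | .ex x φ => φ.freeVars.erase x

/-- Satisfaction of a formula in an origin-graph `g`, where the second-order variables are
interpreted by the sets `X` of (input and output) positions. The predicates `{ψ}` are relations on
the input positions, in which the variable `X i` stands for its set of input positions. -/
def LTFormula.Holds {A B : Type*} {n : ℕ} (g : OGraph A B) (X : Fin n → Set g.Pos) :
    LTFormula A B n → (Fin 2 → g.Pos) → Prop
  | .letter b t, ν => ∃ q, t.eval g ν = Sum.inr q ∧ g.output.get q = b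
  | .leOut s t, ν => ∃ q r, s.eval g ν = Sum.inr q ∧ t.eval g ν = Sum.inr r ∧ q ≤ r
  | .eq s t, ν => s.eval g ν = t.eval g ν
  | .mem t i, ν => t.eval g ν ∈ X i
  | .input0 ψ, _ => ψ.Holds g.input ![] (fun i => Sum.inl ⁻¹' X i)
  | .input1 ψ t, ν => ∃ p, t.eval g ν = Sum.inl p ∧
      ψ.Holds g.input ![p] (fun i => Sum.inl ⁻¹' X i)
  | .input2 ψ s t, ν => ∃ p r, s.eval g ν = Sum.inl p ∧ t.eval g ν = Sum.inl r ∧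
      ψ.Holds g.input ![p, r] (fun i => Sum.inl ⁻¹' X i)
  | .neg φ, ν => ¬ φ.Holds g X ν
  | .and φ ψ, ν => φ.Holds g X ν ∧ ψ.Holds g X ν
  | .ex x φ, ν => ∃ p : g.Pos, φ.Holds g X (Function.update ν x p)

/-- Sentences of `L_T`. -/
structure LTSentence (A B : Type*) where
  formula : LTFormula A B 0
  closed : formula.freeVars = ∅

/-- The o-transduction defined by an `L_T`-sentence. -/
def LTSentence.oTransduction {A B : Type*} (φ : LTSentence A B) : Set (OGraph A B) :=
  {g | ∀ ν : Fin 2 → g.Pos, φ.formula.Holds g Fin.elim0 ν}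

/-- Sentences `∃ X₁ … ∃ Xₙ φ` of `∃L_T`. -/
structure ELTSentence (A B : Type*) where
  numSets : ℕ
  formula : LTFormula A B numSets
  closed : formula.freeVars = ∅

/-- The o-transduction defined by an `∃L_T`-sentence; the second-order variables range over sets of
input and output positions. -/
def ELTSentence.oTransduction {A B : Type*} (φ : ELTSentence A B) : Set (OGraph A B) :=
  {g | ∃ X : Fin φ.numSets → Set g.Pos, ∀ ν : Fin 2 → g.Pos, φ.formula.Holds g X ν}

/-- Gödel numbers of MSO formulas over the alphabet `Fin k`. -/
def WordMSO.code {k : ℕ} : {n m : ℕ} → WordMSO (Fin k) n m → ℕ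
  | _, _, .letter a x => Nat.pair 1 (Nat.pair a x)
  | _, _, .le x y => Nat.pair 2 (Nat.pair x y)
  | _, _, .eq x y => Nat.pair 3 (Nat.pair x y)
  | _, _, .mem x i => Nat.pair 4 (Nat.pair x i)
  | _, _, .neg φ => Nat.pair 5 φ.code
  | _, _, .and φ ψ => Nat.pair 6 (Nat.pair φ.code ψ.code)
  | _, _, .ex φ => Nat.pair 7 φ.code
  | _, _, .exSet φ => Nat.pair 8 φ.code

/-- Gödel numbers of terms. -/
def LTTerm.code : LTTerm → ℕ
  | .var x => Nat.pair 1 x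
  | .orig t => Nat.pair 2 t.code

/-- Gödel numbers of formulas over the input alphabet `Fin k` and the output alphabet `Fin m`. -/
def LTFormula.code {k m n : ℕ} : LTFormula (Fin k) (Fin m) n → ℕ
  | .letter b t => Nat.pair 1 (Nat.pair b t.code)
  | .leOut s t => Nat.pair 2 (Nat.pair s.code t.code)
  | .eq s t => Nat.pair 3 (Nat.pair s.code t.code)
  | .mem t i => Nat.pair 4 (Nat.pair t.code i)
  | .input0 ψ => Nat.pair 5 ψ.code
  | .input1 ψ t => Nat.pair 6 (Nat.pair ψ.code t.code)
  | .input2 ψ s t => Nat.pair 7 (Nat.pair ψ.code (Nat.pair s.code t.code))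
  | .neg φ => Nat.pair 8 φ.code
  | .and φ ψ => Nat.pair 9 (Nat.pair φ.code ψ.code)
  | .ex x φ => Nat.pair 10 (Nat.pair x φ.code)

/-- The Gödel number of an `L_T`-sentence, which also records the sizes of the alphabets. -/
def LTSentence.code {k m : ℕ} (φ : LTSentence (Fin k) (Fin m)) : ℕ :=
  Nat.pair k (Nat.pair m φ.formula.code)

/-- The Gödel number of an `∃L_T`-sentence, which also records the sizes of the alphabets and the
number of second-order variables. -/
def ELTSentence.code {k m : ℕ} (φ : ELTSentence (Fin k) (Fin m)) : ℕ :=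
  Nat.pair k (Nat.pair m (Nat.pair φ.numSets φ.formula.code))

/-- A finite automaton written down as a finite object: the list of its initial states, the list of
its transitions `(source, letter, target)` and the list of its accepting states. -/
abbrev AutomatonTable : Type := List ℕ × List (ℕ × ℕ × ℕ) × List ℕ

/-- The automaton over the alphabet `Fin k` described by a table. Only the finitely many states
that the table mentions matter. -/
def AutomatonTable.toNFA (T : AutomatonTable) (k : ℕ) : NFA (Fin k) ℕ where
  step p a := {q | (p, (a : ℕ), q) ∈ T.2.1}
  start := {q | q ∈ T.1}
  accept := {q | q ∈ T.2.2}

/-!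
The input domain of a sentence `∃ X₁ … ∃ Xₙ φ` is regular because it has finitely many left
quotients, and an automaton for it is computable because the number of left quotients is bounded by
a computable function of the sentence.

*Finitely many left quotients.* A model over the input word `u ++ v` splits into a left part over
`u` and a right part over `v`, each with the output positions that have their origin in it; only the
output order interleaves the two parts. Elements are put into finitely many classes, which record
the subformulas of `φ` that hold at the element, its labels, and the MSO type of its part of the
input word with its origin marked. The state of the model at the cut consists of the MSO types of
the two parts and of the order in which the first and the last elements of the classes occur in the
output. If two models have the same state, the left part of the one and the right part of the other
can be put together to a model: by `exists_amalgamated_rank` their output orders can be merged such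
that every comparison with an element of a part that was dropped is still witnessed by an element of
the same class. As two variables see only two elements at a time, this suffices for the truth of `φ`
(`LTFormula.sat_iff_of_match`, `LTFormula.exists_rank_of_recombination`). The MSO predicates enter
through the composition theorem `WordMSO.finIndex_satIn`. So the left quotient by `u` depends only
on whether `u` is empty and on the set of states that models over extensions of `u` have at the cut
(`LTFormula.finIndex_domain`), and regularity follows from the Myhill–Nerode theorem.

*Computing an automaton.* By the same back-and-forth argument, among the output positions with the
same origin and the same type only the first and the last are needed, so that every word in the
domain has an output of bounded length (`LTFormula.exists_output_length_le`). Hence membership in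
the domain is decidable: `InDomain` searches through the finitely many candidates, on which formulas
are evaluated by recursion on Gödel numbers (`MSONode.eval`, `LTNode.eval`). Let `N` be the computed
bound on the number of left quotients. The automaton sought can be taken to have at most `N`
states, and any such automaton has at most `2 ^ N` left quotients. If it agrees with the domain on
the words of length at most `N * 2 ^ N`, it recognises the domain, since in a shortest word on which
the two differ a factor could be cut out (`Language.eq_of_finIndex`). Agreement on these words can
be tested, so that `searchAutomaton` finds an automaton by unbounded search.
-/

/-! ### Relations of finite index -/

/-- The relation `R` has at most `N` distinct rows: there is a classification of the row indices
into `N` classes such that equally classified indices have the same row. For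
`R u v := u ++ v ∈ L` the rows are the left quotients of the language `L`. -/
def FinIndex {U V : Type*} (N : ℕ) (R : U → V → Prop) : Prop :=
  ∃ f : U → Fin N, ∀ a a', f a = f a' → ∀ b, R a b ↔ R a' b

namespace FinIndex

variable {U V U' V' : Type*} {N M : ℕ} {R : U → V → Prop} {R' : U → V → Prop}

theorem of_fintype {T : Type*} [Fintype T] (f : U → T) (hN : Fintype.card T ≤ N)
    (h : ∀ a a', f a = f a' → ∀ b, R a b ↔ R a' b) : FinIndex N R := by
  refine ⟨fun a => Fin.castLE hN (Fintype.equivFin T (f a)), fun a a' haa b => h a a' ?_ b⟩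
  simpa using haa

theorem of_finite {T : Type*} [Finite T] (f : U → T) (hN : Nat.card T ≤ N)
    (h : ∀ a a', f a = f a' → ∀ b, R a b ↔ R a' b) : FinIndex N R := by
  have := Fintype.ofFinite T
  exact of_fintype f (by rwa [← Nat.card_eq_fintype_card]) h

theorem mono (h : FinIndex N R) (hNM : N ≤ M) : FinIndex M R := by
  obtain ⟨f, hf⟩ := h
  exact of_fintype f (by simpa using hNM) hf

theorem congr (h : FinIndex N R) (hR : ∀ a b, R' a b ↔ R a b) : FinIndex N R' := by
  obtain ⟨f, hf⟩ := h
  exact ⟨f, fun a a' haa b => by rw [hR, hR, hf a a' haa]⟩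

theorem neg (h : FinIndex N R) : FinIndex N fun a b => ¬ R a b := by
  obtain ⟨f, hf⟩ := h
  exact ⟨f, fun a a' haa b => not_congr (hf a a' haa b)⟩

theorem and (h : FinIndex N R) (h' : FinIndex M R') :
    FinIndex (N * M) fun a b => R a b ∧ R' a b := by
  obtain ⟨f, hf⟩ := h
  obtain ⟨g, hg⟩ := h'
  refine of_fintype (fun a => (f a, g a)) (by simp) fun a a' haa b => ?_
  simp only [Prod.mk.injEq] at haa
  rw [hf a a' haa.1, hg a a' haa.2]

theorem or (h : FinIndex N R) (h' : FinIndex M R') :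
    FinIndex (N * M) fun a b => R a b ∨ R' a b :=
  (h.neg.and h'.neg).neg.congr fun a b => by tauto

/-- Projection: the class of `a` is the set of the classes of the possible witnesses over `a`. -/
theorem ex {I : U → Type*} {J : V → Type*} {i : (a : U) → I a → U'} {j : (b : V) → J b → V'}
    {R : U' → V' → Prop} (h : FinIndex N R) :
    FinIndex (2 ^ N) fun a b => ∃ x y, R (i a x) (j b y) := by
  obtain ⟨f, hf⟩ := h
  refine of_fintype (fun a => {t : Fin N | ∃ x, f (i a x) = t}) (by simp) ?_
  have key : ∀ a a', {t : Fin N | ∃ x, f (i a x) = t} = {t : Fin N | ∃ x, f (i a' x) = t} →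
      ∀ b, (∃ x y, R (i a x) (j b y)) → ∃ x y, R (i a' x) (j b y) := by
    rintro a a' haa b ⟨x, y, hxy⟩
    obtain ⟨x', hx'⟩ : f (i a x) ∈ {t : Fin N | ∃ x, f (i a' x) = t} := haa ▸ ⟨x, rfl⟩
    exact ⟨x', y, (hf _ _ hx' _).2 hxy⟩
  exact fun a a' haa b => ⟨key a a' haa b, key a' a haa.symm b⟩

theorem exRight {J : V → Type*} {i : U → U'} {j : (b : V) → J b → V'} {R : U' → V' → Prop}
    (h : FinIndex N R) : FinIndex N fun a b => ∃ y, R (i a) (j b y) := by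
  obtain ⟨f, hf⟩ := h
  exact ⟨fun a => f (i a), fun a a' haa b => exists_congr fun y => hf _ _ haa _⟩

end FinIndex

/-! ### Composition of monadic second-order types -/

/-- A labelled relational structure over the signature of words, with a valuation of set variables
and a partial valuation of first-order variables. The valuation is partial so that the variables
can be distributed over the two factors of a concatenation. -/
structure MSOStruct (A : Type*) (n m : ℕ) where
  P : Type
  lab : P → A
  le : P → P → Prop
  var : Fin n → Option P
  set : Fin m → Set P

/-- Satisfaction of MSO formulas under a partial valuation; atomic formulas about undefined
variables are false. -/
def WordMSO.Sat {A P : Type*} (lab : P → A) (le : P → P → Prop) : {n m : ℕ} → WordMSO A n m →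
    (Fin n → Option P) → (Fin m → Set P) → Prop
  | _, _, .letter a x, ν, _ => ∃ p, ν x = some p ∧ lab p = a
  | _, _, .le x y, ν, _ => ∃ p q, ν x = some p ∧ ν y = some q ∧ le p q
  | _, _, .eq x y, ν, _ => ∃ p, ν x = some p ∧ ν y = some p
  | _, _, .mem x i, ν, S => ∃ p, ν x = some p ∧ p ∈ S i
  | _, _, .neg φ, ν, S => ¬ φ.Sat lab le ν S
  | _, _, .and φ ψ, ν, S => φ.Sat lab le ν S ∧ ψ.Sat lab le ν S
  | _, _, .ex φ, ν, S => ∃ p : P, φ.Sat lab le (Fin.cons (some p) ν) S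
  | _, _, .exSet φ, ν, S => ∃ Z : Set P, φ.Sat lab le ν (Fin.cons Z S)

theorem Fin.comp_cons_eq {α β : Type*} {n : ℕ} (f : α → β) (x : α) (ν : Fin n → α) :
    (fun i => f ((Fin.cons x ν : Fin (n + 1) → α) i)) =
      (Fin.cons (f x) (fun i => f (ν i)) : Fin (n + 1) → β) := by
  funext i
  cases i using Fin.cases <;> rfl

theorem WordMSO.holds_iff_sat {A : Type*} (u : List A) {n m : ℕ} (φ : WordMSO A n m) :
    ∀ (ν : Fin n → Fin u.length) (S : Fin m → Set (Fin u.length)),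
      φ.Holds u ν S ↔ φ.Sat u.get (· ≤ ·) (fun i => some (ν i)) S := by
  induction φ with
  | letter a x => intro ν S; simp [Holds, Sat]
  | le x y => intro ν S; simp [Holds, Sat]
  | eq x y => intro ν S; simp [Holds, Sat, eq_comm]
  | mem x i => intro ν S; simp [Holds, Sat]
  | neg φ ih => intro ν S; simp [Holds, Sat, ih]
  | and φ ψ ih ih' => intro ν S; simp [Holds, Sat, ih, ih']
  | ex φ ih => intro ν S; simp [Holds, Sat, ih, Fin.comp_cons_eq]
  | exSet φ ih => intro ν S; simp [Holds, Sat, ih]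

/-- Satisfaction is invariant under isomorphism. -/
theorem WordMSO.sat_equiv {A P P' : Type*} {lab : P → A} {le : P → P → Prop} {lab' : P' → A}
    {le' : P' → P' → Prop} (e : P ≃ P') (hlab : ∀ p, lab' (e p) = lab p)
    (hle : ∀ p q, le' (e p) (e q) ↔ le p q) {n m : ℕ} (φ : WordMSO A n m) :
    ∀ (ν : Fin n → Option P) (S : Fin m → Set P),
      φ.Sat lab le ν S ↔
        φ.Sat lab' le' (fun i => (ν i).map e) (fun i => {p | e.symm p ∈ S i}) := by
  induction φ with
  | letter a x => intro ν S; simp [Sat, hlab]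
  | le x y => intro ν S; simp [Sat, hle]
  | eq x y =>
    intro ν S
    simp only [Sat, Option.map_eq_some_iff]
    constructor
    · rintro ⟨p, h, h'⟩
      exact ⟨e p, ⟨p, h, rfl⟩, p, h', rfl⟩
    · rintro ⟨_, ⟨p, h, rfl⟩, q, h', hq⟩
      obtain rfl := e.injective hq
      exact ⟨_, h, h'⟩
  | mem x i => intro ν S; simp [Sat]
  | neg φ ih => intro ν S; simp only [Sat]; rw [ih]
  | and φ ψ ih ih' => intro ν S; simp only [Sat]; rw [ih, ih']
  | ex φ ih =>
    intro ν S
    simp only [Sat]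
    rw [← e.exists_congr_right]
    refine exists_congr fun p => ?_
    rw [ih, Fin.comp_cons_eq (Option.map e)]
    rfl
  | exSet φ ih =>
    intro ν S
    simp only [Sat]
    rw [← (Equiv.Set.congr e).exists_congr_right]
    refine exists_congr fun Z => ?_
    rw [ih, Fin.comp_cons_eq (fun Z : Set P => {p | e.symm p ∈ Z})]
    have : {p | e.symm p ∈ Z} = Equiv.Set.congr e Z := by
      ext p
      simp [Equiv.Set.congr_apply, Set.mem_image_equiv]
    rw [this]

namespace MSOStruct

variable {A : Type*} {n m k : ℕ}

/-- The concatenation: every position of the first factor precedes those of the second. -/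
def append (a b : MSOStruct A n m) : MSOStruct A n m where
  P := a.P ⊕ b.P
  lab := Sum.elim a.lab b.lab
  le := Sum.Lex a.le b.le
  var x := (a.var x).map Sum.inl <|> (b.var x).map Sum.inr
  set i := {p | Sum.elim (· ∈ a.set i) (· ∈ b.set i) p}

/-- Renaming of first-order variables. -/
def reindex (a : MSOStruct A n m) (i : Fin k → Fin n) : MSOStruct A k m :=
  { a with var := fun x => a.var (i x) }

/-- Extension by a value of a new first-order variable. -/
def consVar (a : MSOStruct A n m) (p : Option a.P) : MSOStruct A (n + 1) m :=
  { a with var := Fin.cons p a.var }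

/-- Extension by a value of a new set variable. -/
def consSet (a : MSOStruct A n m) (Z : Set a.P) : MSOStruct A n (m + 1) :=
  { a with set := Fin.cons Z a.set }

end MSOStruct

/-- Satisfaction of an MSO formula in a structure with valuation. -/
def WordMSO.SatIn {A : Type*} {n m : ℕ} (φ : WordMSO A n m) (a : MSOStruct A n m) : Prop :=
  φ.Sat a.lab a.le a.var a.set

/-- A bound for the number of types with respect to a formula that the first factor of a
concatenation can have. For an atomic formula three truth values determine the type, which gives
the bound `2 ^ 3`. -/
def WordMSO.index {A : Type*} : {n m : ℕ} → WordMSO A n m → ℕ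
  | _, _, .letter _ _ => 8
  | _, _, .le _ _ => 8
  | _, _, .eq _ _ => 8
  | _, _, .mem _ _ => 8
  | _, _, .neg φ => φ.index
  | _, _, .and φ ψ => φ.index * ψ.index
  | _, _, .ex φ => 2 ^ φ.index * φ.index
  | _, _, .exSet φ => 2 ^ φ.index

theorem WordMSO.satIn_congr {A : Type*} {n m : ℕ} (φ : WordMSO A n m) {a b : MSOStruct A n m}
    (h : a = b) : φ.SatIn a ↔ φ.SatIn b := by rw [h]

namespace MSOStruct

variable {A : Type*} {n m : ℕ}

theorem consVar_append_left (a b : MSOStruct A n m) (p : a.P) :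
    (a.append b).consVar (some (Sum.inl p)) = (a.consVar (some p)).append (b.consVar none) := by
  simp only [append, consVar, mk.injEq, heq_eq_eq, true_and]
  refine ⟨?_, rfl⟩
  funext x
  cases x using Fin.cases <;> rfl

theorem consVar_append_right (a b : MSOStruct A n m) (p : b.P) :
    (a.append b).consVar (some (Sum.inr p)) = (a.consVar none).append (b.consVar (some p)) := by
  simp only [append, consVar, mk.injEq, heq_eq_eq, true_and]
  refine ⟨?_, rfl⟩
  funext x
  cases x using Fin.cases <;> rfl

theorem consSet_append (a b : MSOStruct A n m) (Z : Set (a.P ⊕ b.P)) :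
    (a.append b).consSet Z =
      (a.consSet (Sum.inl ⁻¹' Z)).append (b.consSet (Sum.inr ⁻¹' Z)) := by
  simp only [append, consSet, mk.injEq, heq_eq_eq, true_and]
  refine ⟨rfl, ?_⟩
  funext x
  ext p
  cases x using Fin.cases <;> cases p <;> rfl

end MSOStruct

/-- The composition theorem for monadic second-order logic: whether a concatenation satisfies a
formula depends on the first factor only through one of finitely many types. -/
theorem WordMSO.finIndex_satIn {A : Type*} {n m : ℕ} (φ : WordMSO A n m) :
    FinIndex φ.index fun a b : MSOStruct A n m => φ.SatIn (a.append b) := by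
  classical
  induction φ with
  | letter c x =>
    refine FinIndex.of_fintype (T := Prop × Prop × Prop)
      (fun a => ((a.var x = none), (∃ p, a.var x = some p ∧ a.lab p = c), True)) (by simp [index]) ?_
    intro a a' h b
    simp only [Prod.mk.injEq, eq_iff_iff, and_true] at h
    have key : ∀ a : MSOStruct A _ _, SatIn (.letter c x) (a.append b) ↔
        (∃ p, a.var x = some p ∧ a.lab p = c) ∨
          (a.var x = none ∧ ∃ p, b.var x = some p ∧ b.lab p = c) := by
      intro a
      cases ha : a.var x <;> cases hb : b.var x <;>
        simp [SatIn, Sat, MSOStruct.append, ha, hb]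
    rw [key, key, h.1, h.2]
  | le x y =>
    refine FinIndex.of_fintype (T := Prop × Prop × Prop)
      (fun a => ((a.var x = none), (a.var y = none),
        (∃ p q, a.var x = some p ∧ a.var y = some q ∧ a.le p q))) (by simp [index]) ?_
    intro a a' h b
    simp only [Prod.mk.injEq, eq_iff_iff] at h
    have key : ∀ a : MSOStruct A _ _, SatIn (.le x y) (a.append b) ↔
        (∃ p q, a.var x = some p ∧ a.var y = some q ∧ a.le p q) ∨
          (¬ a.var x = none ∧ a.var y = none ∧ b.var y ≠ none) ∨
          (a.var x = none ∧ a.var y = none ∧ ∃ p q, b.var x = some p ∧ b.var y = some q ∧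
            b.le p q) := by
      intro a
      cases ha : a.var x <;> cases hb : b.var x <;> cases ha' : a.var y <;> cases hb' : b.var y <;>
        simp [SatIn, Sat, MSOStruct.append, ha, hb, ha', hb']
    rw [key, key, h.1, h.2.1, h.2.2]
  | eq x y =>
    refine FinIndex.of_fintype (T := Prop × Prop × Prop)
      (fun a => ((a.var x = none), (a.var y = none),
        (∃ p, a.var x = some p ∧ a.var y = some p))) (by simp [index]) ?_
    intro a a' h b
    simp only [Prod.mk.injEq, eq_iff_iff] at h
    have key : ∀ a : MSOStruct A _ _, SatIn (.eq x y) (a.append b) ↔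
        (∃ p, a.var x = some p ∧ a.var y = some p) ∨
          (a.var x = none ∧ a.var y = none ∧ ∃ p, b.var x = some p ∧ b.var y = some p) := by
      intro a
      cases ha : a.var x <;> cases hb : b.var x <;> cases ha' : a.var y <;> cases hb' : b.var y <;>
        simp [SatIn, Sat, MSOStruct.append, ha, hb, ha', hb']
    rw [key, key, h.1, h.2.1, h.2.2]
  | mem x i =>
    refine FinIndex.of_fintype (T := Prop × Prop × Prop)
      (fun a => ((a.var x = none), (∃ p, a.var x = some p ∧ p ∈ a.set i), True))
      (by simp [index]) ?_
    intro a a' h b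
    simp only [Prod.mk.injEq, eq_iff_iff, and_true] at h
    have key : ∀ a : MSOStruct A _ _, SatIn (.mem x i) (a.append b) ↔
        (∃ p, a.var x = some p ∧ p ∈ a.set i) ∨
          (a.var x = none ∧ ∃ p, b.var x = some p ∧ p ∈ b.set i) := by
      intro a
      cases ha : a.var x <;> cases hb : b.var x <;>
        simp [SatIn, Sat, MSOStruct.append, ha, hb] <;> rfl
    rw [key, key, h.1, h.2]
  | neg φ ih => exact ih.neg
  | and φ ψ ih ih' => exact ih.and ih'
  | ex φ ih =>
    refine ((ih.ex (U := MSOStruct A _ _) (V := MSOStruct A _ _) (I := fun a => a.P)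
      (J := fun _ => Unit) (i := fun a p => a.consVar (some p))
      (j := fun b _ => b.consVar none)).or
      (ih.exRight (J := fun b => b.P) (i := fun a => a.consVar none)
        (j := fun b p => b.consVar (some p)))).congr fun a b => ?_
    -- The witness lies in the first or in the second factor.
    change (∃ p : a.P ⊕ b.P, φ.SatIn ((a.append b).consVar (some p))) ↔ _
    rw [Sum.exists]
    simp only [MSOStruct.consVar_append_left, MSOStruct.consVar_append_right, exists_const]
  | exSet φ ih =>
    refine (ih.ex (U := MSOStruct A _ _) (V := MSOStruct A _ _) (I := fun a => Set a.P)
      (J := fun b => Set b.P) (i := fun a p => a.consSet p)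
      (j := fun b p => b.consSet p)).congr fun a b => ?_
    change (∃ Z : Set (a.P ⊕ b.P), φ.SatIn ((a.append b).consSet Z)) ↔ _
    simp only [MSOStruct.consSet_append]
    constructor
    · rintro ⟨Z, h⟩
      exact ⟨_, _, h⟩
    · rintro ⟨Z, Z', h⟩
      refine ⟨{p | Sum.elim (· ∈ Z) (· ∈ Z') p}, ?_⟩
      exact h

/-! ### Two-variable formulas in abstract origin structures -/

/-- An origin-graph without its output order: sets `P` and `Q` of input and output positions with
their labels, an order on `P`, the origin mapping and an interpretation of `n` set variables. The
output order is supplied separately, by a ranking of `Q` in a linear order. -/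
structure OriginStruct (A B : Type*) (n : ℕ) where
  P : Type
  Q : Type
  lab : P → A
  le : P → P → Prop
  olab : Q → B
  orig : Q → P
  X : Fin n → Set (P ⊕ Q)

namespace OriginStruct

variable {A B : Type*} {n : ℕ}

/-- The universe: input and output positions. -/
abbrev Pos (M : OriginStruct A B n) : Type := M.P ⊕ M.Q

/-- The input position to which an element belongs. -/
def origPos (M : OriginStruct A B n) : M.Pos → M.P := Sum.elim id M.orig

/-- The input word with a partial valuation, seen as a structure for MSO. -/
def mso {k : ℕ} (M : OriginStruct A B n) (ν : Fin k → Option M.P) : MSOStruct A k n where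
  P := M.P
  lab := M.lab
  le := M.le
  var := ν
  set i := Sum.inl ⁻¹' M.X i

/-- The properties of a single element that are visible to the atomic formulas other than the MSO
predicates: the output label (if it is an output position) and the set variables that contain the
element and its origin. -/
def loc (M : OriginStruct A B n) (e : M.Pos) : Option B × (Fin n → Prop) × (Fin n → Prop) :=
  (Sum.elim (fun _ => none) (fun q => some (M.olab q)) e, fun i => e ∈ M.X i,
    fun i => Sum.inl (M.origPos e) ∈ M.X i)

end OriginStruct

/-- The value of a term in an origin structure. -/
def LTTerm.val {A B : Type*} {n : ℕ} (M : OriginStruct A B n) (ν : Fin 2 → M.Pos) :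
    LTTerm → M.Pos
  | .var x => ν x
  | .orig t => Sum.inl (M.origPos (t.val M ν))

namespace LTFormula

variable {A B : Type*} {n : ℕ} {Λ Λ' : Type*} [LinearOrder Λ] [LinearOrder Λ']

/-- Satisfaction in an origin structure whose output order is given by the ranking `rk`. -/
def Sat (M : OriginStruct A B n) (rk : M.Q → Λ) : LTFormula A B n → (Fin 2 → M.Pos) → Prop
  | .letter b t, ν => ∃ q, t.val M ν = Sum.inr q ∧ M.olab q = b
  | .leOut s t, ν => ∃ q r, s.val M ν = Sum.inr q ∧ t.val M ν = Sum.inr r ∧ rk q ≤ rk r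
  | .eq s t, ν => s.val M ν = t.val M ν
  | .mem t i, ν => t.val M ν ∈ M.X i
  | .input0 ψ, _ => ψ.SatIn (M.mso ![])
  | .input1 ψ t, ν => ∃ p, t.val M ν = Sum.inl p ∧ ψ.SatIn (M.mso ![some p])
  | .input2 ψ s t, ν => ∃ p r, s.val M ν = Sum.inl p ∧ t.val M ν = Sum.inl r ∧
      ψ.SatIn (M.mso ![some p, some r])
  | .neg φ, ν => ¬ φ.Sat M rk ν
  | .and φ ψ, ν => φ.Sat M rk ν ∧ ψ.Sat M rk ν
  | .ex x φ, ν => ∃ p, φ.Sat M rk (Function.update ν x p)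

/-- The list of subformulas. -/
def subs : LTFormula A B n → List (LTFormula A B n)
  | .neg φ => .neg φ :: φ.subs
  | .and φ ψ => .and φ ψ :: (φ.subs ++ ψ.subs)
  | .ex x φ => .ex x φ :: φ.subs
  | φ => [φ]

theorem self_mem_subs (φ : LTFormula A B n) : φ ∈ φ.subs := by cases φ <;> simp [subs]

theorem mem_subs_of_neg {φ χ : LTFormula A B n} (h : χ.neg ∈ φ.subs) : χ ∈ φ.subs := by
  induction φ with
  | neg φ ih =>
    simp only [subs, List.mem_cons, neg.injEq] at h ⊢
    rcases h with rfl | h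
    · exact Or.inr (self_mem_subs _)
    · exact Or.inr (ih h)
  | and φ ψ ih ih' =>
    simp only [subs, List.mem_cons, reduceCtorEq, List.mem_append, false_or] at h ⊢
    exact Or.inr (h.imp ih ih')
  | ex x φ ih =>
    simp only [subs, List.mem_cons, reduceCtorEq, false_or] at h ⊢
    exact Or.inr (ih h)
  | _ => simp [subs] at h

theorem mem_subs_of_and {φ χ χ' : LTFormula A B n} (h : χ.and χ' ∈ φ.subs) :
    χ ∈ φ.subs ∧ χ' ∈ φ.subs := by
  induction φ with
  | neg φ ih =>
    simp only [subs, List.mem_cons, reduceCtorEq, false_or] at h ⊢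
    exact ⟨Or.inr (ih h).1, Or.inr (ih h).2⟩
  | and φ ψ ih ih' =>
    simp only [subs, List.mem_cons, and.injEq, List.mem_append] at h ⊢
    rcases h with ⟨rfl, rfl⟩ | h | h
    · exact ⟨Or.inr (Or.inl (self_mem_subs _)), Or.inr (Or.inr (self_mem_subs _))⟩
    · exact ⟨Or.inr (Or.inl (ih h).1), Or.inr (Or.inl (ih h).2)⟩
    · exact ⟨Or.inr (Or.inr (ih' h).1), Or.inr (Or.inr (ih' h).2)⟩
  | ex x φ ih =>
    simp only [subs, List.mem_cons, reduceCtorEq, false_or] at h ⊢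
    exact ⟨Or.inr (ih h).1, Or.inr (ih h).2⟩
  | _ => simp [subs] at h

theorem mem_subs_of_ex {φ χ : LTFormula A B n} {x : Fin 2} (h : χ.ex x ∈ φ.subs) :
    χ ∈ φ.subs := by
  induction φ with
  | neg φ ih =>
    simp only [subs, List.mem_cons, reduceCtorEq, false_or] at h ⊢
    exact Or.inr (ih h)
  | and φ ψ ih ih' =>
    simp only [subs, List.mem_cons, reduceCtorEq, List.mem_append, false_or] at h ⊢
    exact Or.inr (h.imp ih ih')
  | ex y φ ih =>
    simp only [subs, List.mem_cons, ex.injEq] at h ⊢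
    rcases h with ⟨rfl, rfl⟩ | h
    · exact Or.inr (self_mem_subs _)
    · exact Or.inr (ih h)
  | _ => simp [subs] at h

/-- For an atom `{ψ}(s, t)`, the truth of `ψ` at the origins of the variables of `s` and `t`; no
condition for other formulas. -/
def InputSat : LTFormula A B n → MSOStruct A 2 n → Prop
  | .input0 ψ, a => ψ.SatIn (a.reindex ![])
  | .input1 ψ t, a => ψ.SatIn (a.reindex ![t.fvar])
  | .input2 ψ s t, a => ψ.SatIn (a.reindex ![s.fvar, t.fvar])
  | _, _ => True

end LTFormula

section Agreement

variable {A B : Type*} {n : ℕ} {Λ Λ' : Type*} [LinearOrder Λ] [LinearOrder Λ']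

/-- As origins are input positions, a term is a variable or denotes the origin of its variable. -/
theorem LTTerm.val_eq (t : LTTerm) :
    t = .var t.fvar ∨ ∀ (M : OriginStruct A B n) (ν : Fin 2 → M.Pos),
      t.val M ν = Sum.inl (M.origPos (ν t.fvar)) := by
  induction t with
  | var x => exact Or.inl rfl
  | orig t ih =>
    refine Or.inr fun M ν => ?_
    rcases ih with ih | ih
    · rw [ih]; rfl
    · simp only [val, fvar, ih]; rfl

theorem LTTerm.origPos_val (t : LTTerm) (M : OriginStruct A B n) (ν : Fin 2 → M.Pos) :
    M.origPos (t.val M ν) = M.origPos (ν t.fvar) := by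
  rcases t.val_eq (A := A) (B := B) (n := n) with ih | ih
  · rw [ih]; rfl
  · rw [ih]; rfl

/-- The pairs `ν` and `μ` of elements of two origin structures have the same atomic type, as far as
MSO predicates of the formulas in `Φ` are concerned. -/
structure AtomAgree (Φ : List (LTFormula A B n)) {M M' : OriginStruct A B n} (rk : M.Q → Λ)
    (rk' : M'.Q → Λ') (ν : Fin 2 → M.Pos) (μ : Fin 2 → M'.Pos) : Prop where
  loc : ∀ x, M.loc (ν x) = M'.loc (μ x)
  eq : ν 0 = ν 1 ↔ μ 0 = μ 1
  orig : M.origPos (ν 0) = M.origPos (ν 1) ↔ M'.origPos (μ 0) = M'.origPos (μ 1)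
  rank : ∀ x y q r q' r', ν x = Sum.inr q → ν y = Sum.inr r → μ x = Sum.inr q' →
    μ y = Sum.inr r' → (rk q ≤ rk r ↔ rk' q' ≤ rk' r')
  input : ∀ χ ∈ Φ, χ.InputSat (M.mso fun x => some (M.origPos (ν x))) ↔
    χ.InputSat (M'.mso fun x => some (M'.origPos (μ x)))

namespace AtomAgree

variable {Φ : List (LTFormula A B n)} {M M' : OriginStruct A B n} {rk : M.Q → Λ}
    {rk' : M'.Q → Λ'} {ν : Fin 2 → M.Pos} {μ : Fin 2 → M'.Pos}

theorem loc_val (h : AtomAgree Φ rk rk' ν μ) (t : LTTerm) :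
    M.loc (t.val M ν) = M'.loc (t.val M' μ) := by
  rcases t.val_eq (A := A) (B := B) (n := n) with ht | ht
  · rw [ht]; exact h.loc _
  · rw [ht, ht]
    have := h.loc t.fvar
    simp only [OriginStruct.loc, Prod.mk.injEq] at this ⊢
    exact ⟨rfl, this.2.2, this.2.2⟩

theorem eq_all (h : AtomAgree Φ rk rk' ν μ) (x y : Fin 2) : ν x = ν y ↔ μ x = μ y := by
  fin_cases x <;> fin_cases y <;> simp [h.eq, eq_comm]

theorem orig_all (h : AtomAgree Φ rk rk' ν μ) (x y : Fin 2) :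
    M.origPos (ν x) = M.origPos (ν y) ↔ M'.origPos (μ x) = M'.origPos (μ y) := by
  fin_cases x <;> fin_cases y <;> simp [h.orig, eq_comm]

theorem val_isLeft (h : AtomAgree Φ rk rk' ν μ) (t : LTTerm) :
    (t.val M ν).isLeft = (t.val M' μ).isLeft := by
  have := congrArg Prod.fst (h.loc_val t)
  simp only [OriginStruct.loc] at this
  generalize t.val M ν = e at *
  generalize t.val M' μ = e' at *
  cases e <;> cases e' <;> simp_all

theorem val_eq_iff (h : AtomAgree Φ rk rk' ν μ) (s t : LTTerm) :
    s.val M ν = t.val M ν ↔ s.val M' μ = t.val M' μ := by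
  have hs := h.val_isLeft s
  have ht := h.val_isLeft t
  -- Two input positions are equal if and only if their origins are.
  have key : ∀ (N : OriginStruct A B n) (e e' : N.Pos), e.isLeft = true → e'.isLeft = true →
      (e = e' ↔ N.origPos e = N.origPos e') := by
    rintro N (e | e) (e' | e') h h' <;> simp_all [OriginStruct.origPos]
  by_cases h1 : (s.val M ν).isLeft = true <;> by_cases h2 : (t.val M ν).isLeft = true
  · rw [key _ _ _ h1 h2, key _ _ _ (hs ▸ h1) (ht ▸ h2)]
    simp only [LTTerm.origPos_val]
    exact h.orig_all _ _
  · constructor <;> intro e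
    · rw [e] at h1; exact absurd h1 h2
    · rw [hs, e, ← ht] at h1; exact absurd h1 h2
  · constructor <;> intro e
    · rw [← e] at h2; exact absurd h2 h1
    · rw [ht, ← e, ← hs] at h2; exact absurd h2 h1
  · rcases s.val_eq (A := A) (B := B) (n := n) with hs | hs
    · rcases t.val_eq (A := A) (B := B) (n := n) with ht | ht
      · rw [hs, ht]; exact h.eq_all _ _
      · simp [ht] at h2
    · simp [hs] at h1

theorem sat_letter (h : AtomAgree Φ rk rk' ν μ) (b : B) (t : LTTerm) :
    (LTFormula.letter b t).Sat M rk ν ↔ (LTFormula.letter b t).Sat M' rk' μ := by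
  have := congrArg Prod.fst (h.loc_val t)
  simp only [OriginStruct.loc] at this
  simp only [LTFormula.Sat]
  generalize t.val M ν = e at *
  generalize t.val M' μ = e' at *
  cases e <;> cases e' <;> simp_all

theorem sat_leOut (h : AtomAgree Φ rk rk' ν μ) (s t : LTTerm) :
    (LTFormula.leOut s t).Sat M rk ν ↔ (LTFormula.leOut s t).Sat M' rk' μ := by
  simp only [LTFormula.Sat]
  rcases s.val_eq (A := A) (B := B) (n := n) with hs | hs
  · rcases t.val_eq (A := A) (B := B) (n := n) with ht | ht
    · have h1 := h.val_isLeft s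
      have h2 := h.val_isLeft t
      have h3 := h.rank s.fvar t.fvar
      rw [hs] at h1 ⊢
      rw [ht] at h2 ⊢
      simp only [LTTerm.val] at h1 h2 h3 ⊢
      generalize ν s.fvar = e1 at *
      generalize μ s.fvar = e2 at *
      generalize ν t.fvar = e3 at *
      generalize μ t.fvar = e4 at *
      cases e1 <;> cases e2 <;> cases e3 <;> cases e4 <;> simp_all
    · simp [ht]
  · simp [hs]

theorem sat_mem (h : AtomAgree Φ rk rk' ν μ) (t : LTTerm) (i : Fin n) :
    (LTFormula.mem t i : LTFormula A B n).Sat M rk ν ↔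
      (LTFormula.mem t i : LTFormula A B n).Sat M' rk' μ := by
  have := congrFun (congrArg (fun z => z.2.1) (h.loc_val t)) i
  exact iff_of_eq this

theorem sat_input0 (h : AtomAgree Φ rk rk' ν μ) {ψ : WordMSO A 0 n}
    (hΦ : LTFormula.input0 ψ ∈ Φ) :
    (LTFormula.input0 ψ : LTFormula A B n).Sat M rk ν ↔
      (LTFormula.input0 ψ : LTFormula A B n).Sat M' rk' μ := by
  have := h.input _ hΦ
  simp only [LTFormula.InputSat, LTFormula.Sat] at this ⊢
  convert this using 2 <;> simp [OriginStruct.mso, MSOStruct.reindex] <;> exact Subsingleton.elim _ _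

theorem sat_input1 (h : AtomAgree Φ rk rk' ν μ) {ψ : WordMSO A 1 n} {t : LTTerm}
    (hΦ : LTFormula.input1 ψ t ∈ Φ) :
    (LTFormula.input1 ψ t : LTFormula A B n).Sat M rk ν ↔
      (LTFormula.input1 ψ t : LTFormula A B n).Sat M' rk' μ := by
  have h1 := h.val_isLeft t
  have key : ∀ (N : OriginStruct A B n) (κ : Fin 2 → N.Pos),
      (∃ p, t.val N κ = Sum.inl p ∧ ψ.SatIn (N.mso ![some p])) ↔
        (t.val N κ).isLeft ∧ (LTFormula.input1 ψ t : LTFormula A B n).InputSat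
          (N.mso fun x => some (N.origPos (κ x))) := by
    intro N κ
    have h2 := t.origPos_val N κ
    have h3 : ∀ p, N.mso ![some (N.origPos (κ t.fvar))] =
      (N.mso fun x => some (N.origPos (κ x))).reindex ![p] ↔
        N.origPos (κ t.fvar) = N.origPos (κ p) := by
      intro p
      simp [OriginStruct.mso, MSOStruct.reindex, funext_iff]
    rw [LTFormula.InputSat, ← (h3 _).2 rfl, ← h2]
    cases t.val N κ <;> simp [OriginStruct.origPos]
  simp only [LTFormula.Sat]
  rw [key, key, h1, h.input _ hΦ]

theorem sat_input2 (h : AtomAgree Φ rk rk' ν μ) {ψ : WordMSO A 2 n} {s t : LTTerm}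
    (hΦ : LTFormula.input2 ψ s t ∈ Φ) :
    (LTFormula.input2 ψ s t : LTFormula A B n).Sat M rk ν ↔
      (LTFormula.input2 ψ s t : LTFormula A B n).Sat M' rk' μ := by
  have h1 := h.val_isLeft t
  have h1' := h.val_isLeft s
  have key : ∀ (N : OriginStruct A B n) (κ : Fin 2 → N.Pos),
      (∃ p r, s.val N κ = Sum.inl p ∧ t.val N κ = Sum.inl r ∧
        ψ.SatIn (N.mso ![some p, some r])) ↔
        (s.val N κ).isLeft ∧ (t.val N κ).isLeft ∧
          (LTFormula.input2 ψ s t : LTFormula A B n).InputSat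
            (N.mso fun x => some (N.origPos (κ x))) := by
    intro N κ
    have h2 := t.origPos_val N κ
    have h2' := s.origPos_val N κ
    have h3 : N.mso ![some (N.origPos (κ s.fvar)), some (N.origPos (κ t.fvar))] =
        (N.mso fun x => some (N.origPos (κ x))).reindex ![s.fvar, t.fvar] := by
      simp [OriginStruct.mso, MSOStruct.reindex, funext_iff, Fin.forall_fin_two]
    rw [LTFormula.InputSat, ← h3, ← h2, ← h2']
    cases s.val N κ <;> cases t.val N κ <;> simp [OriginStruct.origPos]
  simp only [LTFormula.Sat]
  rw [key, key, h1, h1', h.input _ hΦ]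

end AtomAgree

/-- The truth of `∃ x, χ` depends only on the value of the other variable, so that it is a property
of a single element. -/
theorem LTFormula.sat_ex_const {M : OriginStruct A B n} {rk : M.Q → Λ} {χ : LTFormula A B n}
    {x : Fin 2} (ν : Fin 2 → M.Pos) :
    (χ.ex x).Sat M rk ν ↔ (χ.ex x).Sat M rk fun _ => ν (1 - x) := by
  simp only [LTFormula.Sat]
  refine exists_congr fun p => iff_of_eq (congrArg _ ?_)
  funext y
  by_cases hy : y = x
  · simp [hy]
  · rw [Function.update_of_ne hy, Function.update_of_ne hy]
    exact congrArg ν (by omega)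

/-- A back-and-forth principle for two variables. Pairs of elements of `H` are matched with pairs
of elements of the structures `M i` that have the same atomic type; single elements are related by
`same` only if they have the same type with respect to `φ`. If every pair has a match, and every
witness available to some relative of an element `h` in the structure where it lives is matched by
a witness for `h` in `H`, then matched pairs satisfy the same subformulas of `φ`. -/
theorem LTFormula.sat_iff_of_match {ι : Type*} (φ : LTFormula A B n) {H : OriginStruct A B n}
    {rk : H.Q → Λ} {M : ι → OriginStruct A B n} {rk' : ∀ i, (M i).Q → Λ'}
    (same : H.Pos → (i : ι) → (M i).Pos → Prop)
    (mtch : (Fin 2 → H.Pos) → (i : ι) → (Fin 2 → (M i).Pos) → Prop)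
    (hatom : ∀ ν i μ, mtch ν i μ → AtomAgree φ.subs rk (rk' i) ν μ)
    (hsame : ∀ ν i μ, mtch ν i μ → ∀ x, same (ν x) i (μ x))
    (htype : ∀ h i g i' g', same h i g → same h i' g' → ∀ χ ∈ φ.subs,
      (χ.Sat (M i) (rk' i) (fun _ => g) ↔ χ.Sat (M i') (rk' i') fun _ => g'))
    (hmatch : ∀ ν, ∃ i μ, mtch ν i μ)
    (hwit : ∀ h, ∃ i g, same h i g ∧ ∀ x g', ∃ p,
      mtch (Function.update (fun _ => h) x p) i (Function.update (fun _ => g) x g')) :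
    ∀ χ ∈ φ.subs, ∀ ν i μ, mtch ν i μ → (χ.Sat H rk ν ↔ χ.Sat (M i) (rk' i) μ) := by
  intro χ
  induction χ with
  | letter b t => exact fun _ ν i μ h => (hatom ν i μ h).sat_letter b t
  | leOut s t => exact fun _ ν i μ h => (hatom ν i μ h).sat_leOut s t
  | eq s t => exact fun _ ν i μ h => (hatom ν i μ h).val_eq_iff s t
  | mem t j => exact fun _ ν i μ h => (hatom ν i μ h).sat_mem t j
  | input0 ψ => exact fun hχ ν i μ h => (hatom ν i μ h).sat_input0 hχ
  | input1 ψ t => exact fun hχ ν i μ h => (hatom ν i μ h).sat_input1 hχ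
  | input2 ψ s t => exact fun hχ ν i μ h => (hatom ν i μ h).sat_input2 hχ
  | neg χ ih => exact fun hχ ν i μ h => not_congr (ih (mem_subs_of_neg hχ) ν i μ h)
  | and χ χ' ih ih' =>
    exact fun hχ ν i μ h => and_congr (ih (mem_subs_of_and hχ).1 ν i μ h)
      (ih' (mem_subs_of_and hχ).2 ν i μ h)
  | ex x χ ih =>
    intro hχ ν i μ h
    have hx : (1 : Fin 2) - x ≠ x := by omega
    constructor
    · rintro ⟨p, hp⟩
      -- The structure that matches the witness may differ from `M i`, but the type of the element
      -- that is kept is the same in both.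
      obtain ⟨i', μ', h'⟩ := hmatch (Function.update ν x p)
      rw [ih (mem_subs_of_ex hχ) _ _ _ h'] at hp
      have h1 : (χ.ex x).Sat (M i') (rk' i') μ' := ⟨μ' x, by simpa using hp⟩
      rw [sat_ex_const] at h1 ⊢
      have h2 := hsame _ _ _ h' (1 - x)
      rw [Function.update_of_ne hx] at h2
      exact (htype _ _ _ _ _ h2 (hsame _ _ _ h (1 - x)) _ hχ).1 h1
    · intro h1
      rw [sat_ex_const] at h1 ⊢
      obtain ⟨i', g, hg, hw⟩ := hwit (ν (1 - x))
      obtain ⟨g', hg'⟩ := (htype _ _ _ _ _ (hsame _ _ _ h (1 - x)) hg _ hχ).1 h1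
      obtain ⟨p, hp⟩ := hw x g'
      exact ⟨p, (ih (mem_subs_of_ex hχ) _ _ _ hp).2 hg'⟩

end Agreement

/-! ### Amalgamation of ranked classes -/

section Amalgamation

variable {C E : Type*}

/-- In a set of elements that carry classes `c` and ranks `rk`, the element `e` has the least rank
(for `n.2 = false`) or the greatest rank (for `n.2 = true`) in the class `n.1`. -/
def IsClassExtreme (c : E → C) (rk : E → ℕ) (n : C × Bool) (e : E) : Prop :=
  c e = n.1 ∧ ∀ e', c e' = n.1 → if n.2 then rk e' ≤ rk e else rk e ≤ rk e'

/-- The comparison of the extreme ranks of the inhabited classes. -/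
def extremeLE (c : E → C) (rk : E → ℕ) (n n' : C × Bool) : Prop :=
  ∃ e e', IsClassExtreme c rk n e ∧ IsClassExtreme c rk n' e' ∧ rk e ≤ rk e'

theorem exists_isClassExtreme [Finite E] (c : E → C) (rk : E → ℕ) (e : E) (b : Bool) :
    ∃ e', IsClassExtreme c rk (c e, b) e' := by
  have hfin : {e' | c e' = c e}.Finite := Set.toFinite _
  cases b with
  | false =>
    obtain ⟨m, hm, hmin⟩ := Set.exists_min_image _ rk hfin ⟨e, rfl⟩
    exact ⟨m, hm, fun e' he' => by simpa using hmin e' he'⟩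
  | true =>
    obtain ⟨m, hm, hmin⟩ := Set.exists_max_image _ rk hfin ⟨e, rfl⟩
    exact ⟨m, hm, fun e' he' => by simpa using hmin e' he'⟩

theorem IsClassExtreme.rk_eq {c : E → C} {rk : E → ℕ} {n : C × Bool} {e e' : E}
    (h : IsClassExtreme c rk n e) (h' : IsClassExtreme c rk n e') : rk e = rk e' := by
  have h1 := h.2 e' h'.1
  have h2 := h'.2 e h.1
  split_ifs at h1 h2 <;> omega

theorem IsClassExtreme.le {c : E → C} {rk : E → ℕ} {n : C} {e e' : E}
    (h : IsClassExtreme c rk (n, false) e) (h' : c e' = n) : rk e ≤ rk e' := by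
  simpa using h.2 e' h'

theorem IsClassExtreme.ge {c : E → C} {rk : E → ℕ} {n : C} {e e' : E}
    (h : IsClassExtreme c rk (n, true) e) (h' : c e' = n) : rk e' ≤ rk e := by
  simpa using h.2 e' h'

variable {E' : Type*} {c : E → C} {rk : E → ℕ} {c' : E' → C} {rk' : E' → ℕ}

theorem IsClassExtreme.exists_of_extremeLE_eq (hρ : extremeLE c rk = extremeLE c' rk') {n : C × Bool}
    {e : E} (h : IsClassExtreme c rk n e) : ∃ e', IsClassExtreme c' rk' n e' := by
  have h1 : extremeLE c rk n n := ⟨e, e, h, h, le_rfl⟩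
  rw [hρ] at h1
  obtain ⟨e', _, h', _⟩ := h1
  exact ⟨e', h'⟩

theorem IsClassExtreme.le_iff (hρ : extremeLE c rk = extremeLE c' rk') {n n' : C × Bool}
    {e₁ e₂ : E} {e₁' e₂' : E'} (h₁ : IsClassExtreme c rk n e₁) (h₂ : IsClassExtreme c rk n' e₂)
    (h₁' : IsClassExtreme c' rk' n e₁') (h₂' : IsClassExtreme c' rk' n' e₂') :
    rk e₁ ≤ rk e₂ ↔ rk' e₁' ≤ rk' e₂' := by
  have k : extremeLE c rk n n' ↔ rk e₁ ≤ rk e₂ :=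
    ⟨fun ⟨a, b, ha, hb, hab⟩ => by rwa [h₁.rk_eq ha, h₂.rk_eq hb],
      fun h => ⟨_, _, h₁, h₂, h⟩⟩
  have k' : extremeLE c' rk' n n' ↔ rk' e₁' ≤ rk' e₂' :=
    ⟨fun ⟨a, b, ha, hb, hab⟩ => by rwa [h₁'.rk_eq ha, h₂'.rk_eq hb],
      fun h => ⟨_, _, h₁', h₂', h⟩⟩
  rw [← k, ← k', hρ]

/-- Two ranked sets `L₀ ⊕ R₀` and `L₁ ⊕ R₁` of elements with classes, in which the extreme ranks of
the classes compare alike, can be recombined: there is a ranking `κ` of `L₀ ⊕ R₁` that extends the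
rankings of `L₀` and of `R₁`, in which mixed pairs compare like pairs of the same classes in
`L₁ ⊕ R₁`, and in which every comparison with an element of the dropped parts `R₀` and `L₁` is
still witnessed by an element of the same class. -/
theorem exists_amalgamated_rank {CL CR L₀ R₀ L₁ R₁ : Type*} [Finite CL] [Finite CR]
    [Finite L₀] [Finite R₀] [Finite L₁] [Finite R₁] (l₀ : L₀ → CL) (r₀ : R₀ → CR) (l₁ : L₁ → CL)
    (r₁ : R₁ → CR) (rk₀ : L₀ ⊕ R₀ → ℕ) (rk₁ : L₁ ⊕ R₁ → ℕ)
    (hρ : extremeLE (Sum.map l₀ r₀) rk₀ = extremeLE (Sum.map l₁ r₁) rk₁) :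
    ∃ κ : L₀ ⊕ R₁ → ℕ ×ₗ ℕ,
      (∀ x x', κ (.inl x) ≤ κ (.inl x') ↔ rk₀ (.inl x) ≤ rk₀ (.inl x')) ∧
      (∀ y y', κ (.inr y) ≤ κ (.inr y') ↔ rk₁ (.inr y) ≤ rk₁ (.inr y')) ∧
      (∀ x y, κ (.inl x) ≠ κ (.inr y)) ∧
      (∀ x y, ∃ x', l₁ x' = l₀ x ∧
        (κ (.inl x) < κ (.inr y) ↔ rk₁ (.inl x') < rk₁ (.inr y))) ∧
      (∀ x y', ∃ y, r₁ y = r₀ y' ∧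
        (κ (.inl x) < κ (.inr y) ↔ rk₀ (.inl x) < rk₀ (.inr y'))) ∧
      (∀ y x', ∃ x, l₀ x = l₁ x' ∧
        (κ (.inl x) < κ (.inr y) ↔ rk₁ (.inl x') < rk₁ (.inr y))) := by
  set c₀ := Sum.map l₀ r₀ with hc₀
  set c₁ := Sum.map l₁ r₁ with hc₁
  -- The cuts that the elements of `L₀` and `R₁` determine in the common chain of extreme ranks.
  let I : L₀ → Set ((CL ⊕ CR) × Bool) := fun x =>
    {n | ∃ e, IsClassExtreme c₀ rk₀ n e ∧ rk₀ e ≤ rk₀ (.inl x)}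
  let J : R₁ → Set ((CL ⊕ CR) × Bool) := fun y =>
    {n | ∃ e, IsClassExtreme c₁ rk₁ n e ∧ rk₁ e < rk₁ (.inr y)}
  have hI : ∀ x x', rk₀ (.inl x) ≤ rk₀ (.inl x') → (I x).ncard ≤ (I x').ncard := fun x x' h =>
    Set.ncard_le_ncard (fun n ⟨e, he, hle⟩ => ⟨e, he, hle.trans h⟩) (Set.toFinite _)
  have hJ : ∀ y y', rk₁ (.inr y) ≤ rk₁ (.inr y') → (J y).ncard ≤ (J y').ncard := fun y y' h =>
    Set.ncard_le_ncard (fun n ⟨e, he, hle⟩ => ⟨e, he, hle.trans_le h⟩) (Set.toFinite _)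
  have hIJ : ∀ x y, (I x).ncard ≤ (J y).ncard ↔ I x ⊆ J y := by
    intro x y
    refine ⟨fun h => ?_, fun h => Set.ncard_le_ncard h (Set.toFinite _)⟩
    by_contra hn
    obtain ⟨n, ⟨e, he, hex⟩, hnJ⟩ := Set.not_subset.1 hn
    obtain ⟨e₁, he₁⟩ := he.exists_of_extremeLE_eq hρ
    have hy : rk₁ (.inr y) ≤ rk₁ e₁ := not_lt.1 fun h => hnJ ⟨e₁, he₁, h⟩
    have hsub : J y ⊆ I x := by
      rintro m ⟨a₁, ha₁, hay⟩
      obtain ⟨a, ha⟩ := ha₁.exists_of_extremeLE_eq hρ.symm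
      exact ⟨a, ha, ((ha.le_iff hρ he ha₁ he₁).2 (by omega)).trans hex⟩
    have : J y ⊂ I x := ⟨hsub, fun h' => hn h'⟩
    have := Set.ncard_lt_ncard this (Set.toFinite _)
    omega
  -- The cuts are nested, so they are ranked by their sizes. By the parity of the first component,
  -- `x` comes before `y` if and only if `I x ⊆ J y`.
  let κ : L₀ ⊕ R₁ → ℕ ×ₗ ℕ := Sum.elim (fun x => toLex (2 * (I x).ncard, rk₀ (.inl x)))
    fun y => toLex (2 * (J y).ncard + 1, rk₁ (.inr y))
  have hκ : ∀ x y, κ (.inl x) < κ (.inr y) ↔ I x ⊆ J y := by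
    intro x y
    rw [← hIJ]
    simp only [κ, Sum.elim_inl, Sum.elim_inr, Prod.Lex.toLex_lt_toLex]
    omega
  have low : ∀ x y n e, IsClassExtreme c₀ rk₀ n e → IsClassExtreme c₁ rk₁ n (.inr y) →
      rk₀ (.inl x) < rk₀ e → I x ⊆ J y := by
    rintro x y n e he he₁ hlt m ⟨a, ha, hax⟩
    obtain ⟨a₁, ha₁⟩ := ha.exists_of_extremeLE_eq hρ
    refine ⟨a₁, ha₁, not_le.1 fun h => ?_⟩
    have := (he.le_iff hρ ha he₁ ha₁).2 h
    omega
  refine ⟨κ, fun x x' => ?_, fun y y' => ?_, fun x y h => ?_, fun x y => ?_, fun x y' => ?_,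
    fun y x' => ?_⟩
  · simp only [κ, Sum.elim_inl, Prod.Lex.toLex_le_toLex]
    have h1 := hI x x'
    have h2 := hI x' x
    constructor
    · intro h; by_contra h'; omega
    · intro h; have := h1 h; omega
  · simp only [κ, Sum.elim_inr, Prod.Lex.toLex_le_toLex]
    have h1 := hJ y y'
    have h2 := hJ y' y
    constructor
    · intro h; by_contra h'; omega
    · intro h; have := h1 h; omega
  · simp only [κ, Sum.elim_inl, Sum.elim_inr, toLex_inj, Prod.mk.injEq] at h
    omega
  · rw [hκ]
    by_cases h : I x ⊆ J y
    · -- The least element of the class lies below `y`.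
      obtain ⟨m, hm⟩ := exists_isClassExtreme c₀ rk₀ (.inl x) false
      obtain ⟨e, he, hey⟩ := h ⟨m, hm, hm.le rfl⟩
      obtain ⟨x' | x', hx'⟩ : ∃ z, z = e := ⟨e, rfl⟩
      · subst hx'
        have := he.1
        simp only [hc₀, hc₁, Sum.map_inl, Sum.inl.injEq] at this
        exact ⟨x', this, iff_of_true h hey⟩
      · subst hx'
        have := he.1
        simp [hc₀, hc₁] at this
    · -- Some extreme rank separates `y` from `x`, hence `y` from the greatest element of the class.
      obtain ⟨n, ⟨a, ha, hax⟩, hnJ⟩ := Set.not_subset.1 h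
      obtain ⟨a₁, ha₁⟩ := ha.exists_of_extremeLE_eq hρ
      have hy : rk₁ (.inr y) ≤ rk₁ a₁ := not_lt.1 fun h => hnJ ⟨a₁, ha₁, h⟩
      obtain ⟨m, hm⟩ := exists_isClassExtreme c₀ rk₀ (.inl x) true
      obtain ⟨e, he⟩ := hm.exists_of_extremeLE_eq hρ
      have h1 : rk₁ a₁ ≤ rk₁ e := (ha.le_iff hρ hm ha₁ he).1 (hax.trans (hm.ge rfl))
      obtain ⟨x' | x', hx'⟩ : ∃ z, z = e := ⟨e, rfl⟩
      · subst hx'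
        have := he.1
        simp only [hc₀, hc₁, Sum.map_inl, Sum.inl.injEq] at this
        exact ⟨x', this, iff_of_false h (by omega)⟩
      · subst hx'
        have := he.1
        simp [hc₀, hc₁] at this
  · simp only [hκ]
    -- The greatest element of the class if `x` is to be below it, and else the least one.
    obtain ⟨m, hm⟩ := exists_isClassExtreme c₀ rk₀ (.inr y') (decide (rk₀ (.inl x) < rk₀ (.inr y')))
    obtain ⟨e, he⟩ := hm.exists_of_extremeLE_eq hρ
    obtain ⟨y | y, hy⟩ : ∃ z, z = e := ⟨e, rfl⟩
    · subst hy
      have := he.1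
      simp [hc₀, hc₁] at this
    · subst hy
      have hc := he.1
      simp only [hc₀, hc₁, Sum.map_inr, Sum.inr.injEq] at hc
      refine ⟨y, hc, ?_⟩
      by_cases h : rk₀ (.inl x) < rk₀ (.inr y')
      · rw [decide_eq_true h] at hm he
        exact iff_of_true (low x y _ m hm he (h.trans_le (hm.ge rfl))) h
      · rw [decide_eq_false h] at hm he
        refine iff_of_false (fun hsub => ?_) h
        obtain ⟨a, ha, hay⟩ := hsub ⟨m, hm, (hm.le rfl).trans (not_lt.1 h)⟩
        have := ha.rk_eq he
        omega
  · simp only [hκ]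
    -- The least element of the class if it is to be below `y`, and else the greatest one.
    obtain ⟨e, he⟩ :=
      exists_isClassExtreme c₁ rk₁ (.inl x') (!decide (rk₁ (.inl x') < rk₁ (.inr y)))
    obtain ⟨m, hm⟩ := he.exists_of_extremeLE_eq hρ.symm
    obtain ⟨x | x, hx⟩ : ∃ z, z = m := ⟨m, rfl⟩
    · subst hx
      have hc := hm.1
      simp only [hc₀, hc₁, Sum.map_inl, Sum.inl.injEq] at hc
      refine ⟨x, hc, ?_⟩
      by_cases h : rk₁ (.inl x') < rk₁ (.inr y)
      · rw [decide_eq_true h] at hm he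
        refine iff_of_true ?_ h
        rintro n ⟨a, ha, hax⟩
        obtain ⟨a₁, ha₁⟩ := ha.exists_of_extremeLE_eq hρ
        have h1 := (ha.le_iff hρ hm ha₁ he).1 hax
        exact ⟨a₁, ha₁, (h1.trans (he.le rfl)).trans_lt h⟩
      · rw [decide_eq_false h] at hm he
        refine iff_of_false (fun hsub => ?_) h
        obtain ⟨a, ha, hay⟩ := hsub ⟨_, hm, le_rfl⟩
        have h1 := ha.rk_eq he
        have h2 : rk₁ (.inl x') ≤ rk₁ e := he.ge rfl
        omega
    · subst hx
      have := hm.1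
      simp [hc₀, hc₁] at this

end Amalgamation

/-! ### Recombination of origin structures -/

namespace OriginStruct

variable {A B : Type*} {n : ℕ}

/-- The concatenation of two origin structures. The output positions are those of both, each with
its origin in its own factor; how their outputs interleave is left to the ranking. -/
def append (L R : OriginStruct A B n) : OriginStruct A B n where
  P := L.P ⊕ R.P
  Q := L.Q ⊕ R.Q
  lab := Sum.elim L.lab R.lab
  le := Sum.Lex L.le R.le
  olab := Sum.elim L.olab R.olab
  orig := Sum.map L.orig R.orig
  X i := {e | Sum.elim (· ∈ L.X i) (· ∈ R.X i) (Equiv.sumSumSumComm L.P R.P L.Q R.Q e)}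

variable {L R : OriginStruct A B n}

/-- The embedding of the first factor in a concatenation. -/
def inLeft (R : OriginStruct A B n) (e : L.Pos) : (L.append R).Pos := Sum.map Sum.inl Sum.inl e

/-- The embedding of the second factor in a concatenation. -/
def inRight (L : OriginStruct A B n) (e : R.Pos) : (L.append R).Pos := Sum.map Sum.inr Sum.inr e

theorem exists_inLeft_or_inRight (h : (L.append R).Pos) :
    (∃ e : L.Pos, h = inLeft R e) ∨ ∃ e : R.Pos, h = inRight L e := by
  rcases h with (h | h) | (h | h)
  · exact Or.inl ⟨Sum.inl h, rfl⟩
  · exact Or.inr ⟨Sum.inl h, rfl⟩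
  · exact Or.inl ⟨Sum.inr h, rfl⟩
  · exact Or.inr ⟨Sum.inr h, rfl⟩

theorem inLeft_injective : Function.Injective (inLeft (L := L) R) :=
  Sum.map_injective.2 ⟨Sum.inl_injective, Sum.inl_injective⟩

theorem inRight_injective : Function.Injective (inRight (R := R) L) :=
  Sum.map_injective.2 ⟨Sum.inr_injective, Sum.inr_injective⟩

theorem inLeft_ne_inRight (e : L.Pos) (e' : R.Pos) : inLeft R e ≠ inRight L e' := by
  intro h
  have := congrArg Sum.isLeft (congrArg (L.append R).origPos h)
  cases e <;> cases e' <;> simp [inLeft, inRight, append, origPos] at this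

theorem origPos_inLeft (e : L.Pos) :
    (L.append R).origPos (inLeft R e) = Sum.inl (L.origPos e) := by
  cases e <;> rfl

theorem origPos_inRight (e : R.Pos) :
    (L.append R).origPos (inRight L e) = Sum.inr (R.origPos e) := by
  cases e <;> rfl

theorem origPos_inLeft_eq_iff {e e' : L.Pos} :
    (L.append R).origPos (inLeft R e) = (L.append R).origPos (inLeft R e') ↔
      L.origPos e = L.origPos e' := by
  rw [origPos_inLeft, origPos_inLeft]
  exact Sum.inl_injective.eq_iff

theorem origPos_inRight_eq_iff {e e' : R.Pos} :
    (L.append R).origPos (inRight L e) = (L.append R).origPos (inRight L e') ↔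
      R.origPos e = R.origPos e' := by
  rw [origPos_inRight, origPos_inRight]
  exact Sum.inr_injective.eq_iff

theorem origPos_inLeft_ne_inRight (e : L.Pos) (e' : R.Pos) :
    (L.append R).origPos (inLeft R e) ≠ (L.append R).origPos (inRight L e') := by
  rw [origPos_inLeft, origPos_inRight]
  exact Sum.inl_ne_inr

theorem inLeft_eq_inr {e : L.Pos} {q : L.Q ⊕ R.Q} (h : inLeft R e = Sum.inr q) :
    ∃ q', e = Sum.inr q' ∧ q = Sum.inl q' := by
  rcases e with e | e
  · exact absurd h Sum.inl_ne_inr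
  · exact ⟨e, rfl, (Sum.inr_injective h).symm⟩

theorem inRight_eq_inr {e : R.Pos} {q : L.Q ⊕ R.Q} (h : inRight L e = Sum.inr q) :
    ∃ q', e = Sum.inr q' ∧ q = Sum.inr q' := by
  rcases e with e | e
  · exact absurd h Sum.inl_ne_inr
  · exact ⟨e, rfl, (Sum.inr_injective h).symm⟩

theorem loc_inLeft (e : L.Pos) : (L.append R).loc (inLeft R e) = L.loc e := by
  cases e <;> rfl

theorem loc_inRight (e : R.Pos) : (L.append R).loc (inRight L e) = R.loc e := by
  cases e <;> rfl

theorem mso_append {k : ℕ} (νL : Fin k → Option L.P) (νR : Fin k → Option R.P) :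
    (L.append R).mso (fun x => (νL x).map Sum.inl <|> (νR x).map Sum.inr) =
      (L.mso νL).append (R.mso νR) := by
  simp only [mso, MSOStruct.append, append, MSOStruct.mk.injEq, heq_eq_eq, true_and]
  refine ⟨rfl, ?_⟩
  funext i
  ext p
  cases p <;> rfl

theorem mso_inLeft (e : Fin 2 → L.Pos) :
    ((L.append R).mso fun x => some ((L.append R).origPos (inLeft R (e x)))) =
      (L.mso fun x => some (L.origPos (e x))).append (R.mso fun _ => none) := by
  rw [← mso_append]
  congr 1
  funext x
  rw [origPos_inLeft]
  rfl

theorem mso_inRight (e : Fin 2 → R.Pos) :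
    ((L.append R).mso fun x => some ((L.append R).origPos (inRight L (e x)))) =
      (L.mso fun _ => none).append (R.mso fun x => some (R.origPos (e x))) := by
  rw [← mso_append]
  congr 1
  funext x
  rw [origPos_inRight]
  rfl

theorem mso_mixed (y : Fin 2) (a : L.Pos) (b : R.Pos) :
    ((L.append R).mso fun x => some ((L.append R).origPos
      (if x = y then inLeft R a else inRight L b))) =
      (L.mso fun x => if x = y then some (L.origPos a) else none).append
        (R.mso fun x => if x = y then none else some (R.origPos b)) := by
  rw [← mso_append]
  congr 1
  funext x
  split_ifs
  · rw [origPos_inLeft]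
    rfl
  · rw [origPos_inRight]
    rfl

/-- The ranking of all elements of a concatenation induced by a ranking of its output positions;
the rank of input positions is immaterial. -/
def rankAll (rk : L.Q ⊕ R.Q → ℕ) : L.Pos ⊕ R.Pos → ℕ :=
  Sum.elim (Sum.elim (fun _ => 0) fun q => rk (.inl q)) (Sum.elim (fun _ => 0) fun q => rk (.inr q))

end OriginStruct

/-- Classes of elements: the truth values of `K` formulas, the local properties, and two types. -/
abbrev ElementClass (B T : Type*) (K n : ℕ) : Type _ :=
  (Fin K → Prop) × (Option B × (Fin n → Prop) × (Fin n → Prop)) × (Fin 2 → T)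

open OriginStruct in
/-- The class of an element of the first factor: the subformulas of `φ` true at the element, its
local properties, and the MSO type of the first factor in which the value of one of the two
variables is the origin of the element. -/
def LTFormula.leftClass {A B T : Type*} {n : ℕ} (φ : LTFormula A B n)
    (f : MSOStruct A 2 n → T) (L R : OriginStruct A B n) (rk : L.Q ⊕ R.Q → ℕ) (e : L.Pos) :
    ElementClass B T φ.subs.length n :=
  (fun j => (φ.subs.get j).Sat (L.append R) rk fun _ => inLeft R e, L.loc e,
    fun y => f (L.mso fun x => if x = y then some (L.origPos e) else none))

open OriginStruct in
/-- The class of an element of the second factor, analogous to `LTFormula.leftClass`. -/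
def LTFormula.rightClass {A B T : Type*} {n : ℕ} (φ : LTFormula A B n)
    (g : MSOStruct A 2 n → T) (L R : OriginStruct A B n) (rk : L.Q ⊕ R.Q → ℕ) (e : R.Pos) :
    ElementClass B T φ.subs.length n :=
  (fun j => (φ.subs.get j).Sat (L.append R) rk fun _ => inRight L e, R.loc e,
    fun y => g (R.mso fun x => if x = y then none else some (R.origPos e)))

open OriginStruct in
/-- If two models of `φ`, each the concatenation of two factors, agree on the MSO types of the
factors and on the order of the extreme elements of the classes, then the first factor of the one
and the second factor of the other form a model of `φ` under a suitable ranking. The models are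
indexed by `Bool`. -/
theorem LTFormula.exists_rank_of_recombination {A B T₁ T₂ : Type*} [Finite B] [Finite T₁]
    [Finite T₂] {n : ℕ} (φ : LTFormula A B n) (f : MSOStruct A 2 n → T₁) (g : MSOStruct A 2 n → T₂)
    (hfg : ∀ a a' b b', f a = f a' → g b = g b' → ∀ χ ∈ φ.subs,
      (χ.InputSat (a.append b) ↔ χ.InputSat (a'.append b')))
    (L R : Bool → OriginStruct A B n) (rk : ∀ i, (L i).Q ⊕ (R i).Q → ℕ)
    (hLP : ∀ i, Finite (L i).P) (hLQ : ∀ i, Finite (L i).Q) (hRP : ∀ i, Finite (R i).P)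
    (hRQ : ∀ i, Finite (R i).Q) (hinj : ∀ i, Function.Injective (rk i))
    (hsat : ∀ i ν, φ.Sat ((L i).append (R i)) (rk i) ν)
    (hf : f ((L false).mso fun _ => none) = f ((L true).mso fun _ => none))
    (hg : g ((R false).mso fun _ => none) = g ((R true).mso fun _ => none))
    (hρ : extremeLE (Sum.map (φ.leftClass f (L false) (R false) (rk false))
        (φ.rightClass g (L false) (R false) (rk false))) (rankAll (rk false)) =
      extremeLE (Sum.map (φ.leftClass f (L true) (R true) (rk true))
        (φ.rightClass g (L true) (R true) (rk true))) (rankAll (rk true))) :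
    ∃ κ : (L false).Q ⊕ (R true).Q → ℕ ×ₗ ℕ, Function.Injective κ ∧
      ∀ ν, φ.Sat ((L false).append (R true)) κ ν := by
  obtain ⟨κ, hκL, hκR, hκne, hmix, hwL, hwR⟩ := exists_amalgamated_rank _ _ _ _ _ _ hρ
  let κQ : (L false).Q ⊕ (R true).Q → ℕ ×ₗ ℕ := fun q => κ (Sum.map Sum.inr Sum.inr q)
  refine ⟨κQ, ?_, ?_⟩
  · rintro (q | q) (r | r) h
    · have h1 := (hκL (.inr q) (.inr r)).1 h.le
      have h2 := (hκL (.inr r) (.inr q)).1 h.ge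
      exact congrArg _ (Sum.inl_injective (hinj false (le_antisymm h1 h2)))
    · exact absurd h (hκne _ _)
    · exact absurd h.symm (hκne _ _)
    · have h1 := (hκR (.inr q) (.inr r)).1 h.le
      have h2 := (hκR (.inr r) (.inr q)).1 h.ge
      exact congrArg _ (Sum.inr_injective (hinj true (le_antisymm h1 h2)))
  -- An element is related to the elements of the same class in both models.
  let same : ((L false).append (R true)).Pos → (i : Bool) → ((L i).append (R i)).Pos → Prop :=
    fun h i g' =>
    (∃ a a', h = inLeft _ a ∧ g' = inLeft _ a' ∧
      φ.leftClass f (L i) (R i) (rk i) a' = φ.leftClass f (L false) (R false) (rk false) a) ∨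
    (∃ b b', h = inRight _ b ∧ g' = inRight _ b' ∧
      φ.rightClass g (L i) (R i) (rk i) b' = φ.rightClass g (L true) (R true) (rk true) b)
  -- Pairs within one factor are matched with themselves, mixed pairs with mixed pairs of the same
  -- classes that are ordered alike.
  let mtch : (Fin 2 → ((L false).append (R true)).Pos) → (i : Bool) →
      (Fin 2 → ((L i).append (R i)).Pos) → Prop := fun ν i μ =>
    (∃ e : Fin 2 → (L false).Pos, ν = (fun x => inLeft _ (e x)) ∧
      (⟨i, μ⟩ : Σ i, Fin 2 → ((L i).append (R i)).Pos) = ⟨false, fun x => inLeft _ (e x)⟩) ∨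
    (∃ e : Fin 2 → (R true).Pos, ν = (fun x => inRight _ (e x)) ∧
      (⟨i, μ⟩ : Σ i, Fin 2 → ((L i).append (R i)).Pos) = ⟨true, fun x => inRight _ (e x)⟩) ∨
    (∃ (y : Fin 2) (a : (L false).Pos) (b : (R true).Pos) (a' : (L i).Pos) (b' : (R i).Pos),
      φ.leftClass f (L i) (R i) (rk i) a' = φ.leftClass f (L false) (R false) (rk false) a ∧
      φ.rightClass g (L i) (R i) (rk i) b' = φ.rightClass g (L true) (R true) (rk true) b ∧
      (κ (.inl a) < κ (.inr b) ↔ rankAll (rk i) (.inl a') < rankAll (rk i) (.inr b')) ∧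
      ν = (fun x => if x = y then inLeft _ a else inRight _ b) ∧
      μ = (fun x => if x = y then inLeft _ a' else inRight _ b'))
  have hmatch : ∀ ν, ∃ i μ, mtch ν i μ := by
    -- A mixed pair with its left element at the variable `y` is matched in the second model.
    have hmixed : ∀ (y : Fin 2) (a : (L false).Pos) (b : (R true).Pos),
        ∃ i μ, mtch (fun x => if x = y then inLeft _ a else inRight _ b) i μ := by
      intro y a b
      obtain ⟨a', ha', h⟩ := hmix a b
      exact ⟨true, _, Or.inr (Or.inr ⟨y, a, b, a', b, ha', rfl, h, rfl, rfl⟩)⟩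
    intro ν
    rcases exists_inLeft_or_inRight (ν 0) with ⟨a, ha⟩ | ⟨a, ha⟩ <;>
      rcases exists_inLeft_or_inRight (ν 1) with ⟨b, hb⟩ | ⟨b, hb⟩
    · refine ⟨false, _, Or.inl ⟨![a, b], ?_, rfl⟩⟩
      funext x; fin_cases x
      · exact ha
      · exact hb
    · obtain ⟨i, μ, h⟩ := hmixed 0 a b
      refine ⟨i, μ, ?_⟩
      convert h using 1
      funext x; fin_cases x
      · exact ha
      · exact hb
    · obtain ⟨i, μ, h⟩ := hmixed 1 b a
      refine ⟨i, μ, ?_⟩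
      convert h using 1
      funext x; fin_cases x
      · exact ha
      · exact hb
    · refine ⟨true, _, Or.inr (Or.inl ⟨![a, b], ?_, rfl⟩)⟩
      funext x; fin_cases x
      · exact ha
      · exact hb
  have key := φ.sat_iff_of_match (H := (L false).append (R true)) (rk := κQ)
    (M := fun i => (L i).append (R i)) (rk' := rk) same mtch ?_ ?_ ?_ hmatch ?_
  · intro ν
    obtain ⟨i, μ, h⟩ := hmatch ν
    exact (key φ φ.self_mem_subs ν i μ h).2 (hsat i μ)
  · -- Matched pairs have the same atomic type.
    rintro ν i μ (⟨e, rfl, h⟩ | ⟨e, rfl, h⟩ | ⟨y, a, b, a', b', ha, hb, hab, rfl, rfl⟩)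
    · cases h
      refine ⟨fun x => ?_, ?_, ?_, ?_, ?_⟩
      · rw [loc_inLeft, loc_inLeft]
      · rw [inLeft_injective.eq_iff, inLeft_injective.eq_iff]
      · rw [origPos_inLeft_eq_iff, origPos_inLeft_eq_iff]
      · intro x y q r q' r' hq hr hq' hr'
        obtain ⟨q, kq, rfl⟩ := inLeft_eq_inr hq
        obtain ⟨r, kr, rfl⟩ := inLeft_eq_inr hr
        obtain ⟨q', kq', rfl⟩ := inLeft_eq_inr hq'
        obtain ⟨r', kr', rfl⟩ := inLeft_eq_inr hr'
        obtain rfl := Sum.inr_injective (kq.symm.trans kq')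
        obtain rfl := Sum.inr_injective (kr.symm.trans kr')
        exact hκL (.inr q) (.inr r)
      · intro χ hχ
        rw [mso_inLeft, mso_inLeft]
        exact hfg _ _ _ _ rfl hg.symm χ hχ
    · cases h
      refine ⟨fun x => ?_, ?_, ?_, ?_, ?_⟩
      · rw [loc_inRight, loc_inRight]
      · rw [inRight_injective.eq_iff, inRight_injective.eq_iff]
      · rw [origPos_inRight_eq_iff, origPos_inRight_eq_iff]
      · intro x y q r q' r' hq hr hq' hr'
        obtain ⟨q, kq, rfl⟩ := inRight_eq_inr hq
        obtain ⟨r, kr, rfl⟩ := inRight_eq_inr hr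
        obtain ⟨q', kq', rfl⟩ := inRight_eq_inr hq'
        obtain ⟨r', kr', rfl⟩ := inRight_eq_inr hr'
        obtain rfl := Sum.inr_injective (kq.symm.trans kq')
        obtain rfl := Sum.inr_injective (kr.symm.trans kr')
        exact hκR (.inr q) (.inr r)
      · intro χ hχ
        rw [mso_inRight, mso_inRight]
        exact hfg _ _ _ _ hf rfl χ hχ
    · simp only [LTFormula.leftClass, LTFormula.rightClass, Prod.mk.injEq] at ha hb
      obtain ⟨_, haloc, haf⟩ := ha
      obtain ⟨_, hbloc, hbg⟩ := hb
      have hy : (0 : Fin 2) = y ∧ ¬ (1 : Fin 2) = y ∨ ¬ (0 : Fin 2) = y ∧ (1 : Fin 2) = y := by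
        omega
      refine ⟨fun x => ?_, ?_, ?_, ?_, ?_⟩
      · split_ifs
        · rw [loc_inLeft, loc_inLeft, haloc]
        · rw [loc_inRight, loc_inRight, hbloc]
      · rcases hy with ⟨h0, h1⟩ | ⟨h0, h1⟩ <;> simp only [h0, h1, if_true, if_false]
        · exact iff_of_false (inLeft_ne_inRight _ _) (inLeft_ne_inRight _ _)
        · exact iff_of_false (inLeft_ne_inRight _ _).symm (inLeft_ne_inRight _ _).symm
      · rcases hy with ⟨h0, h1⟩ | ⟨h0, h1⟩ <;> simp only [h0, h1, if_true, if_false]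
        · exact iff_of_false (origPos_inLeft_ne_inRight _ _) (origPos_inLeft_ne_inRight _ _)
        · exact iff_of_false (origPos_inLeft_ne_inRight _ _).symm
            (origPos_inLeft_ne_inRight _ _).symm
      · -- On output positions the rankings are injective, so that `≤` and `<` agree on mixed pairs.
        have hlt : ∀ qa qb qa' qb', a = .inr qa → b = .inr qb → a' = .inr qa' → b' = .inr qb' →
            (κQ (.inl qa) ≤ κQ (.inr qb) ↔ rk i (.inl qa') ≤ rk i (.inr qb')) ∧
            (κQ (.inr qb) ≤ κQ (.inl qa) ↔ rk i (.inr qb') ≤ rk i (.inl qa')) := by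
          rintro qa qb qa' qb' rfl rfl rfl rfl
          have h1 := hκne (.inr qa) (.inr qb)
          have h2 : rk i (.inl qa') ≠ rk i (.inr qb') := fun h => Sum.inl_ne_inr (hinj i h)
          change κ (.inl (.inr qa)) < κ (.inr (.inr qb)) ↔ rk i (.inl qa') < rk i (.inr qb') at hab
          change (κ (.inl (.inr qa)) ≤ κ (.inr (.inr qb)) ↔ _) ∧
            (κ (.inr (.inr qb)) ≤ κ (.inl (.inr qa)) ↔ _)
          rw [h1.le_iff_lt, h2.le_iff_lt, ← not_lt, ← not_lt]
          exact ⟨hab, not_congr hab⟩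
        intro x z q r q' r' hq hr hq' hr'
        by_cases hxy : x = y <;> by_cases hzy : z = y <;>
          simp only [hxy, hzy, if_true, if_false] at hq hr hq' hr'
        · rw [Sum.inr_injective (hq.symm.trans hr), Sum.inr_injective (hq'.symm.trans hr')]
          simp
        · obtain ⟨q, kq, rfl⟩ := inLeft_eq_inr hq
          obtain ⟨r, kr, rfl⟩ := inRight_eq_inr hr
          obtain ⟨q', kq', rfl⟩ := inLeft_eq_inr hq'
          obtain ⟨r', kr', rfl⟩ := inRight_eq_inr hr'
          exact (hlt _ _ _ _ kq kr kq' kr').1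
        · obtain ⟨q, kq, rfl⟩ := inRight_eq_inr hq
          obtain ⟨r, kr, rfl⟩ := inLeft_eq_inr hr
          obtain ⟨q', kq', rfl⟩ := inRight_eq_inr hq'
          obtain ⟨r', kr', rfl⟩ := inLeft_eq_inr hr'
          exact (hlt _ _ _ _ kr kq kr' kq').2
        · rw [Sum.inr_injective (hq.symm.trans hr), Sum.inr_injective (hq'.symm.trans hr')]
          simp
      · intro χ hχ
        rw [mso_mixed, mso_mixed]
        exact hfg _ _ _ _ (congrFun haf y).symm (congrFun hbg y).symm χ hχ
  · -- The components of matched pairs are related.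
    rintro ν i μ (⟨e, rfl, h⟩ | ⟨e, rfl, h⟩ | ⟨y, a, b, a', b', ha, hb, -, rfl, rfl⟩) x
    · cases h
      exact Or.inl ⟨_, _, rfl, rfl, rfl⟩
    · cases h
      exact Or.inr ⟨_, _, rfl, rfl, rfl⟩
    · by_cases hx : x = y
      · simp only [hx, if_true]
        exact Or.inl ⟨_, _, rfl, rfl, ha⟩
      · simp only [hx, if_false]
        exact Or.inr ⟨_, _, rfl, rfl, hb⟩
  · -- Relatives of one element satisfy the same subformulas, which are part of the class.
    rintro h i c i' c' (⟨a, a', rfl, rfl, ha⟩ | ⟨a, a', rfl, rfl, ha⟩)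
      (⟨b, b', hh, rfl, hb⟩ | ⟨b, b', hh, rfl, hb⟩) χ hχ
    · obtain ⟨j, rfl⟩ := List.get_of_mem hχ
      obtain rfl := inLeft_injective hh
      exact iff_of_eq (congrFun (congrArg Prod.fst (ha.trans hb.symm)) j)
    · exact absurd hh (inLeft_ne_inRight _ _)
    · exact absurd hh.symm (inLeft_ne_inRight _ _)
    · obtain ⟨j, rfl⟩ := List.get_of_mem hχ
      obtain rfl := inRight_injective hh
      exact iff_of_eq (congrFun (congrArg Prod.fst (ha.trans hb.symm)) j)
  · -- Each element is its own relative in the model that it comes from. A witness in the dropped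
    -- factor of that model is replaced by an element of the same class on the same side.
    intro h
    rcases exists_inLeft_or_inRight h with ⟨a, rfl⟩ | ⟨b, rfl⟩
    · refine ⟨false, inLeft _ a, Or.inl ⟨a, a, rfl, rfl, rfl⟩, fun x g' => ?_⟩
      rcases exists_inLeft_or_inRight g' with ⟨c, rfl⟩ | ⟨c, rfl⟩
      · refine ⟨inLeft _ c, Or.inl ⟨Function.update (fun _ => a) x c, ?_, ?_⟩⟩
        · funext z; by_cases hz : z = x <;> simp [hz]
        · congr 1
          funext z; by_cases hz : z = x <;> simp [hz]
      · obtain ⟨b, hb, h⟩ := hwL a c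
        refine ⟨inRight _ b, Or.inr (Or.inr ⟨1 - x, a, b, a, c, rfl, hb.symm, h, ?_, ?_⟩)⟩ <;>
        · funext z
          by_cases hz : z = x
          · subst hz
            rw [Function.update_self, if_neg (by omega)]
          · rw [Function.update_of_ne hz, if_pos (by omega)]
    · refine ⟨true, inRight _ b, Or.inr ⟨b, b, rfl, rfl, rfl⟩, fun x g' => ?_⟩
      rcases exists_inLeft_or_inRight g' with ⟨c, rfl⟩ | ⟨c, rfl⟩
      · obtain ⟨a, ha, h⟩ := hwR b c
        refine ⟨inLeft _ a, Or.inr (Or.inr ⟨x, a, b, c, b, ?_, rfl, h, ?_, ?_⟩)⟩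
        · exact ha.symm
        all_goals
          funext z
          by_cases hz : z = x
          · subst hz
            rw [Function.update_self, if_pos rfl]
          · rw [Function.update_of_ne hz, if_neg hz]
      · refine ⟨inRight _ c, Or.inr (Or.inl ⟨Function.update (fun _ => b) x c, ?_, ?_⟩)⟩
        · funext z; by_cases hz : z = x <;> simp [hz]
        · congr 1
          funext z; by_cases hz : z = x <;> simp [hz]

/-! ### Origin structures over words -/

namespace OriginStruct

variable {A B : Type*} {n : ℕ}

/-- The input part of the structure is the word `u`. -/
def IsOver (M : OriginStruct A B n) (u : List A) : Prop :=
  ∃ e : M.P ≃ Fin u.length, (∀ p, u.get (e p) = M.lab p) ∧ ∀ p q, e p ≤ e q ↔ M.le p q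

theorem IsOver.finite {M : OriginStruct A B n} {u : List A} (h : M.IsOver u) : Finite M.P :=
  h.elim fun e _ => Finite.of_equiv _ e.symm

end OriginStruct

/-- An origin-graph and sets of its positions as an origin structure. -/
def OGraph.toStruct {A B : Type*} {n : ℕ} (g : OGraph A B) (X : Fin n → Set g.Pos) :
    OriginStruct A B n where
  P := Fin g.input.length
  Q := Fin g.output.length
  lab := g.input.get
  le := (· ≤ ·)
  olab := g.output.get
  orig := g.origin
  X := X

theorem OGraph.orig_eq {A B : Type*} {n : ℕ} (g : OGraph A B) (X : Fin n → Set g.Pos)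
    (e : g.Pos) : g.orig e = Sum.inl ((g.toStruct X).origPos e) := by
  cases e <;> rfl

theorem LTTerm.eval_eq_val {A B : Type*} {n : ℕ} (g : OGraph A B) (X : Fin n → Set g.Pos)
    (ν : Fin 2 → g.Pos) (t : LTTerm) : t.eval g ν = t.val (g.toStruct X) ν := by
  induction t with
  | var x => rfl
  | orig t ih =>
    change g.orig (t.eval g ν) = _
    rw [ih]
    exact g.orig_eq X _

theorem LTFormula.holds_iff_sat {A B : Type*} {n : ℕ} (g : OGraph A B) (X : Fin n → Set g.Pos)
    (φ : LTFormula A B n) (ν : Fin 2 → g.Pos) :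
    φ.Holds g X ν ↔ φ.Sat (g.toStruct X) Fin.val ν := by
  have hmso : ∀ {k : ℕ} (ψ : WordMSO A k n) (κ : Fin k → Fin g.input.length),
      ψ.Holds g.input κ (fun i => Sum.inl ⁻¹' X i) ↔
        ψ.SatIn ((g.toStruct X).mso fun x => some (κ x)) := fun ψ κ => ψ.holds_iff_sat _ _ _
  have h1 : ∀ p : Fin g.input.length, (fun x => some (![p] x)) = ![some p] := fun p => by
    funext x; fin_cases x; rfl
  have h2 : ∀ p r : Fin g.input.length, (fun x => some (![p, r] x)) = ![some p, some r] :=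
    fun p r => by funext x; fin_cases x <;> rfl
  induction φ generalizing ν with
  | letter b t => simp only [Holds, Sat, ← LTTerm.eval_eq_val]; rfl
  | leOut s t => simp only [Holds, Sat, ← LTTerm.eval_eq_val]; rfl
  | eq s t => simp only [Holds, Sat, ← LTTerm.eval_eq_val]; rfl
  | mem t i => simp only [Holds, Sat, ← LTTerm.eval_eq_val]; rfl
  | input0 ψ =>
    simp only [Holds, Sat, hmso]
    exact ψ.satIn_congr (congrArg _ (Subsingleton.elim _ _))
  | input1 ψ t =>
    simp only [Holds, Sat, hmso, ← LTTerm.eval_eq_val]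
    exact exists_congr fun p => and_congr_right fun _ =>
      ψ.satIn_congr (congrArg (OriginStruct.mso _) (h1 p))
  | input2 ψ s t =>
    simp only [Holds, Sat, hmso, ← LTTerm.eval_eq_val]
    exact exists_congr fun p => exists_congr fun r => and_congr_right fun _ =>
      and_congr_right fun _ => ψ.satIn_congr (congrArg (OriginStruct.mso _) (h2 p r))
  | neg φ ih => simp only [Holds, Sat, ih]
  | and φ ψ ih ih' => simp only [Holds, Sat, ih, ih']
  | ex x φ ih => simp only [Holds, Sat, ih]; rfl

open OriginStruct in
/-- Satisfaction is invariant under isomorphism. -/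
theorem LTFormula.sat_equiv {A B Λ Λ' : Type*} [LinearOrder Λ] [LinearOrder Λ'] {n : ℕ}
    {M M' : OriginStruct A B n} {rk : M.Q → Λ} {rk' : M'.Q → Λ'} (eP : M.P ≃ M'.P)
    (eQ : M.Q ≃ M'.Q) (hlab : ∀ p, M'.lab (eP p) = M.lab p)
    (hle : ∀ p q, M'.le (eP p) (eP q) ↔ M.le p q) (holab : ∀ q, M'.olab (eQ q) = M.olab q)
    (horig : ∀ q, M'.orig (eQ q) = eP (M.orig q))
    (hX : ∀ i e, Sum.map eP eQ e ∈ M'.X i ↔ e ∈ M.X i)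
    (hrk : ∀ q r, rk' (eQ q) ≤ rk' (eQ r) ↔ rk q ≤ rk r) (φ : LTFormula A B n) :
    (∀ ν, φ.Sat M' rk' ν) ↔ ∀ ν, φ.Sat M rk ν := by
  have hinj : Function.Injective (Sum.map eP eQ) :=
    Sum.map_injective.2 ⟨eP.injective, eQ.injective⟩
  have hop : ∀ e, M'.origPos (Sum.map eP eQ e) = eP (M.origPos e) := by
    rintro (p | q)
    · rfl
    · exact horig q
  have key := φ.sat_iff_of_match (ι := Unit) (H := M) (rk := rk) (M := fun _ => M')
    (rk' := fun _ => rk') (fun e _ e' => e' = Sum.map eP eQ e)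
    (fun ν _ μ => ∀ x, μ x = Sum.map eP eQ (ν x)) ?_ (fun _ _ _ h => h) ?_ ?_ ?_ φ φ.self_mem_subs
  · constructor
    · exact fun h ν => (key ν () _ fun x => rfl).2 (h _)
    · intro h ν
      refine (key (fun x => (Equiv.sumCongr eP eQ).symm (ν x)) () ν fun x => ?_).1 (h _)
      exact ((Equiv.sumCongr eP eQ).apply_symm_apply (ν x)).symm
  · rintro ν - μ h
    obtain rfl : μ = fun x => Sum.map eP eQ (ν x) := funext h
    refine ⟨fun x => ?_, ?_, ?_, ?_, ?_⟩
    · have h1 : ∀ i, (Sum.inl (eP (M.origPos (ν x))) ∈ M'.X i) = (Sum.inl (M.origPos (ν x)) ∈ M.X i) :=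
        fun i => propext (hX i (Sum.inl _))
      simp only [OriginStruct.loc, hop, hX, h1, Prod.mk.injEq, and_true]
      cases ν x
      · rfl
      · simp [holab]
    · exact hinj.eq_iff.symm
    · simp [hop]
    · rintro x y q r q' r' hq hr hq' hr'
      simp only [hq, hr, Sum.map_inr, Sum.inr.injEq] at hq' hr'
      rw [← hq', ← hr', hrk]
    · intro χ _
      have hm : ∀ {k : ℕ} (ψ : WordMSO A k n) (κ : Fin k → Fin 2),
          ψ.SatIn ((M.mso fun x => some (M.origPos (ν x))).reindex κ) ↔
          ψ.SatIn ((M'.mso fun x => some (M'.origPos (Sum.map eP eQ (ν x)))).reindex κ) := by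
        intro k ψ κ
        refine (ψ.sat_equiv eP hlab hle _ _).trans (iff_of_eq ?_)
        change WordMSO.Sat M'.lab M'.le ψ _ _ = WordMSO.Sat M'.lab M'.le ψ _ _
        congr 1
        · funext x
          simp [mso, MSOStruct.reindex, hop]
        · funext i
          ext p
          have := hX i (Sum.inl (eP.symm p))
          simp only [Sum.map_inl, Equiv.apply_symm_apply] at this
          exact this.symm
      cases χ <;> first | exact Iff.rfl | exact hm _ _
  · rintro e - g - g' rfl rfl χ -
    rfl
  · exact fun ν => ⟨(), _, fun x => rfl⟩
  · refine fun e => ⟨(), _, rfl, fun x g' => ⟨(Equiv.sumCongr eP eQ).symm g', fun y => ?_⟩⟩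
    by_cases hy : y = x
    · subst hy
      rw [Function.update_self, Function.update_self]
      exact ((Equiv.sumCongr eP eQ).apply_symm_apply g').symm
    · rw [Function.update_of_ne hy, Function.update_of_ne hy]

/-- Sorting a finite set along an injective ranking. -/
theorem exists_equiv_fin_le_iff {Q Λ : Type*} [LinearOrder Λ] [Finite Q] {κ : Q → Λ}
    (hκ : Function.Injective κ) {N : ℕ}
    (hN : Nat.card Q = N) :
    ∃ e : Fin N ≃ Q, ∀ q r, κ (e q) ≤ κ (e r) ↔ q ≤ r := by
  let _ := LinearOrder.lift' κ hκ
  have := Fintype.ofFinite Q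
  let e := Fintype.orderIsoFinOfCardEq Q (by rw [← Nat.card_eq_fintype_card, hN])
  exact ⟨e.toEquiv, fun q r => e.le_iff_le⟩

/-- A finite model over a nonempty word, whose output positions are ranked injectively, is
isomorphic to an origin-graph. -/
theorem LTFormula.exists_oGraph {A B Λ : Type*} [LinearOrder Λ] {n : ℕ} (φ : LTFormula A B n)
    {M : OriginStruct A B n} [Finite M.Q] {κ : M.Q → Λ} (hκ : Function.Injective κ)
    (hsat : ∀ ν, φ.Sat M κ ν) {u : List A} (hu : u ≠ []) (hM : M.IsOver u) :
    ∃ (g : OGraph A B) (X : Fin n → Set g.Pos), g.input = u ∧ g.output.length = Nat.card M.Q ∧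
      ∀ ν, φ.Holds g X ν := by
  obtain ⟨eP, hlab, hle⟩ := hM
  obtain ⟨e, he⟩ := exists_equiv_fin_le_iff hκ rfl
  let v := List.ofFn fun q => M.olab (e q)
  have hv : v.length = Nat.card M.Q := List.length_ofFn
  let eQ : M.Q ≃ Fin v.length := e.symm.trans (finCongr hv.symm)
  let g : OGraph A B := ⟨u, hu, v, fun q => eP (M.orig (eQ.symm q))⟩
  let X : Fin n → Set g.Pos := fun i => {z | (Equiv.sumCongr eP eQ).symm z ∈ M.X i}
  refine ⟨g, X, rfl, hv, fun ν => ?_⟩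
  rw [holds_iff_sat]
  revert ν
  refine (sat_equiv (M := M) (M' := g.toStruct X) (rk := κ) eP eQ hlab hle ?_ ?_ ?_ ?_ φ).2 hsat
  · intro q
    change (List.ofFn fun q => M.olab (e q)).get (Fin.cast hv.symm (e.symm q)) = _
    simp
  · exact fun q => congrArg (fun z => eP (M.orig z)) (eQ.symm_apply_apply q)
  · intro i z
    change (Equiv.sumCongr eP eQ).symm (Equiv.sumCongr eP eQ z) ∈ M.X i ↔ _
    rw [Equiv.symm_apply_apply]
  · intro q r
    change (Fin.cast hv.symm (e.symm q) : ℕ) ≤ (Fin.cast hv.symm (e.symm r) : ℕ) ↔ _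
    have := he (e.symm q) (e.symm r)
    rw [Equiv.apply_symm_apply, Equiv.apply_symm_apply] at this
    exact this.symm

/-- The positions of a concatenation of words. -/
def appendPosEquiv {A : Type*} (u v : List A) :
    Fin u.length ⊕ Fin v.length ≃ Fin (u ++ v).length :=
  finSumFinEquiv.trans (finCongr List.length_append.symm)

theorem get_appendPosEquiv {A : Type*} (u v : List A) (p : Fin u.length ⊕ Fin v.length) :
    (u ++ v).get (appendPosEquiv u v p) = Sum.elim u.get v.get p := by
  cases p <;> simp [appendPosEquiv]

theorem appendPosEquiv_le_iff {A : Type*} (u v : List A) (p q : Fin u.length ⊕ Fin v.length) :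
    appendPosEquiv u v p ≤ appendPosEquiv u v q ↔ Sum.Lex (· ≤ ·) (· ≤ ·) p q := by
  have hl : ∀ p : Fin u.length, (appendPosEquiv u v (.inl p) : ℕ) = p := fun p => by
    simp [appendPosEquiv]
  have hr : ∀ p : Fin v.length, (appendPosEquiv u v (.inr p) : ℕ) = u.length + p := fun p => by
    simp [appendPosEquiv]
  rw [Fin.le_def]
  rcases p with p | p <;> rcases q with q | q
  · rw [hl, hl, Sum.lex_inl_inl, Fin.le_def]
  · rw [hl, hr]
    exact iff_of_true (by omega) (Sum.Lex.sep _ _)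
  · rw [hl, hr]
    exact iff_of_false (by omega) Sum.lex_inr_inl
  · rw [hr, hr, Sum.lex_inr_inr, Fin.le_def]
    omega

theorem OriginStruct.IsOver.append {A B : Type*} {n : ℕ} {L R : OriginStruct A B n}
    {u v : List A} (hL : L.IsOver u) (hR : R.IsOver v) : (L.append R).IsOver (u ++ v) := by
  obtain ⟨e, he, he'⟩ := hL
  obtain ⟨d, hd, hd'⟩ := hR
  refine ⟨(Equiv.sumCongr e d).trans (appendPosEquiv u v), fun p => ?_, fun p q => ?_⟩
  · refine (get_appendPosEquiv u v _).trans ?_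
    rcases p with p | p
    · exact he p
    · exact hd p
  · refine (appendPosEquiv_le_iff u v _ _).trans ?_
    rcases p with p | p <;> rcases q with q | q
    · exact Sum.lex_inl_inl.trans ((he' p q).trans Sum.lex_inl_inl.symm)
    · exact iff_of_true (Sum.Lex.sep _ _) (Sum.Lex.sep _ _)
    · exact iff_of_false Sum.lex_inr_inl Sum.lex_inr_inl
    · exact Sum.lex_inr_inr.trans ((hd' p q).trans Sum.lex_inr_inr.symm)

/-- A model over a concatenation of words is isomorphic to a concatenation of structures. -/
theorem LTFormula.exists_append {A B Λ : Type*} [LinearOrder Λ] {n : ℕ} (φ : LTFormula A B n)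
    {M : OriginStruct A B n} [Finite M.Q] {κ : M.Q → Λ} (hκ : Function.Injective κ)
    (hsat : ∀ ν, φ.Sat M κ ν) {u v : List A} (hM : M.IsOver (u ++ v)) :
    ∃ (L R : OriginStruct A B n) (rk : L.Q ⊕ R.Q → Λ), L.IsOver u ∧ R.IsOver v ∧
      Finite L.Q ∧ Finite R.Q ∧ Function.Injective rk ∧ ∀ ν, φ.Sat (L.append R) rk ν := by
  classical
  obtain ⟨e, hlab, hle⟩ := hM
  let s : Fin u.length ⊕ Fin v.length ≃ M.P :=
    (appendPosEquiv u v).trans e.symm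
  let isL : M.Q → Prop := fun q => (s.symm (M.orig q)).isLeft = true
  let eQ : {q // isL q} ⊕ {q // ¬ isL q} ≃ M.Q := Equiv.sumCompl isL
  let L : OriginStruct A B n :=
    { P := Fin u.length, Q := {q // isL q}, lab := u.get, le := (· ≤ ·), olab := fun q => M.olab q
      orig := fun q => (s.symm (M.orig q)).getLeft q.2
      X := fun i => {z | Sum.map (fun p => s (Sum.inl p)) Subtype.val z ∈ M.X i} }
  let R : OriginStruct A B n :=
    { P := Fin v.length, Q := {q // ¬ isL q}, lab := v.get, le := (· ≤ ·)
      olab := fun q => M.olab q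
      orig := fun q => (s.symm (M.orig q)).getRight (by simpa [isL] using q.2)
      X := fun i => {z | Sum.map (fun p => s (Sum.inr p)) Subtype.val z ∈ M.X i} }
  refine ⟨L, R, fun q => κ (eQ q), ⟨Equiv.refl _, fun _ => rfl, fun _ _ => Iff.rfl⟩,
    ⟨Equiv.refl _, fun _ => rfl, fun _ _ => Iff.rfl⟩, inferInstanceAs (Finite {q // isL q}),
    inferInstanceAs (Finite {q // ¬ isL q}), hκ.comp eQ.injective, ?_⟩
  refine (sat_equiv (M := L.append R) (M' := M) (rk := fun q => κ (eQ q)) s eQ ?_ ?_ ?_ ?_ ?_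
    (fun _ _ => Iff.rfl) φ).1 hsat
  · intro p
    rw [← hlab]
    refine (congrArg _ (e.apply_symm_apply _)).trans (get_appendPosEquiv u v p)
  · intro p q
    rw [← hle]
    change e (e.symm _) ≤ e (e.symm _) ↔ _
    rw [e.apply_symm_apply, e.apply_symm_apply]
    exact appendPosEquiv_le_iff u v p q
  · rintro (q | q) <;> rfl
  · rintro (q | q)
    · change M.orig q = s (Sum.inl (Sum.getLeft _ _))
      rw [Sum.inl_getLeft, Equiv.apply_symm_apply]
    · change M.orig q = s (Sum.inr (Sum.getRight _ _))
      rw [Sum.inr_getRight, Equiv.apply_symm_apply]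
  · rintro i ((p | p) | (q | q)) <;> rfl

/-! ### Finitely many left quotients of input domains -/

namespace LTFormula

variable {A B : Type*} {n : ℕ}

/-- A bound for the number of types of the first factor of a concatenation with respect to all MSO
predicates in a formula. -/
def index : LTFormula A B n → ℕ
  | .input0 ψ => ψ.index
  | .input1 ψ _ => ψ.index
  | .input2 ψ _ _ => ψ.index
  | .neg φ => φ.index
  | .and φ ψ => φ.index * ψ.index
  | .ex _ φ => φ.index
  | _ => 1

theorem finIndex_inputSat (φ : LTFormula A B n) :
    FinIndex φ.index fun (a : MSOStruct A 2 n) (b : LTFormula A B n × MSOStruct A 2 n) =>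
      b.1 ∈ φ.subs ∧ b.1.InputSat (a.append b.2) := by
  have hatom : ∀ {k : ℕ} (ψ : WordMSO A k n) (i : Fin k → Fin 2) (χ : LTFormula A B n),
      χ.subs = [χ] → (∀ a, χ.InputSat a = ψ.SatIn (a.reindex i)) → FinIndex ψ.index
        fun (a : MSOStruct A 2 n) (b : LTFormula A B n × MSOStruct A 2 n) =>
          b.1 ∈ χ.subs ∧ b.1.InputSat (a.append b.2) := by
    intro k ψ i χ hs hχ
    obtain ⟨f, hf⟩ := ψ.finIndex_satIn
    refine ⟨fun a => f (a.reindex i), fun a a' h b => and_congr_right fun hb => ?_⟩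
    rw [hs, List.mem_singleton] at hb
    rw [hb, hχ, hχ]
    exact hf _ _ h (b.2.reindex i)
  have htriv : ∀ χ : LTFormula A B n, χ.subs = [χ] → (∀ a, χ.InputSat a) → FinIndex 1
        fun (a : MSOStruct A 2 n) (b : LTFormula A B n × MSOStruct A 2 n) =>
          b.1 ∈ χ.subs ∧ b.1.InputSat (a.append b.2) := by
    intro χ hs hχ
    refine ⟨fun _ => 0, fun a a' h b => and_congr_right fun hb => ?_⟩
    rw [hs, List.mem_singleton] at hb
    rw [hb]
    exact iff_of_true (hχ _) (hχ _)
  induction φ with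
  | letter b t => exact htriv _ rfl fun _ => trivial
  | leOut s t => exact htriv _ rfl fun _ => trivial
  | eq s t => exact htriv _ rfl fun _ => trivial
  | mem t i => exact htriv _ rfl fun _ => trivial
  | input0 ψ => exact hatom ψ _ _ rfl fun _ => rfl
  | input1 ψ t => exact hatom ψ _ _ rfl fun _ => rfl
  | input2 ψ s t => exact hatom ψ _ _ rfl fun _ => rfl
  | neg φ ih =>
    obtain ⟨f, hf⟩ := ih
    refine ⟨f, fun a a' h b => and_congr_right fun hb => ?_⟩
    rcases List.mem_cons.1 hb with hb | hb
    · rw [hb]; rfl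
    · simpa [hb] using hf a a' h b
  | ex x φ ih =>
    obtain ⟨f, hf⟩ := ih
    refine ⟨f, fun a a' h b => and_congr_right fun hb => ?_⟩
    rcases List.mem_cons.1 hb with hb | hb
    · rw [hb]; rfl
    · simpa [hb] using hf a a' h b
  | and φ ψ ih ih' =>
    obtain ⟨f, hf⟩ := ih
    obtain ⟨g, hg⟩ := ih'
    refine FinIndex.of_fintype (fun a => (f a, g a)) (by simp [index]) fun a a' h b =>
      and_congr_right fun hb => ?_
    simp only [Prod.mk.injEq] at h
    rcases List.mem_cons.1 hb with hb | hb
    · rw [hb]; rfl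
    · rcases List.mem_append.1 hb with hb | hb
      · simpa [hb] using hf a a' h.1 b
      · simpa [hb] using hg a a' h.2 b

/-- The input domain of the o-transduction of `∃ X₁ … ∃ Xₙ φ`. -/
def domain (φ : LTFormula A B n) : Language A :=
  {u | ∃ (g : OGraph A B) (X : Fin n → Set g.Pos), g.input = u ∧ ∀ ν, φ.Holds g X ν}

end LTFormula

/-- A bound for the number of left quotients of the input domain defined by a formula with `N` MSO
types, `K` subformulas and `n` set variables over an output alphabet of size `b`. It counts the
pairs of a truth value (the first factor is empty or not) and a set of states. A state consists of
two MSO types and a binary relation on pairs of a class and a Boolean. -/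
def quotientBound (N K n b : ℕ) : ℕ :=
  2 * 2 ^ (N * 2 ^ (N * K) *
    (2 ^ ((2 ^ K * ((b + 1) * (2 ^ n * 2 ^ n)) * N ^ 2 +
      2 ^ K * ((b + 1) * (2 ^ n * 2 ^ n)) * (2 ^ (N * K)) ^ 2) * 2)) ^
    ((2 ^ K * ((b + 1) * (2 ^ n * 2 ^ n)) * N ^ 2 +
      2 ^ K * ((b + 1) * (2 ^ n * 2 ^ n)) * (2 ^ (N * K)) ^ 2) * 2))

open OriginStruct in
/-- The information on a first factor `u` that determines `{v | u ++ v ∈ φ.domain}` is the set of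
all states at the cut between `u` and some `v` of models over `u ++ v`, where the state consists of
the MSO types of the two factors and of the order of the extreme elements of the classes. -/
theorem LTFormula.finIndex_domain {A B : Type*} [Fintype B] {n : ℕ} (φ : LTFormula A B n) :
    FinIndex (quotientBound φ.index φ.subs.length n (Fintype.card B))
      fun u v : List A => u ++ v ∈ φ.domain := by
  classical
  obtain ⟨f, hf⟩ := φ.finIndex_inputSat
  -- The dual type of a second factor: its column in the matrix whose rows are the types `f`.
  let g : MSOStruct A 2 n → Fin φ.index × Fin φ.subs.length → Prop := fun b t =>
    ∃ a, f a = t.1 ∧ (φ.subs.get t.2).InputSat (a.append b)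
  have hfg : ∀ a a' b b', f a = f a' → g b = g b' → ∀ χ ∈ φ.subs,
      (χ.InputSat (a.append b) ↔ χ.InputSat (a'.append b')) := by
    intro a a' b b' ha hb χ hχ
    obtain ⟨j, rfl⟩ := List.get_of_mem hχ
    have key : ∀ a b, (φ.subs.get j).InputSat (a.append b) ↔ g b (f a, j) := by
      intro a b
      constructor
      · exact fun h => ⟨a, rfl, h⟩
      · rintro ⟨c, hc, h⟩
        have := hf c a hc (φ.subs.get j, b)
        simp only [hχ, true_and] at this
        exact this.1 h
    rw [key, key, ha, hb]
  let Name := (ElementClass B (Fin φ.index) φ.subs.length n ⊕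
    ElementClass B (Fin φ.index × Fin φ.subs.length → Prop) φ.subs.length n) × Bool
  let State := Fin φ.index × (Fin φ.index × Fin φ.subs.length → Prop) × (Name → Name → Prop)
  have : Finite Name := by unfold Name; infer_instance
  have : Finite State := by unfold State; infer_instance
  let state : ∀ L R : OriginStruct A B n, (L.Q ⊕ R.Q → ℕ) → State := fun L R rk =>
    (f (L.mso fun _ => none), g (R.mso fun _ => none),
      extremeLE (Sum.map (φ.leftClass f L R rk) (φ.rightClass g L R rk)) (rankAll rk))
  let states : List A → Set State := fun u =>
    {s | ∃ (L R : OriginStruct A B n) (rk : L.Q ⊕ R.Q → ℕ), L.IsOver u ∧ Finite R.P ∧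
      Finite L.Q ∧ Finite R.Q ∧ Function.Injective rk ∧ (∀ ν, φ.Sat (L.append R) rk ν) ∧
      s = state L R rk}
  refine FinIndex.of_finite (fun u => ((u = [] : Prop), states u)) ?_ ?_
  · have hset : ∀ (T : Type _) [Finite T], Nat.card (Set T) = 2 ^ Nat.card T := fun T _ => by
      rw [Set, Nat.card_fun, Nat.card_eq_fintype_card, Fintype.card_prop]
    refine le_of_eq ?_
    rw [Nat.card_prod, hset]
    simp only [State, Name, Nat.card_prod, Nat.card_sum, Nat.card_fun]
    simp [quotientBound, mul_assoc]
  · have key : ∀ u u', ((u = [] : Prop), states u) = ((u' = [] : Prop), states u') → ∀ v,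
        u ++ v ∈ φ.domain → u' ++ v ∈ φ.domain := by
      rintro u u' h v ⟨G, X, hG, hφ⟩
      simp only [Prod.mk.injEq, eq_iff_iff] at h
      obtain ⟨hnil, hstates⟩ := h
      have hne : u' ++ v ≠ [] := by
        have := G.input_ne
        rw [hG] at this
        simpa [hnil] using this
      have hover : (G.toStruct X).IsOver (u ++ v) := by
        rw [← hG]
        exact ⟨Equiv.refl _, fun _ => rfl, fun _ _ => Iff.rfl⟩
      have : Finite (G.toStruct X).Q := inferInstanceAs (Finite (Fin _))
      obtain ⟨L₁, R₁, rk₁, hL₁, hR₁, hfL₁, hfR₁, hrk₁, hφ₁⟩ := φ.exists_append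
        (M := G.toStruct X) (κ := Fin.val) Fin.val_injective
        (fun ν => (φ.holds_iff_sat G X ν).1 (hφ ν)) hover
      have hmem : state L₁ R₁ rk₁ ∈ states u :=
        ⟨L₁, R₁, rk₁, hL₁, hR₁.finite, hfL₁, hfR₁, hrk₁, hφ₁, rfl⟩
      rw [hstates] at hmem
      obtain ⟨L₀, R₀, rk₀, hL₀, hR₀, hfL₀, hfR₀, hrk₀, hφ₀, hs⟩ := hmem
      obtain ⟨κ, hκ, hsat⟩ := φ.exists_rank_of_recombination f g hfg
        (fun i => Bool.rec L₀ L₁ i) (fun i => Bool.rec R₀ R₁ i) (fun i => Bool.rec rk₀ rk₁ i)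
        (by rintro (_ | _); exacts [hL₀.finite, hL₁.finite])
        (by rintro (_ | _); exacts [hfL₀, hfL₁])
        (by rintro (_ | _); exacts [hR₀, hR₁.finite])
        (by rintro (_ | _); exacts [hfR₀, hfR₁])
        (by rintro (_ | _); exacts [hrk₀, hrk₁])
        (by rintro (_ | _); exacts [hφ₀, hφ₁])
        (congrArg Prod.fst hs).symm (congrArg (fun s => s.2.1) hs).symm
        (congrArg (fun s => s.2.2) hs).symm
      have : Finite (L₀.append R₁).Q := inferInstanceAs (Finite (L₀.Q ⊕ R₁.Q))
      obtain ⟨G', X', hG', -, hφ'⟩ := φ.exists_oGraph hκ hsat hne (hL₀.append hR₁)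
      exact ⟨G', X', hG', hφ'⟩
    exact fun u u' h v => ⟨key u u' h v, key u' u h.symm v⟩

theorem Language.isRegular_of_finIndex {A : Type*} {L : Language A} {N : ℕ}
    (h : FinIndex N fun u v : List A => u ++ v ∈ L) : L.IsRegular := by
  obtain ⟨f, hf⟩ := h
  refine IsRegular.of_finite_range_leftQuotient ?_
  have hfac : ∀ u u', f u = f u' → L.leftQuotient u = L.leftQuotient u' :=
    fun u u' h => Set.ext fun v => hf u u' h v
  have : Set.range L.leftQuotient ⊆ Set.range fun t : Fin N =>
      {v | ∃ u, f u = t ∧ u ++ v ∈ L} := by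
    rintro _ ⟨u, rfl⟩
    refine ⟨f u, Set.ext fun v => ⟨?_, fun h => ⟨u, rfl, h⟩⟩⟩
    rintro ⟨u', hu', h⟩
    exact (hf u' u hu' v).1 h
  exact (Set.finite_range _).subset this

/-! ### Bounded outputs -/

/-- A bound for the number of output positions needed over an input word of length `l`, for a
formula with `K` subformulas and `n` set variables over an output alphabet of size `b`. -/
def outputBound (l K n b : ℕ) : ℕ :=
  l * (2 ^ K * ((b + 1) * (2 ^ n * 2 ^ n))) * 2

open OriginStruct in
/-- Among the output positions with the same origin, local properties and type, only the first and
the last are needed: they provide the witnesses that the others provide. -/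
theorem LTFormula.exists_card_le_outputBound {A B : Type*} [Fintype B] {n : ℕ}
    (φ : LTFormula A B n) {M : OriginStruct A B n} [Finite M.Q] {rk : M.Q → ℕ}
    (hrk : Function.Injective rk) (hsat : ∀ ν, φ.Sat M rk ν) {u : List A} (hM : M.IsOver u) :
    ∃ (H : OriginStruct A B n) (rk' : H.Q → ℕ), H.IsOver u ∧ Finite H.Q ∧
      Nat.card H.Q ≤ outputBound u.length φ.subs.length n (Fintype.card B) ∧
      Function.Injective rk' ∧ ∀ ν, φ.Sat H rk' ν := by
  classical
  have := hM.finite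
  let Key := M.P × (Fin φ.subs.length → Prop) × Option B × (Fin n → Prop) × (Fin n → Prop)
  let key : M.Pos → Key := fun e =>
    (M.origPos e, fun j => (φ.subs.get j).Sat M rk fun _ => e, M.loc e)
  let c : M.Q → Key := fun q => key (.inr q)
  let kept : M.Q → Prop := fun q => ∃ b, IsClassExtreme c rk (c q, b) q
  let H : OriginStruct A B n :=
    { P := M.P, Q := {q // kept q}, lab := M.lab, le := M.le, olab := fun q => M.olab q
      orig := fun q => M.orig q, X := fun i => Sum.map id Subtype.val ⁻¹' M.X i }
  let emb : H.Pos → M.Pos := Sum.map id Subtype.val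
  have hemb : Function.Injective emb :=
    Sum.map_injective.2 ⟨Function.injective_id, Subtype.val_injective⟩
  let rk' : H.Q → ℕ := fun q => rk q.1
  have hfin : Finite H.Q := inferInstanceAs (Finite {q // kept q})
  refine ⟨H, rk', hM, hfin, ?_, hrk.comp Subtype.val_injective, ?_⟩
  · -- A kept position is determined by its class and by whether it is the last one in it.
    let code : H.Q → Key × Bool := fun q => (c q.1, decide (IsClassExtreme c rk (c q.1, true) q.1))
    have hcode : Function.Injective code := by
      intro q r h
      simp only [code, Prod.mk.injEq, decide_eq_decide] at h
      refine Subtype.ext (hrk ?_)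
      by_cases hq : IsClassExtreme c rk (c q.1, true) q.1
      · have hr := h.2.1 hq
        rw [← h.1] at hr
        exact hq.rk_eq hr
      · have hr := fun h' => hq (h.2.2 h')
        obtain ⟨b, hb⟩ := q.2
        obtain ⟨b', hb'⟩ := r.2
        cases b with
        | true => exact absurd hb hq
        | false =>
          cases b' with
          | true => exact absurd hb' hr
          | false =>
            rw [← h.1] at hb'
            exact hb.rk_eq hb'
    have : Finite Key := by unfold Key; infer_instance
    refine (Nat.card_le_card_of_injective code hcode).trans (le_of_eq ?_)
    have hP : Nat.card M.P = u.length := by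
      obtain ⟨e, -⟩ := hM
      rw [Nat.card_congr e, Nat.card_eq_fintype_card, Fintype.card_fin]
    simp only [Key, Nat.card_prod, Nat.card_fun, Finite.card_option, hP]
    simp [outputBound]
  · let mtch : (Fin 2 → H.Pos) → Unit → (Fin 2 → M.Pos) → Prop := fun ν _ μ =>
      (∀ x, key (emb (ν x)) = key (μ x)) ∧ (ν 0 = ν 1 ↔ μ 0 = μ 1) ∧
      ∀ x y q r q' r', ν x = Sum.inr q → ν y = Sum.inr r → μ x = Sum.inr q' → μ y = Sum.inr r' →
        (rk' q ≤ rk' r ↔ rk q' ≤ rk r')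
    have hloc : ∀ h, H.loc h = M.loc (emb h) := by rintro (p | q) <;> rfl
    have horig : ∀ h, H.origPos h = M.origPos (emb h) := by rintro (p | q) <;> rfl
    have hself : ∀ ν, mtch ν () fun x => emb (ν x) := by
      refine fun ν => ⟨fun x => rfl, hemb.eq_iff.symm, ?_⟩
      intro x y q r q' r' hq hr hq' hr'
      simp only [hq, hr, emb, Sum.map_inr, Sum.inr.injEq] at hq' hr'
      rw [← hq', ← hr']
    have key' := φ.sat_iff_of_match (ι := Unit) (H := H) (rk := rk') (M := fun _ => M)
      (rk' := fun _ => rk) (fun h _ e => key (emb h) = key e) mtch ?_ (fun _ _ _ h => h.1) ?_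
      (fun ν => ⟨(), _, hself ν⟩) ?_ φ φ.self_mem_subs
    · exact fun ν => (key' ν () _ (hself ν)).2 (hsat _)
    · rintro ν - μ ⟨hk, heq, hr⟩
      have hk1 : ∀ x, M.origPos (emb (ν x)) = M.origPos (μ x) := fun x => congrArg Prod.fst (hk x)
      refine ⟨fun x => ?_, heq, ?_, hr, ?_⟩
      · rw [hloc]
        exact congrArg (fun z => z.2.2) (hk x)
      · simp only [horig, hk1]
      · intro χ _
        simp only [horig, hk1]
        rfl
    · rintro h - g - g' hg hg' χ hχ
      obtain ⟨j, rfl⟩ := List.get_of_mem hχ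
      exact iff_of_eq (congrFun (congrArg (fun z => z.2.1) (hg.symm.trans hg')) j)
    · refine fun h => ⟨(), emb h, rfl, fun x g' => ?_⟩
      have hmk : ∀ p : H.Pos, key (emb p) = key g' → (p = h ↔ g' = emb h) →
          (∀ r q q', h = Sum.inr r → p = Sum.inr q → g' = Sum.inr q' →
            (rk' q ≤ rk' r ↔ rk q' ≤ rk' r) ∧ (rk' r ≤ rk' q ↔ rk' r ≤ rk q')) →
          mtch (Function.update (fun _ => h) x p) () (Function.update (fun _ => emb h) x g') := by
        intro p hp hph hpr
        refine ⟨fun y => ?_, ?_, ?_⟩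
        · by_cases hy : y = x
          · subst hy; simpa using hp
          · simp [hy]
        · rcases (by omega : x = 0 ∨ x = 1) with rfl | rfl
          · simpa using hph
          · have h01 : (0 : Fin 2) ≠ 1 := by decide
            rw [Function.update_of_ne h01, Function.update_self, Function.update_of_ne h01,
              Function.update_self]
            exact (eq_comm.trans hph).trans eq_comm
        · intro y z q r q' r' hq hr hq' hr'
          have hh : ∀ {r : H.Q} {r' : M.Q}, h = Sum.inr r → emb h = Sum.inr r' → rk r' = rk' r := by
            rintro r r' rfl h'
            rw [← Sum.inr_injective h']
          by_cases hy : y = x <;> by_cases hz : z = x <;>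
            simp only [hy, hz, Function.update_self, ne_eq, not_false_eq_true,
              Function.update_of_ne] at hq hr hq' hr'
          · rw [Sum.inr_injective (hq.symm.trans hr), Sum.inr_injective (hq'.symm.trans hr')]
            simp
          · rw [hh hr hr']
            exact (hpr _ _ _ hr hq hq').1
          · rw [hh hq hq']
            exact (hpr _ _ _ hq hr hr').2
          · rw [Sum.inr_injective (hq.symm.trans hr), Sum.inr_injective (hq'.symm.trans hr')]
            simp
      by_cases hg : g' = emb h
      · refine ⟨h, hmk h (by rw [hg]) (iff_of_true rfl hg) ?_⟩
        rintro r q q' rfl hq hq'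
        rw [hg] at hq'
        obtain rfl := Sum.inr_injective hq
        rw [← Sum.inr_injective hq']
        exact ⟨Iff.rfl, Iff.rfl⟩
      · rcases g' with p | q'
        · refine ⟨Sum.inl p, hmk _ rfl (iff_of_false ?_ hg) ?_⟩
          · rintro rfl
            exact hg rfl
          · rintro r q q' rfl hq hq'
            exact absurd hq Sum.inl_ne_inr
        · -- The first position is used for witnesses below `h`, the last for those above.
          obtain ⟨q, hq⟩ := exists_isClassExtreme c rk q' (decide (∃ r : H.Q, h = .inr r ∧ rk' r < rk q'))
          have hkept : kept q := ⟨_, by rw [hq.1]; exact hq⟩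
          have hne : ∀ r : H.Q, h = .inr r → rk q' ≠ rk' r := by
            rintro r rfl hr
            exact hg (congrArg _ (hrk hr))
          have hcmp : ∀ r : H.Q, h = .inr r →
              rk' r < rk q ∧ rk' r < rk q' ∨ rk q < rk' r ∧ rk q' < rk' r := by
            intro r hr
            have h1 := hne r hr
            by_cases hlt : rk' r < rk q'
            · rw [decide_eq_true ⟨r, hr, hlt⟩] at hq
              exact Or.inl ⟨hlt.trans_le (hq.ge rfl), hlt⟩
            · have : ¬ ∃ r : H.Q, h = .inr r ∧ rk' r < rk q' := by
                rintro ⟨r', hr', h'⟩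
                rw [Sum.inr_injective (hr.symm.trans hr')] at hlt
                exact hlt h'
              rw [decide_eq_false this] at hq
              have := hq.le (e' := q') rfl
              omega
          refine ⟨Sum.inr ⟨q, hkept⟩, hmk _ hq.1 (iff_of_false ?_ hg) ?_⟩
          · intro h'
            have h1 : rk' ⟨q, hkept⟩ = rk q := rfl
            have := hcmp _ h'.symm
            omega
          · intro r q₁ q₂ hr hq₁ hq₂
            rw [← Sum.inr_injective hq₁, ← Sum.inr_injective hq₂]
            have h1 : rk' ⟨q, hkept⟩ = rk q := rfl
            have := hcmp r hr
            omega

/-- Every word in the input domain has an output of bounded length. -/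
theorem LTFormula.exists_output_length_le {A B : Type*} [Fintype B] {n : ℕ} (φ : LTFormula A B n)
    {u : List A} (hu : u ∈ φ.domain) : ∃ (g : OGraph A B) (X : Fin n → Set g.Pos), g.input = u ∧
      g.output.length ≤ outputBound u.length φ.subs.length n (Fintype.card B) ∧
      ∀ ν, φ.Holds g X ν := by
  obtain ⟨g, X, rfl, hφ⟩ := hu
  have : Finite (g.toStruct X).Q := inferInstanceAs (Finite (Fin _))
  obtain ⟨H, rk, hH, _, hcard, hinj, hsat⟩ := φ.exists_card_le_outputBound (M := g.toStruct X)
    (rk := Fin.val) Fin.val_injective (fun ν => (φ.holds_iff_sat g X ν).1 (hφ ν))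
    ⟨Equiv.refl _, fun _ => rfl, fun _ _ => Iff.rfl⟩
  obtain ⟨g', X', hg', hlen, hφ'⟩ := φ.exists_oGraph hinj hsat g.input_ne hH
  exact ⟨g', X', hg', by omega, hφ'⟩

/-! ### Computable bounds -/

/-- A tower of exponentials, which bounds the number of MSO types in terms of Gödel numbers. -/
def tower (c : ℕ) : ℕ := (fun x => 4 ^ x)^[c] 8

theorem tower_succ (c : ℕ) : tower (c + 1) = 4 ^ tower c := Function.iterate_succ_apply' _ _ _

theorem tower_mono : Monotone tower :=
  monotone_nat_of_le_succ fun c => by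
    rw [tower_succ]
    exact (Nat.lt_pow_self (by norm_num)).le

theorem mul_le_tower_succ {x y c : ℕ} (hx : x ≤ 2 ^ tower c) (hy : y ≤ tower c) :
    x * y ≤ tower (c + 1) := by
  rw [tower_succ]
  calc x * y ≤ 2 ^ tower c * 2 ^ tower c :=
        Nat.mul_le_mul hx (hy.trans (Nat.lt_pow_self (by norm_num)).le)
    _ = 4 ^ tower c := by rw [← mul_pow]; norm_num

theorem Nat.lt_pair_of_pos {t c : ℕ} (ht : 0 < t) : c < Nat.pair t c :=
  lt_of_lt_of_le (by omega) (Nat.add_le_pair t c)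

theorem WordMSO.index_le_tower {k n m : ℕ} (ψ : WordMSO (Fin k) n m) :
    ψ.index ≤ tower ψ.code := by
  have step : ∀ {t c : ℕ}, 0 < t → tower (c + 1) ≤ tower (Nat.pair t c) := fun h =>
    tower_mono (Nat.lt_pair_of_pos h)
  have le8 : ∀ c, 8 ≤ tower c := fun c => tower_mono (Nat.zero_le c)
  induction ψ with
  | letter a x => exact le8 _
  | le x y => exact le8 _
  | eq x y => exact le8 _
  | mem x i => exact le8 _
  | neg ψ ih => exact ih.trans (tower_mono (Nat.lt_pair_of_pos (by norm_num)).le)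
  | and ψ ψ' ih ih' =>
    refine (mul_le_tower_succ (c := Nat.pair ψ.code ψ'.code) ?_ ?_).trans (step (by norm_num))
    · exact (ih.trans (tower_mono (Nat.left_le_pair _ _))).trans
        (Nat.lt_pow_self (by norm_num)).le
    · exact ih'.trans (tower_mono (Nat.right_le_pair _ _))
  | ex ψ ih =>
    exact (mul_le_tower_succ (Nat.pow_le_pow_right (by norm_num) ih) ih).trans (step (by norm_num))
  | exSet ψ ih =>
    refine le_trans ?_ (step (by norm_num))
    rw [tower_succ]
    exact (Nat.pow_le_pow_left (by norm_num) _).trans (Nat.pow_le_pow_right (by norm_num) ih)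

theorem LTFormula.index_le_tower {k m n : ℕ} (φ : LTFormula (Fin k) (Fin m) n) :
    φ.index ≤ tower φ.code := by
  have step : ∀ {t c : ℕ}, 0 < t → tower (c + 1) ≤ tower (Nat.pair t c) := fun h =>
    tower_mono (Nat.lt_pair_of_pos h)
  have le1 : ∀ c, 1 ≤ tower c := fun c => le_trans (by decide) (tower_mono (Nat.zero_le c))
  have up : ∀ {t c : ℕ}, 0 < t → tower c ≤ tower (Nat.pair t c) := fun h =>
    tower_mono (Nat.lt_pair_of_pos h).le
  induction φ with
  | letter b t => exact le1 _
  | leOut s t => exact le1 _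
  | eq s t => exact le1 _
  | mem t i => exact le1 _
  | input0 ψ => exact ψ.index_le_tower.trans (up (by norm_num))
  | input1 ψ t =>
    exact (ψ.index_le_tower.trans (tower_mono (Nat.left_le_pair _ _))).trans (up (by norm_num))
  | input2 ψ s t =>
    exact (ψ.index_le_tower.trans (tower_mono (Nat.left_le_pair _ _))).trans (up (by norm_num))
  | neg φ ih => exact ih.trans (up (by norm_num))
  | and φ ψ ih ih' =>
    refine (mul_le_tower_succ (c := Nat.pair φ.code ψ.code) ?_ ?_).trans (step (by norm_num))
    · exact (ih.trans (tower_mono (Nat.left_le_pair _ _))).trans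
        (Nat.lt_pow_self (by norm_num)).le
    · exact ih'.trans (tower_mono (Nat.right_le_pair _ _))
  | ex x φ ih =>
    exact (ih.trans (tower_mono (Nat.right_le_pair _ _))).trans (up (by norm_num))

theorem LTFormula.length_subs_le {k m n : ℕ} (φ : LTFormula (Fin k) (Fin m) n) :
    φ.subs.length ≤ φ.code := by
  induction φ with
  | neg φ ih =>
    have := Nat.add_le_pair 8 φ.code
    simp only [subs, List.length_cons, code]
    omega
  | and φ ψ ih ih' =>
    have h1 := Nat.add_le_pair φ.code ψ.code
    have h2 := Nat.add_le_pair 9 (Nat.pair φ.code ψ.code)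
    simp only [subs, List.length_cons, List.length_append, code]
    omega
  | ex x φ ih =>
    have h1 := Nat.add_le_pair x φ.code
    have h2 := Nat.add_le_pair 10 (Nat.pair x φ.code)
    simp only [subs, List.length_cons, code]
    omega
  | _ =>
    simp only [subs, List.length_singleton, code]
    exact le_trans (by norm_num) (Nat.left_le_pair _ _)

theorem quotientBound_mono {N N' K K' n n' b b' : ℕ} (hN : N ≤ N') (hK : K ≤ K') (hn : n ≤ n')
    (hb : b ≤ b') : quotientBound N K n b ≤ quotientBound N' K' n' b' := by
  have h2 : ∀ {x y : ℕ}, x ≤ y → 2 ^ x ≤ 2 ^ y := fun h => Nat.pow_le_pow_right (by norm_num) h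
  have hNK : 2 ^ (N * K) ≤ 2 ^ (N' * K') := h2 (Nat.mul_le_mul hN hK)
  have hc : 2 ^ K * ((b + 1) * (2 ^ n * 2 ^ n)) ≤ 2 ^ K' * ((b' + 1) * (2 ^ n' * 2 ^ n')) := by
    have := h2 hK
    have := h2 hn
    gcongr
  have hs : (2 ^ K * ((b + 1) * (2 ^ n * 2 ^ n)) * N ^ 2 +
      2 ^ K * ((b + 1) * (2 ^ n * 2 ^ n)) * (2 ^ (N * K)) ^ 2) * 2 ≤
      (2 ^ K' * ((b' + 1) * (2 ^ n' * 2 ^ n')) * N' ^ 2 +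
      2 ^ K' * ((b' + 1) * (2 ^ n' * 2 ^ n')) * (2 ^ (N' * K')) ^ 2) * 2 :=
    Nat.mul_le_mul_right _ (Nat.add_le_add (Nat.mul_le_mul hc (Nat.pow_le_pow_left hN 2))
      (Nat.mul_le_mul hc (Nat.pow_le_pow_left hNK 2)))
  unfold quotientBound
  refine Nat.mul_le_mul_left _ (h2 (Nat.mul_le_mul (Nat.mul_le_mul hN hNK) ?_))
  exact (Nat.pow_le_pow_left (h2 hs) _).trans (Nat.pow_le_pow_right (by positivity) hs)

theorem outputBound_mono {l K K' n n' b b' : ℕ} (hK : K ≤ K') (hn : n ≤ n') (hb : b ≤ b') :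
    outputBound l K n b ≤ outputBound l K' n' b' := by
  have h2 : ∀ {x y : ℕ}, x ≤ y → 2 ^ x ≤ 2 ^ y := fun h => Nat.pow_le_pow_right (by norm_num) h
  have := h2 hK
  have := h2 hn
  unfold outputBound
  gcongr

/-! ### Comparison of languages with finitely many left quotients -/

/-- Two languages with at most `N` and `M` left quotients are equal if they agree on the words of
length at most `N * M`: among more prefixes, two lead to the same pair of left quotients, and the
part of the word between them can be cut out. -/
theorem Language.eq_of_finIndex {A : Type*} {L L' : Language A} {N M : ℕ}
    (h : FinIndex N fun u v : List A => u ++ v ∈ L) (h' : FinIndex M fun u v : List A => u ++ v ∈ L')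
    (hag : ∀ w : List A, w.length ≤ N * M → (w ∈ L ↔ w ∈ L')) : L = L' := by
  obtain ⟨f, hf⟩ := h
  obtain ⟨g, hg⟩ := h'
  refine Set.ext fun w => ?_
  change w ∈ L ↔ w ∈ L'
  induction hl : w.length using Nat.strong_induction_on generalizing w with
  | _ l ih =>
  by_cases hw : w.length ≤ N * M
  · exact hag w hw
  · let pre : Fin (N * M + 1) → Fin N × Fin M := fun i => (f (w.take i), g (w.take i))
    obtain ⟨i, j, hij, hpre⟩ : ∃ i j, i < j ∧ pre i = pre j := by
      obtain ⟨i, j, hne, hpre⟩ := Fintype.exists_ne_map_eq_of_card_lt pre (by simp)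
      rcases lt_or_gt_of_ne hne with h | h
      · exact ⟨i, j, h, hpre⟩
      · exact ⟨j, i, h, hpre.symm⟩
    simp only [pre, Prod.mk.injEq] at hpre
    have h1 := hf _ _ hpre.1 (w.drop j)
    have h2 := hg _ _ hpre.2 (w.drop j)
    simp only [List.take_append_drop] at h1 h2
    rw [← h1, ← h2]
    refine ih _ ?_ _ rfl
    have hj := j.2
    have : (i : ℕ) < j := hij
    simp only [List.length_append, List.length_take, List.length_drop]
    omega

/-! ### Automata as tables -/

namespace AutomatonTable

/-- The states of the automaton other than the accepting ones are below `N`. -/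
def Below (T : AutomatonTable) (N : ℕ) : Prop :=
  (∀ s ∈ T.1, s < N) ∧ ∀ t ∈ T.2.1, t.2.2 < N

theorem finIndex_accepts {T : AutomatonTable} {N : ℕ} (hT : T.Below N) (k : ℕ) :
    FinIndex (2 ^ N) fun u v : List (Fin k) => u ++ v ∈ (T.toNFA k).accepts := by
  classical
  have hlt : ∀ (u : List (Fin k)), ∀ s ∈ (T.toNFA k).eval u, s < N := by
    intro u
    induction u using List.reverseRecOn with
    | nil => exact hT.1
    | append_singleton u a ih =>
      intro s hs
      rw [NFA.eval_append_singleton, NFA.mem_stepSet] at hs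
      obtain ⟨t, -, hs⟩ := hs
      exact hT.2 _ hs
  refine FinIndex.of_fintype (fun u => {s : Fin N | (s : ℕ) ∈ (T.toNFA k).eval u}) (by simp) ?_
  intro u u' h v
  have : (T.toNFA k).eval u = (T.toNFA k).eval u' := by
    ext s
    constructor
    · intro hs
      exact (Set.ext_iff.1 h ⟨s, hlt u s hs⟩).1 hs
    · intro hs
      exact (Set.ext_iff.1 h ⟨s, hlt u' s hs⟩).2 hs
  have key : ∀ w, w ++ v ∈ (T.toNFA k).accepts ↔
      ∃ s ∈ (T.toNFA k).accept, s ∈ (T.toNFA k).evalFrom ((T.toNFA k).eval w) v := fun w => by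
    rw [NFA.mem_accepts, NFA.evalFrom_append]
    rfl
  rw [key, key, this]

/-- A language with at most `N` left quotients is recognised by an automaton whose states are
below `N`: the state reached by a word is an index of its left quotient. -/
theorem exists_table_of_finIndex {k N : ℕ} {L : Language (Fin k)}
    (h : FinIndex N fun u v : List (Fin k) => u ++ v ∈ L) :
    ∃ T : AutomatonTable, T.Below N ∧ (T.toNFA k).accepts = L := by
  classical
  obtain ⟨f, hf⟩ := h
  -- A word that leads to the state `t`, if there is one.
  let rep : Fin N → List (Fin k) := fun t => if h : ∃ w, f w = t then h.choose else []
  have hrep : ∀ w, f (rep (f w)) = f w := fun w => by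
    have h : ∃ w', f w' = f w := ⟨w, rfl⟩
    simp only [rep, dif_pos h]
    exact h.choose_spec
  let next : Fin N → Fin k → Fin N := fun t a => f (rep t ++ [a])
  let T : AutomatonTable := ([(f [] : ℕ)],
    (List.finRange N).flatMap fun t : Fin N => (List.finRange k).map fun a : Fin k =>
      ((t : ℕ), (a : ℕ), (next t a : ℕ)),
    ((List.finRange N).filter fun t : Fin N => rep t ∈ L).map Fin.val)
  have hstep : ∀ (t : Fin N) (a : Fin k), (T.toNFA k).step t a = {(next t a : ℕ)} := by
    intro t a
    ext q
    change ((t : ℕ), (a : ℕ), q) ∈ List.flatMap _ _ ↔ q = _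
    simp only [List.mem_flatMap, List.mem_map, List.mem_finRange, true_and, Prod.mk.injEq]
    constructor
    · rintro ⟨t', a', h1, h2, h3⟩
      obtain rfl := Fin.ext h1
      obtain rfl := Fin.ext h2
      exact h3.symm
    · rintro rfl
      exact ⟨t, a, rfl, rfl, rfl⟩
  have heval : ∀ w, ∃ t : Fin N, (T.toNFA k).eval w = {(t : ℕ)} ∧
      ∀ v, rep t ++ v ∈ L ↔ w ++ v ∈ L := by
    intro w
    induction w using List.reverseRecOn with
    | nil =>
      refine ⟨f [], ?_, hf _ _ (hrep [])⟩
      ext q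
      exact List.mem_singleton
    | append_singleton w a ih =>
      obtain ⟨t, ht, hq⟩ := ih
      refine ⟨next t a, ?_, fun v => ?_⟩
      · rw [NFA.eval_append_singleton, ht, NFA.stepSet_singleton, hstep]
      · refine (hf _ _ (hrep (rep t ++ [a])) v).trans ?_
        change rep t ++ [a] ++ v ∈ L ↔ _
        rw [List.append_assoc, hq, List.append_assoc]
  refine ⟨T, ⟨?_, ?_⟩, ?_⟩
  · intro s hs
    rw [List.mem_singleton.1 hs]
    exact (f []).2
  · intro t ht
    simp only [T, List.mem_flatMap, List.mem_map, List.mem_finRange, true_and] at ht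
    obtain ⟨t', a, rfl⟩ := ht
    exact (next t' a).2
  · refine Set.ext fun w => ?_
    obtain ⟨t, ht, hq⟩ := heval w
    change (∃ s ∈ (T.toNFA k).accept, s ∈ (T.toNFA k).eval w) ↔ w ∈ L
    have h0 := hq []
    rw [List.append_nil, List.append_nil] at h0
    rw [ht, ← h0]
    change (∃ s ∈ {q | q ∈ List.map _ _}, _) ↔ _
    simp only [Set.mem_ofPred_eq, List.mem_map, List.mem_filter, List.mem_finRange, true_and,
      decide_eq_true_eq, Set.mem_singleton_iff]
    constructor
    · rintro ⟨s, ⟨t', ht', rfl⟩, hs⟩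
      obtain rfl := Fin.ext hs
      exact ht'
    · exact fun h => ⟨t, ⟨t, h, rfl⟩, rfl⟩

end AutomatonTable

/-! ### Primitive recursive evaluation of formulas -/

section PrimrecTools

variable {α β : Type*} [Primcodable α] [Primcodable β]

theorem PrimrecRel.exists_mem {R : α → β → Prop} (hR : PrimrecRel R) {f : α → List β}
    (hf : Primrec f) : PrimrecPred fun a => ∃ b ∈ f a, R a b :=
  (PrimrecRel.exists_mem_list hR.swap).comp hf Primrec.id

theorem PrimrecRel.forall_mem {R : α → β → Prop} (hR : PrimrecRel R) {f : α → List β}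
    (hf : Primrec f) : PrimrecPred fun a => ∀ b ∈ f a, R a b :=
  (PrimrecRel.forall_mem_list hR.swap).comp hf Primrec.id

theorem Primrec.list_mem {γ : Type*} [Primcodable γ] {f : α → γ} {l : α → List γ} (hf : Primrec f)
    (hl : Primrec l) : PrimrecPred fun a => f a ∈ l a :=
  (PrimrecRel.exists_mem (R := fun a b => b = f a)
    (Primrec.eq.comp₂ Primrec₂.right (hf.comp₂ Primrec₂.left)) hl).of_eq fun a => by simp

theorem Primrec.nat_pow : Primrec₂ ((· ^ ·) : ℕ → ℕ → ℕ) :=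
  Primrec₂.unpaired'.1 Nat.Primrec.pow

theorem Primrec.testBit : Primrec₂ Nat.testBit :=
  (Primrec.eq.comp (Primrec.nat_mod.comp
    (Primrec.nat_div.comp Primrec.fst (Primrec.nat_pow.comp (Primrec.const 2) Primrec.snd))
    (Primrec.const 2)) (Primrec.const 1)).decide.of_eq fun n => by
      rw [Nat.testBit_eq_decide_div_mod_eq]

end PrimrecTools

/-- The tag of the Gödel number of a formula. -/
def codeTag (c : ℕ) : ℕ := c.unpair.1

/-- The arguments, packed in a number, of the Gödel number of a formula. -/
def codeArg (c : ℕ) : ℕ := c.unpair.2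

/-- The first argument, when there are several ones. -/
def codeFst (c : ℕ) : ℕ := (codeArg c).unpair.1

/-- The remaining arguments, when there are several ones. -/
def codeSnd (c : ℕ) : ℕ := (codeArg c).unpair.2

@[simp] theorem codeTag_pair (t c : ℕ) : codeTag (Nat.pair t c) = t := by simp [codeTag]
@[simp] theorem codeArg_pair (t c : ℕ) : codeArg (Nat.pair t c) = c := by simp [codeArg]
@[simp] theorem codeFst_pair (t a b : ℕ) : codeFst (Nat.pair t (Nat.pair a b)) = a := by
  simp [codeFst]
@[simp] theorem codeSnd_pair (t a b : ℕ) : codeSnd (Nat.pair t (Nat.pair a b)) = b := by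
  simp [codeSnd]

theorem primrec_codeTag : Primrec codeTag := Primrec.fst.comp Primrec.unpair
theorem primrec_codeArg : Primrec codeArg := Primrec.snd.comp Primrec.unpair
theorem primrec_codeFst : Primrec codeFst := Primrec.fst.comp (Primrec.unpair.comp primrec_codeArg)
theorem primrec_codeSnd : Primrec codeSnd := Primrec.snd.comp (Primrec.unpair.comp primrec_codeArg)

theorem codeArg_lt {c : ℕ} (h : 0 < codeTag c) : codeArg c < c := by
  conv_rhs => rw [← Nat.pair_unpair c]
  exact Nat.lt_pair_of_pos h

theorem codeFst_lt {c : ℕ} (h : 0 < codeTag c) : codeFst c < c :=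
  (Nat.unpair_left_le _).trans_lt (codeArg_lt h)

theorem codeSnd_lt {c : ℕ} (h : 0 < codeTag c) : codeSnd c < c :=
  (Nat.unpair_right_le _).trans_lt (codeArg_lt h)

/-- An instance of the evaluation problem of MSO on words: the Gödel number of a formula, a word, a
list of sets of positions, given by the numbers whose binary digits are their characteristic
functions, and a list of positions. -/
abbrev MSONode : Type := ℕ × List ℕ × List ℕ × List ℕ

namespace MSONode

/-- The instances that the evaluation of an instance refers to. -/
def children (b : MSONode) : List MSONode :=
  if codeTag b.1 = 5 then [(codeArg b.1, b.2)]
  else if codeTag b.1 = 6 then [(codeFst b.1, b.2), (codeSnd b.1, b.2)]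
  else if codeTag b.1 = 7 then
    (List.range b.2.1.length).map fun p => (codeArg b.1, b.2.1, b.2.2.1, p :: b.2.2.2)
  else if codeTag b.1 = 8 then
    (List.range (2 ^ b.2.1.length)).map fun P => (codeArg b.1, b.2.1, P :: b.2.2.1, b.2.2.2)
  else []

open Classical in
/-- The truth value of an instance, given the truth values of its children. -/
def combine (b : MSONode) (r : List Bool) : Bool :=
  if codeTag b.1 = 1 then
    decide (b.2.1.getD (b.2.2.2.getD (codeSnd b.1) 0) 0 = codeFst b.1)
  else if codeTag b.1 = 2 then
    decide (b.2.2.2.getD (codeFst b.1) 0 ≤ b.2.2.2.getD (codeSnd b.1) 0)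
  else if codeTag b.1 = 3 then
    decide (b.2.2.2.getD (codeFst b.1) 0 = b.2.2.2.getD (codeSnd b.1) 0)
  else if codeTag b.1 = 4 then
    (b.2.2.1.getD (codeSnd b.1) 0).testBit (b.2.2.2.getD (codeFst b.1) 0)
  else if codeTag b.1 = 5 then decide (false ∈ r)
  else if codeTag b.1 = 6 then decide (false ∉ r)
  else decide (true ∈ r)

theorem children_lt {b b' : MSONode} (h : b' ∈ b.children) : b'.1 < b.1 := by
  unfold children at h
  split_ifs at h with h5 h6 h7 h8
  · simp only [List.mem_singleton] at h
    subst h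
    exact codeArg_lt (by omega)
  · simp only [List.mem_cons, List.not_mem_nil, or_false] at h
    rcases h with rfl | rfl
    · exact codeFst_lt (by omega)
    · exact codeSnd_lt (by omega)
  · obtain ⟨p, -, rfl⟩ := List.mem_map.1 h
    exact codeArg_lt (by omega)
  · obtain ⟨p, -, rfl⟩ := List.mem_map.1 h
    exact codeArg_lt (by omega)
  · exact absurd h List.not_mem_nil

/-- Evaluation of MSO formulas, in terms of Gödel numbers. -/
def eval (b : MSONode) : Bool :=
  combine b (b.children.attach.map fun b' => eval b'.1)
termination_by b.1
decreasing_by exact children_lt b'.2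

theorem eval_eq (b : MSONode) : b.eval = combine b (b.children.map eval) := by
  rw [eval, List.attach_map_val]

section

open Primrec

theorem primrec_tag : Primrec fun b : MSONode => codeTag b.1 := primrec_codeTag.comp fst

theorem primrec_children : Primrec children := by
  have tag : ∀ i, PrimrecPred fun b : MSONode => codeTag b.1 = i := fun i =>
    Primrec.eq.comp primrec_tag (const i)
  have arg : Primrec fun b : MSONode => codeArg b.1 := primrec_codeArg.comp fst
  have len : Primrec fun b : MSONode => b.2.1.length := list_length.comp (fst.comp snd)
  refine ite (tag 5) ?_ (ite (tag 6) ?_ (ite (tag 7) ?_ (ite (tag 8) ?_ (const []))))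
  · exact list_cons.comp (arg.pair snd) (const [])
  · exact list_cons.comp ((primrec_codeFst.comp fst).pair snd)
      (list_cons.comp ((primrec_codeSnd.comp fst).pair snd) (const []))
  · refine list_map (list_range.comp len) ?_
    exact (arg.comp fst).pair ((fst.comp (snd.comp fst)).pair
      ((fst.comp (snd.comp (snd.comp fst))).pair
        (list_cons.comp snd (snd.comp (snd.comp (snd.comp fst))))))
  · refine list_map (list_range.comp (nat_pow.comp (const 2) len)) ?_
    exact (arg.comp fst).pair ((fst.comp (snd.comp fst)).pair
      ((list_cons.comp snd (fst.comp (snd.comp (snd.comp fst)))).pair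
        (snd.comp (snd.comp (snd.comp fst)))))

theorem primrec_combine : Primrec₂ combine := by
  have tag : ∀ i, PrimrecPred fun b : MSONode × List Bool => codeTag b.1.1 = i := fun i =>
    Primrec.eq.comp (primrec_tag.comp fst) (const i)
  have pos : ∀ {f : ℕ → ℕ}, Primrec f →
      Primrec fun b : MSONode × List Bool => b.1.2.2.2.getD (f b.1.1) 0 := fun hf =>
    (list_getD 0).comp (snd.comp (snd.comp (snd.comp fst))) (hf.comp (fst.comp fst))
  have fst' : Primrec fun b : MSONode × List Bool => codeFst b.1.1 :=
    primrec_codeFst.comp (fst.comp fst)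
  have snd' : Primrec fun b : MSONode × List Bool => codeSnd b.1.1 :=
    primrec_codeSnd.comp (fst.comp fst)
  unfold combine
  refine ite (tag 1) ?_ (ite (tag 2) ?_ (ite (tag 3) ?_ (ite (tag 4) ?_ (ite (tag 5) ?_
    (ite (tag 6) ?_ ?_)))))
  · exact (Primrec.eq.comp ((list_getD 0).comp (fst.comp (snd.comp fst)) (pos primrec_codeSnd))
      fst').decide
  · exact (nat_le.comp (pos primrec_codeFst) (pos primrec_codeSnd)).decide
  · exact (Primrec.eq.comp (pos primrec_codeFst) (pos primrec_codeSnd)).decide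
  · exact testBit.comp ((list_getD 0).comp (fst.comp (snd.comp (snd.comp fst))) snd')
      (pos primrec_codeFst)
  · exact (list_mem (const false) snd).decide
  · exact (list_mem (const false) snd).not.decide
  · exact (list_mem (const true) snd).decide

/-- Recursion along the children is primitive recursive, as their Gödel numbers are smaller. -/
theorem primrec_eval : Primrec eval :=
  nat_omega_rec' eval fst primrec_children (option_some.comp primrec_combine).to₂
    (fun _ _ => children_lt) fun b => by rw [← eval_eq]

end

end MSONode

/-- A set of positions is coded by a number. -/
theorem exists_testBit_iff {n : ℕ} (P : Set (Fin n)) :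
    ∃ M < 2 ^ n, ∀ p : Fin n, M.testBit p = true ↔ p ∈ P := by
  classical
  refine ⟨Nat.ofBits fun p : Fin n => decide (p ∈ P), Nat.ofBits_lt_two_pow _, fun p => ?_⟩
  rw [Nat.testBit_ofBits_lt _ _ p.2, decide_eq_true_eq]

/-- Evaluation is correct if the lists code the assignments. -/
theorem WordMSO.eval_iff {k : ℕ} (u : List (Fin k)) {n m : ℕ} (ψ : WordMSO (Fin k) n m)
    (ν : Fin n → Fin u.length) (S : Fin m → Set (Fin u.length)) {νl Sl : List ℕ}
    (hν : ∀ x : Fin n, νl.getD x 0 = ν x)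
    (hS : ∀ (i : Fin m) (p : Fin u.length), (Sl.getD i 0).testBit p = true ↔ p ∈ S i) :
    MSONode.eval (ψ.code, u.map Fin.val, Sl, νl) = true ↔ ψ.Holds u ν S := by
  induction ψ generalizing νl Sl with
  | letter a x =>
    rw [MSONode.eval_eq]
    simp only [MSONode.combine, code, codeTag_pair, codeFst_pair, codeSnd_pair, hν, if_true,
      decide_eq_true_eq, Holds, List.get_eq_getElem]
    rw [List.getD_eq_getElem _ _ (by simp)]
    simp [Fin.ext_iff]
  | le x y =>
    rw [MSONode.eval_eq]
    simp [MSONode.combine, code, hν, Holds, -List.getD_eq_getElem?_getD]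
  | eq x y =>
    rw [MSONode.eval_eq]
    simp [MSONode.combine, code, hν, Holds, Fin.ext_iff, -List.getD_eq_getElem?_getD]
  | mem x i =>
    rw [MSONode.eval_eq]
    simp [MSONode.combine, code, hν, hS, Holds, -List.getD_eq_getElem?_getD]
  | neg ψ ih =>
    rw [MSONode.eval_eq]
    simp [MSONode.combine, MSONode.children, code, Holds, ← ih ν S hν hS]
  | and ψ ψ' ih ih' =>
    rw [MSONode.eval_eq]
    simp [MSONode.combine, MSONode.children, code, Holds, ← ih ν S hν hS, ← ih' ν S hν hS]
  | ex ψ ih =>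
    rw [MSONode.eval_eq]
    have key : ∀ p : Fin u.length, MSONode.eval (ψ.code, u.map Fin.val, Sl, p :: νl) = true ↔
        ψ.Holds u (Fin.cons p ν) S := fun p => by
      refine ih _ S (fun x => ?_) hS
      refine Fin.cases rfl (fun x => ?_) x
      simpa using hν x
    simp only [MSONode.combine, MSONode.children, code, codeTag_pair, codeArg_pair, Holds, ← key]
    simp [Fin.exists_iff]
  | exSet ψ ih =>
    rw [MSONode.eval_eq]
    have key : ∀ (M : ℕ) (P : Set (Fin u.length)),
        (∀ p : Fin u.length, M.testBit p = true ↔ p ∈ P) →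
        (MSONode.eval (ψ.code, u.map Fin.val, M :: Sl, νl) = true ↔
          ψ.Holds u ν (Fin.cons P S)) := fun M P hM => by
      refine ih ν _ hν (fun i => ?_)
      refine Fin.cases hM (fun i => ?_) i
      simpa using hS i
    simp [MSONode.combine, MSONode.children, code, Holds]
    constructor
    · rintro ⟨M, -, hM⟩
      exact ⟨{p | M.testBit p = true}, (key M _ fun p => Iff.rfl).1 hM⟩
    · rintro ⟨P, hP⟩
      obtain ⟨M, hlt, hM⟩ := exists_testBit_iff P
      exact ⟨M, hlt, (key M P hM).2 hP⟩

/-- An instance of the evaluation problem of `LTFormula`s: the Gödel number of a formula, an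
origin-graph, given by its input word and the list of its output letters together with their
origins, a list of numbers whose binary digits are the characteristic functions of sets of
positions, and the positions assigned to the two variables. The input positions are numbered first,
and the output positions next. -/
abbrev LTNode : Type := ℕ × (List ℕ × List (ℕ × ℕ)) × List ℕ × ℕ × ℕ

namespace LTNode

/-- Removal of an origin symbol from the Gödel number of a term. -/
def stripOrig (c : ℕ) : ℕ := if codeTag c = 2 then codeArg c else c

/-- The value of the term with Gödel number `c`. As the origin function is idempotent, only the
outermost symbol and the variable matter. -/
def termVal (b : LTNode) (c : ℕ) : ℕ :=
  let x := codeArg (stripOrig^[c] c)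
  let p := if x = 0 then b.2.2.2.1 else b.2.2.2.2
  if codeTag c = 1 then p
  else if p < b.2.1.1.length then p
  else (b.2.1.2.getD (p - b.2.1.1.length) (0, 0)).2

/-- The instances that the evaluation of an instance refers to. -/
def children (b : LTNode) : List LTNode :=
  if codeTag b.1 = 8 then [(codeArg b.1, b.2)]
  else if codeTag b.1 = 9 then [(codeFst b.1, b.2), (codeSnd b.1, b.2)]
  else if codeTag b.1 = 10 then
    (List.range (b.2.1.1.length + b.2.1.2.length)).map fun p =>
      (codeSnd b.1, b.2.1, b.2.2.1,
        if codeFst b.1 = 0 then (p, b.2.2.2.2) else (b.2.2.2.1, p))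
  else []

open Classical in
/-- The truth value of the MSO formula with Gödel number `c` at the positions `l`, which is false
if one of them is not an input position. -/
def inputValue (b : LTNode) (c : ℕ) (l : List ℕ) : Bool :=
  decide (∀ p ∈ l, p < b.2.1.1.length) && MSONode.eval (c, b.2.1.1, b.2.2.1, l)

open Classical in
/-- The truth value of an atomic instance. -/
def atomValue (b : LTNode) : Bool :=
  if codeTag b.1 = 1 then
    decide (b.2.1.1.length ≤ b.termVal (codeSnd b.1) ∧
      (b.2.1.2.getD (b.termVal (codeSnd b.1) - b.2.1.1.length) (0, 0)).1 = codeFst b.1)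
  else if codeTag b.1 = 2 then
    decide (b.2.1.1.length ≤ b.termVal (codeFst b.1) ∧
      b.2.1.1.length ≤ b.termVal (codeSnd b.1) ∧
      b.termVal (codeFst b.1) ≤ b.termVal (codeSnd b.1))
  else if codeTag b.1 = 3 then
    decide (b.termVal (codeFst b.1) = b.termVal (codeSnd b.1))
  else if codeTag b.1 = 4 then
    (b.2.2.1.getD (codeSnd b.1) 0).testBit (b.termVal (codeFst b.1))
  else if codeTag b.1 = 5 then b.inputValue (codeArg b.1) []
  else if codeTag b.1 = 6 then b.inputValue (codeFst b.1) [b.termVal (codeSnd b.1)]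
  else b.inputValue (codeFst b.1)
    [b.termVal (codeSnd b.1).unpair.1, b.termVal (codeSnd b.1).unpair.2]

open Classical in
/-- The truth value of an instance, given the truth values of its children. -/
def combine (b : LTNode) (r : List Bool) : Bool :=
  if codeTag b.1 = 8 then decide (false ∈ r)
  else if codeTag b.1 = 9 then decide (false ∉ r)
  else if codeTag b.1 = 10 then decide (true ∈ r)
  else b.atomValue

theorem children_lt {b b' : LTNode} (h : b' ∈ b.children) : b'.1 < b.1 := by
  unfold children at h
  by_cases h8 : codeTag b.1 = 8
  · rw [if_pos h8, List.mem_singleton] at h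
    subst h
    exact codeArg_lt (by omega)
  rw [if_neg h8] at h
  by_cases h9 : codeTag b.1 = 9
  · simp only [if_pos h9, List.mem_cons, List.not_mem_nil, or_false] at h
    rcases h with rfl | rfl
    · exact codeFst_lt (by omega)
    · exact codeSnd_lt (by omega)
  rw [if_neg h9] at h
  by_cases h10 : codeTag b.1 = 10
  · rw [if_pos h10] at h
    obtain ⟨p, -, rfl⟩ := List.mem_map.1 h
    exact codeSnd_lt (by omega)
  · rw [if_neg h10] at h
    exact absurd h List.not_mem_nil

/-- Evaluation of `LTFormula`s, in terms of Gödel numbers. -/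
def eval (b : LTNode) : Bool :=
  combine b (b.children.attach.map fun b' => eval b'.1)
termination_by b.1
decreasing_by exact children_lt b'.2

theorem eval_eq (b : LTNode) : b.eval = combine b (b.children.map eval) := by
  rw [eval, List.attach_map_val]

section

open Primrec

theorem primrec_len : Primrec fun b : LTNode => b.2.1.1.length :=
  list_length.comp (fst.comp (fst.comp snd))

theorem primrec_stripOrig : Primrec stripOrig :=
  ite (Primrec.eq.comp primrec_codeTag (const 2)) primrec_codeArg Primrec.id

theorem primrec_termVal : Primrec₂ termVal := by
  have hx : Primrec fun a : LTNode × ℕ => codeArg (stripOrig^[a.2] a.2) :=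
    primrec_codeArg.comp (nat_iterate snd snd (primrec_stripOrig.comp₂ Primrec₂.right))
  have hν : Primrec fun a : LTNode × ℕ => a.1.2.2.2 := snd.comp (snd.comp (snd.comp fst))
  have hp : Primrec fun a : LTNode × ℕ =>
      if codeArg (stripOrig^[a.2] a.2) = 0 then a.1.2.2.2.1 else a.1.2.2.2.2 :=
    ite (Primrec.eq.comp hx (const 0)) (fst.comp hν) (snd.comp hν)
  have hl : Primrec fun a : LTNode × ℕ => a.1.2.1.1.length := primrec_len.comp fst
  refine ite (Primrec.eq.comp (primrec_codeTag.comp snd) (const 1)) hp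
    (ite (nat_lt.comp hp hl) hp ?_)
  exact snd.comp ((list_getD (0, 0)).comp (snd.comp (fst.comp (snd.comp fst)))
    (nat_sub.comp hp hl))

theorem primrec_children : Primrec children := by
  have tag : ∀ i, PrimrecPred fun b : LTNode => codeTag b.1 = i := fun i =>
    Primrec.eq.comp (primrec_codeTag.comp fst) (const i)
  have arg : Primrec fun b : LTNode => codeArg b.1 := primrec_codeArg.comp fst
  have fst' : Primrec fun b : LTNode => codeFst b.1 := primrec_codeFst.comp fst
  have snd' : Primrec fun b : LTNode => codeSnd b.1 := primrec_codeSnd.comp fst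
  refine ite (tag 8) ?_ (ite (tag 9) ?_ (ite (tag 10) ?_ (const [])))
  · exact list_cons.comp (arg.pair snd) (const [])
  · exact list_cons.comp (fst'.pair snd) (list_cons.comp (snd'.pair snd) (const []))
  · refine list_map (list_range.comp (nat_add.comp primrec_len
      (list_length.comp (snd.comp (fst.comp snd))))) ?_
    have hν : Primrec fun a : LTNode × ℕ => a.1.2.2.2 := snd.comp (snd.comp (snd.comp fst))
    exact (snd'.comp fst).pair ((fst.comp (snd.comp fst)).pair
      ((fst.comp (snd.comp (snd.comp fst))).pair
        (ite (Primrec.eq.comp (fst'.comp fst) (const 0)) (snd.pair (snd.comp hν))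
          ((fst.comp hν).pair snd))))

theorem primrec_inputValue {α : Type*} [Primcodable α] {b : α → LTNode} {c : α → ℕ}
    {l : α → List ℕ} (hb : Primrec b) (hc : Primrec c) (hl : Primrec l) :
    Primrec fun a => (b a).inputValue (c a) (l a) := by
  have hu : Primrec fun a => (b a).2.1.1 := fst.comp (fst.comp (snd.comp hb))
  have hX : Primrec fun a => (b a).2.2.1 := fst.comp (snd.comp (snd.comp hb))
  have hlt : PrimrecRel fun (a : α) (p : ℕ) => p < (b a).2.1.1.length :=
    nat_lt.comp snd (list_length.comp (hu.comp fst))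
  exact Primrec.and.comp (hlt.forall_mem hl).decide
    (MSONode.primrec_eval.comp (hc.pair (hu.pair (hX.pair hl))))

theorem primrec_atomValue : Primrec atomValue := by
  have tag : ∀ i, PrimrecPred fun b : LTNode => codeTag b.1 = i := fun i =>
    Primrec.eq.comp (primrec_codeTag.comp fst) (const i)
  have val : ∀ {f : ℕ → ℕ}, Primrec f → Primrec fun b : LTNode => b.termVal (f b.1) := fun hf =>
    primrec_termVal.comp Primrec.id (hf.comp fst)
  have fst' : Primrec fun b : LTNode => codeFst b.1 := primrec_codeFst.comp fst
  have snd' : Primrec fun b : LTNode => codeSnd b.1 := primrec_codeSnd.comp fst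
  have val₁ : Primrec fun b : LTNode => b.termVal (codeSnd b.1).unpair.1 :=
    val (f := fun c => (codeSnd c).unpair.1) (fst.comp (unpair.comp primrec_codeSnd))
  have val₂ : Primrec fun b : LTNode => b.termVal (codeSnd b.1).unpair.2 :=
    val (f := fun c => (codeSnd c).unpair.2) (snd.comp (unpair.comp primrec_codeSnd))
  have letter : Primrec fun b : LTNode =>
      (b.2.1.2.getD (b.termVal (codeSnd b.1) - b.2.1.1.length) (0, 0)).1 :=
    fst.comp ((list_getD (0, 0)).comp (snd.comp (fst.comp snd))
      (nat_sub.comp (val primrec_codeSnd) primrec_len))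
  have valF := val primrec_codeFst
  have valS := val primrec_codeSnd
  have h1 := ((nat_le.comp primrec_len valS).and (Primrec.eq.comp letter fst')).decide
  have h2 := ((nat_le.comp primrec_len valF).and
      ((nat_le.comp primrec_len valS).and (nat_le.comp valF valS))).decide
  have h3 := (Primrec.eq.comp valF valS).decide
  have h4 : Primrec fun b : LTNode =>
      (b.2.2.1.getD (codeSnd b.1) 0).testBit (b.termVal (codeFst b.1)) :=
    testBit.comp ((list_getD 0).comp (fst.comp (snd.comp snd)) snd') valF
  have h5 : Primrec fun b : LTNode => b.inputValue (codeArg b.1) [] :=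
    primrec_inputValue Primrec.id (primrec_codeArg.comp fst) (const [])
  have h6 : Primrec fun b : LTNode => b.inputValue (codeFst b.1) [b.termVal (codeSnd b.1)] :=
    primrec_inputValue Primrec.id fst' (list_cons.comp valS (const []))
  have h7 : Primrec fun b : LTNode => b.inputValue (codeFst b.1)
      [b.termVal (codeSnd b.1).unpair.1, b.termVal (codeSnd b.1).unpair.2] :=
    primrec_inputValue Primrec.id fst' (list_cons.comp val₁ (list_cons.comp val₂ (const [])))
  exact (ite (tag 1) h1 (ite (tag 2) h2 (ite (tag 3) h3 (ite (tag 4) h4 (ite (tag 5) h5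
    (ite (tag 6) h6 h7)))))).of_eq fun b => rfl

theorem primrec_combine : Primrec₂ combine := by
  have tag : ∀ i, PrimrecPred fun b : LTNode × List Bool => codeTag b.1.1 = i := fun i =>
    Primrec.eq.comp (primrec_codeTag.comp (fst.comp fst)) (const i)
  unfold combine
  refine ite (tag 8) ?_ (ite (tag 9) ?_ (ite (tag 10) ?_ (primrec_atomValue.comp fst)))
  · exact (list_mem (const false) snd).decide
  · exact (list_mem (const false) snd).not.decide
  · exact (list_mem (const true) snd).decide

theorem primrec_eval : Primrec eval :=
  nat_omega_rec' eval fst primrec_children (option_some.comp primrec_combine).to₂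
    (fun _ _ => children_lt) fun b => by rw [← eval_eq]

end

/-- The number of symbols of a term is at most its Gödel number, so `t.code` steps suffice to reach
the variable. -/
theorem iterate_stripOrig (t : LTTerm) {n : ℕ} (hn : t.code ≤ n) :
    stripOrig^[n] t.code = Nat.pair 1 t.fvar := by
  induction t generalizing n with
  | var x =>
    refine Function.iterate_fixed ?_ n
    simp [stripOrig, LTTerm.code]
  | orig t ih =>
    have := Nat.lt_pair_of_pos (t := 2) (c := t.code) (by norm_num)
    rw [LTTerm.code] at hn ⊢
    obtain ⟨n, rfl⟩ : ∃ n', n = n' + 1 := ⟨n - 1, by omega⟩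
    rw [Function.iterate_succ_apply]
    have : stripOrig (Nat.pair 2 t.code) = t.code := by simp [stripOrig]
    rw [this]
    exact ih (by omega)

end LTNode

namespace OGraph

variable {k m : ℕ} (g : OGraph (Fin k) (Fin m))

/-- The number of a position, where the input positions come first. -/
def posNum : g.Pos → ℕ
  | Sum.inl p => p
  | Sum.inr q => g.input.length + q

/-- The list of the output letters together with their origins. -/
def outputCode : List (ℕ × ℕ) :=
  List.ofFn fun q : Fin g.output.length => ((g.output.get q : ℕ), (g.origin q : ℕ))

theorem length_outputCode : g.outputCode.length = g.output.length := List.length_ofFn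

theorem getD_outputCode (q : Fin g.output.length) :
    g.outputCode.getD q (0, 0) = ((g.output.get q : ℕ), (g.origin q : ℕ)) := by
  rw [List.getD_eq_getElem _ _ (by rw [length_outputCode]; exact q.2)]
  simp [outputCode]

theorem posNum_injective : Function.Injective g.posNum := by
  rintro (p | p) (q | q) h <;> simp only [posNum] at h
  · exact congrArg _ (Fin.ext h)
  · omega
  · omega
  · exact congrArg _ (Fin.ext (by omega))

theorem posNum_lt (p : g.Pos) : g.posNum p < g.input.length + g.output.length := by
  rcases p with p | p <;> simp only [posNum] <;> omega

theorem exists_posNum_eq {i : ℕ} (h : i < g.input.length + g.output.length) :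
    ∃ p, g.posNum p = i := by
  by_cases hi : i < g.input.length
  · exact ⟨Sum.inl ⟨i, hi⟩, rfl⟩
  · exact ⟨Sum.inr ⟨i - g.input.length, by omega⟩, by simp only [posNum]; omega⟩

theorem posNum_lt_length_iff (p : g.Pos) :
    g.posNum p < g.input.length ↔ ∃ q, p = Sum.inl q := by
  rcases p with p | p <;> simp [posNum]

end OGraph

theorem LTTerm.eval_orig {A B : Type*} (g : OGraph A B) (ν : Fin 2 → g.Pos) (t : LTTerm) :
    g.orig (t.eval g ν) = g.orig (ν t.fvar) := by
  induction t with
  | var x => rfl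
  | orig t ih =>
    rw [LTTerm.eval, LTTerm.fvar, ← ih]
    rcases t.eval g ν with p | p <;> rfl

section

variable {k m n : ℕ} (g : OGraph (Fin k) (Fin m))

/-- The instance of the evaluation problem given by a formula and an assignment in an
origin-graph. -/
def LTNode.of (c : ℕ) (Xl : List ℕ) (ν : Fin 2 → g.Pos) : LTNode :=
  (c, (g.input.map Fin.val, g.outputCode), Xl, g.posNum (ν 0), g.posNum (ν 1))

theorem LTNode.termVal_of (c : ℕ) (Xl : List ℕ) (ν : Fin 2 → g.Pos) (t : LTTerm) :
    (LTNode.of g c Xl ν).termVal t.code = g.posNum (t.eval g ν) := by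
  have hx : (if codeArg (Nat.pair 1 (t.fvar : ℕ)) = 0 then g.posNum (ν 0) else g.posNum (ν 1)) =
      g.posNum (ν t.fvar) := by
    rw [codeArg_pair]
    rcases Fin.exists_fin_two.1 ⟨t.fvar, rfl⟩ with h | h <;> rw [h] <;> rfl
  simp only [termVal, iterate_stripOrig t le_rfl, LTNode.of, List.length_map, hx]
  cases t with
  | var x => simp [LTTerm.code, LTTerm.eval, LTTerm.fvar]
  | orig t =>
    rw [LTTerm.eval, LTTerm.eval_orig, LTTerm.fvar]
    rcases ν t.fvar with p | q
    · simp [LTTerm.code, OGraph.posNum, OGraph.orig]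
    · simp [LTTerm.code, OGraph.posNum, OGraph.orig, OGraph.getD_outputCode,
        -List.getD_eq_getElem?_getD]

theorem LTNode.inputValue_of {j : ℕ} (c : ℕ) (ψ : WordMSO (Fin k) j n) (X : Fin n → Set g.Pos)
    (ν : Fin 2 → g.Pos) {Xl : List ℕ}
    (hX : ∀ (i : Fin n) (p : g.Pos), (Xl.getD i 0).testBit (g.posNum p) = true ↔ p ∈ X i)
    (t : Fin j → g.Pos) :
    (LTNode.of g c Xl ν).inputValue ψ.code (List.ofFn fun x => g.posNum (t x)) = true ↔
      ∃ p : Fin j → Fin g.input.length, (∀ x, t x = Sum.inl (p x)) ∧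
        ψ.Holds g.input p (fun i => Sum.inl ⁻¹' X i) := by
  have key : ∀ p : Fin j → Fin g.input.length, (∀ x, t x = Sum.inl (p x)) →
      (MSONode.eval (ψ.code, g.input.map Fin.val, Xl, List.ofFn fun x => g.posNum (t x)) = true ↔
        ψ.Holds g.input p (fun i => Sum.inl ⁻¹' X i)) := fun p hp =>
    ψ.eval_iff g.input p _ (fun x => by
      rw [List.getD_eq_getElem _ _ (by simp), List.getElem_ofFn]
      simp [hp, OGraph.posNum]) fun i q => hX i (Sum.inl q)
  rw [inputValue, Bool.and_eq_true, decide_eq_true_eq]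
  simp only [LTNode.of, List.length_map, List.forall_mem_ofFn_iff, OGraph.posNum_lt_length_iff]
  constructor
  · rintro ⟨h, he⟩
    choose p hp using h
    exact ⟨p, hp, (key p hp).1 he⟩
  · rintro ⟨p, hp, h⟩
    exact ⟨fun x => ⟨p x, hp x⟩, (key p hp).2 h⟩

theorem LTNode.atomValue_eq_eval {b : LTNode} (h8 : codeTag b.1 ≠ 8) (h9 : codeTag b.1 ≠ 9)
    (h10 : codeTag b.1 ≠ 10) : b.eval = b.atomValue := by
  rw [eval_eq, combine, if_neg h8, if_neg h9, if_neg h10]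

theorem LTFormula.eval_iff (X : Fin n → Set g.Pos) (φ : LTFormula (Fin k) (Fin m) n)
    (ν : Fin 2 → g.Pos) {Xl : List ℕ}
    (hX : ∀ (i : Fin n) (p : g.Pos), (Xl.getD i 0).testBit (g.posNum p) = true ↔ p ∈ X i) :
    (LTNode.of g φ.code Xl ν).eval = true ↔ φ.Holds g X ν := by
  have tv := fun c ν t => LTNode.termVal_of g c Xl ν t
  have atom : ∀ (t c : ℕ) (ν : Fin 2 → g.Pos), t ≠ 8 → t ≠ 9 → t ≠ 10 →
      (LTNode.of g (Nat.pair t c) Xl ν).eval = (LTNode.of g (Nat.pair t c) Xl ν).atomValue :=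
    fun t c ν h8 h9 h10 => LTNode.atomValue_eq_eval (by simpa [LTNode.of]) (by simpa [LTNode.of])
      (by simpa [LTNode.of])
  have fst_of : ∀ c ν, (LTNode.of g c Xl ν).1 = c := fun _ _ => rfl
  have len_of : ∀ c ν, (LTNode.of g c Xl ν).2.1.1.length = g.input.length := fun _ _ =>
    List.length_map _
  have out_of : ∀ c ν, (LTNode.of g c Xl ν).2.1.2 = g.outputCode := fun _ _ => rfl
  have set_of : ∀ c ν, (LTNode.of g c Xl ν).2.2.1 = Xl := fun _ _ => rfl
  induction φ generalizing ν with
  | letter b t =>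
    rw [code, atom _ _ _ (by decide) (by decide) (by decide)]
    simp only [LTNode.atomValue, fst_of, codeTag_pair, codeFst_pair, codeSnd_pair, if_true, tv,
      len_of, out_of, decide_eq_true_eq, Holds]
    rcases t.eval g ν with p | q
    · simp [OGraph.posNum]
    · simp [OGraph.posNum, OGraph.getD_outputCode, -List.getD_eq_getElem?_getD, ← Fin.ext_iff]
  | leOut s t =>
    rw [code, atom _ _ _ (by decide) (by decide) (by decide)]
    simp only [LTNode.atomValue, fst_of, codeTag_pair, codeFst_pair, codeSnd_pair, tv,
      len_of, Holds]
    rcases s.eval g ν with p | q <;> rcases t.eval g ν with p' | q' <;>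
      simp [OGraph.posNum]
  | eq s t =>
    rw [code, atom _ _ _ (by decide) (by decide) (by decide)]
    simp [LTNode.atomValue, fst_of, tv, Holds, g.posNum_injective.eq_iff]
  | mem t i =>
    rw [code, atom _ _ _ (by decide) (by decide) (by decide)]
    simp [LTNode.atomValue, fst_of, tv, set_of, Holds, hX, -List.getD_eq_getElem?_getD]
  | input0 ψ =>
    rw [code, atom _ _ _ (by decide) (by decide) (by decide)]
    have h := LTNode.inputValue_of g (Nat.pair 5 ψ.code) ψ X ν hX ![]
    refine Iff.trans (Eq.congr_left ?_) (h.trans ?_)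
    · simp [LTNode.atomValue, fst_of]
    · simp only [IsEmpty.forall_iff, true_and, Holds]
      constructor
      · rintro ⟨p, hp⟩
        rwa [Subsingleton.elim ![] p]
      · exact fun hp => ⟨![], hp⟩
  | input1 ψ t =>
    rw [code, atom _ _ _ (by decide) (by decide) (by decide)]
    have h := LTNode.inputValue_of g (Nat.pair 6 (Nat.pair ψ.code t.code)) ψ X ν hX
      ![t.eval g ν]
    refine Iff.trans (Eq.congr_left ?_) (h.trans ?_)
    · simp [LTNode.atomValue, fst_of, tv]
    · constructor
      · rintro ⟨p, hp, hψ⟩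
        refine ⟨p 0, hp 0, ?_⟩
        rwa [show ![p 0] = p from funext fun x => by rw [Subsingleton.elim x 0]; rfl]
      · rintro ⟨p, hp, hψ⟩
        exact ⟨![p], fun x => by rw [Subsingleton.elim x 0]; exact hp, hψ⟩
  | input2 ψ s t =>
    rw [code, atom _ _ _ (by decide) (by decide) (by decide)]
    have h := LTNode.inputValue_of g (Nat.pair 7 (Nat.pair ψ.code (Nat.pair s.code t.code))) ψ X ν
      hX ![s.eval g ν, t.eval g ν]
    refine Iff.trans (Eq.congr_left ?_) (h.trans ?_)
    · simp [LTNode.atomValue, fst_of, tv]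
    · constructor
      · rintro ⟨p, hp, hψ⟩
        refine ⟨p 0, p 1, hp 0, hp 1, ?_⟩
        rwa [show ![p 0, p 1] = p from funext (Fin.forall_fin_two.2 ⟨rfl, rfl⟩)]
      · rintro ⟨p, r, hp, hr, hψ⟩
        exact ⟨![p, r], Fin.forall_fin_two.2 ⟨hp, hr⟩, hψ⟩
  | neg φ ih =>
    rw [LTNode.eval_eq]
    simp [LTNode.combine, LTNode.children, code, LTNode.of, Holds, ← ih]
  | and φ ψ ih ih' =>
    rw [LTNode.eval_eq]
    simp [LTNode.combine, LTNode.children, code, LTNode.of, Holds, ← ih, ← ih']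
  | ex x φ ih =>
    rw [LTNode.eval_eq, Holds]
    simp only [← ih]
    have hc : ∀ p : g.Pos, LTNode.eval (φ.code, (g.input.map Fin.val, g.outputCode), Xl,
        if (x : ℕ) = 0 then (g.posNum p, g.posNum (ν 1)) else (g.posNum (ν 0), g.posNum p)) =
        (LTNode.of g φ.code Xl (Function.update ν x p)).eval := fun p => by
      rcases Fin.exists_fin_two.1 ⟨x, rfl⟩ with h | h <;> rw [h] <;> rfl
    simp only [← hc]
    simp [LTNode.combine, LTNode.children, code, LTNode.of, OGraph.length_outputCode, -Sum.exists]
    constructor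
    · rintro ⟨i, hi, he⟩
      obtain ⟨p, rfl⟩ := g.exists_posNum_eq hi
      exact ⟨p, he⟩
    · rintro ⟨p, he⟩
      exact ⟨_, g.posNum_lt p, he⟩

end

/-! ### Decidability of membership in the input domain -/

/-- The lists of length at most `n` with entries in `l`. -/
def listsUpTo {β : Type*} (l : List β) (n : ℕ) : List (List β) :=
  n.rec [[]] fun _ ls => [] :: l.flatMap fun a => ls.map fun w => a :: w

theorem mem_listsUpTo {β : Type*} {l : List β} {n : ℕ} {w : List β} :
    w ∈ listsUpTo l n ↔ w.length ≤ n ∧ ∀ a ∈ w, a ∈ l := by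
  induction n generalizing w with
  | zero =>
    change w ∈ [[]] ↔ _
    rw [List.mem_singleton, Nat.le_zero, List.length_eq_zero_iff]
    constructor
    · rintro rfl
      simp
    · exact fun h => h.1
  | succ n ih =>
    change w ∈ [] :: l.flatMap (fun a => (listsUpTo l n).map fun w => a :: w) ↔ _
    cases w with
    | nil => simp
    | cons a w =>
      simp [ih]
      tauto

theorem primrec_listsUpTo {β : Type*} [Primcodable β] : Primrec₂ (@listsUpTo β) := by
  refine Primrec.nat_rec' (α := List β × ℕ) Primrec.snd (Primrec.const [[]])
    (h := fun a b => [] :: a.1.flatMap fun x => b.2.map fun w => x :: w) ?_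
  refine Primrec.list_cons.comp (Primrec.const _) (Primrec.list_flatMap
    (Primrec.fst.comp Primrec.fst) (Primrec.list_map
      (Primrec.snd.comp (Primrec.snd.comp Primrec.fst)) ?_))
  exact Primrec.list_cons.comp (Primrec.snd.comp Primrec.fst) Primrec.snd

theorem primrec_two_pow : Primrec fun n : ℕ => 2 ^ n :=
  Primrec.nat_pow.comp (Primrec.const 2) Primrec.id

theorem primrec_outputBound {α : Type*} [Primcodable α] {l K n b : α → ℕ} (hl : Primrec l)
    (hK : Primrec K) (hn : Primrec n) (hb : Primrec b) :
    Primrec fun a => outputBound (l a) (K a) (n a) (b a) := by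
  have hn' := primrec_two_pow.comp hn
  exact Primrec.nat_mul.comp (Primrec.nat_mul.comp hl (Primrec.nat_mul.comp
    (primrec_two_pow.comp hK) (Primrec.nat_mul.comp (Primrec.succ.comp hb)
      (Primrec.nat_mul.comp hn' hn')))) (Primrec.const 2)

theorem primrec_quotientBound {α : Type*} [Primcodable α] {N K n b : α → ℕ} (hN : Primrec N)
    (hK : Primrec K) (hn : Primrec n) (hb : Primrec b) :
    Primrec fun a => quotientBound (N a) (K a) (n a) (b a) := by
  have hn' := primrec_two_pow.comp hn
  have h1 : Primrec fun a => 2 ^ K a * ((b a + 1) * (2 ^ n a * 2 ^ n a)) :=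
    Primrec.nat_mul.comp (primrec_two_pow.comp hK)
      (Primrec.nat_mul.comp (Primrec.succ.comp hb) (Primrec.nat_mul.comp hn' hn'))
  have h2 : Primrec fun a => 2 ^ (N a * K a) := primrec_two_pow.comp (Primrec.nat_mul.comp hN hK)
  have hsq : ∀ {f : α → ℕ}, Primrec f → Primrec fun a => f a ^ 2 := fun hf =>
    Primrec.nat_pow.comp hf (Primrec.const 2)
  have h3 : Primrec fun a => (2 ^ K a * ((b a + 1) * (2 ^ n a * 2 ^ n a)) * N a ^ 2 +
      2 ^ K a * ((b a + 1) * (2 ^ n a * 2 ^ n a)) * (2 ^ (N a * K a)) ^ 2) * 2 :=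
    Primrec.nat_mul.comp (Primrec.nat_add.comp (Primrec.nat_mul.comp h1 (hsq hN))
      (Primrec.nat_mul.comp h1 (hsq h2))) (Primrec.const 2)
  exact Primrec.nat_mul.comp (Primrec.const 2) (primrec_two_pow.comp (Primrec.nat_mul.comp
    (Primrec.nat_mul.comp hN h2) (Primrec.nat_pow.comp (primrec_two_pow.comp h3) h3)))

theorem primrec_tower : Primrec tower :=
  Primrec.nat_iterate Primrec.id (Primrec.const 8)
    (Primrec.nat_pow.comp (Primrec.const 4) Primrec.snd).to₂

/-- The Gödel number of the universal closure of a formula. -/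
def closureCode (c : ℕ) : ℕ :=
  Nat.pair 8 (Nat.pair 10 (Nat.pair 0 (Nat.pair 10 (Nat.pair 1 (Nat.pair 8 c)))))

theorem primrec_closureCode : Primrec closureCode := by
  have h : ∀ (t : ℕ) {f : ℕ → ℕ}, Primrec f → Primrec fun c => Nat.pair t (f c) := fun t _ hf =>
    Primrec₂.natPair.comp (Primrec.const t) hf
  exact h _ (h _ (h _ (h _ (h _ (h _ Primrec.id)))))

theorem LTFormula.eval_closureCode {k m n : ℕ} (g : OGraph (Fin k) (Fin m)) (X : Fin n → Set g.Pos)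
    (φ : LTFormula (Fin k) (Fin m) n) {Xl : List ℕ}
    (hX : ∀ (i : Fin n) (p : g.Pos), (Xl.getD i 0).testBit (g.posNum p) = true ↔ p ∈ X i) :
    LTNode.eval (closureCode φ.code, (g.input.map Fin.val, g.outputCode), Xl, 0, 0) = true ↔
      ∀ ν, φ.Holds g X ν := by
  have h := (neg (ex 0 (ex 1 (neg φ)))).eval_iff g X
    (fun _ => Sum.inl ⟨0, List.length_pos_iff.2 g.input_ne⟩) hX
  refine h.trans ?_
  simp only [Holds, not_exists, not_not]
  constructor
  · intro h ν
    have h' := h (ν 0) (ν 1)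
    rwa [show ν = Function.update (Function.update _ 0 (ν 0)) 1 (ν 1) from
      funext (Fin.forall_fin_two.2 ⟨rfl, rfl⟩)]
  · exact fun h _ _ => h _

theorem OGraph.exists_testBit_posNum {k m : ℕ} (g : OGraph (Fin k) (Fin m)) (P : Set g.Pos) :
    ∃ M < 2 ^ (g.input.length + g.output.length),
      ∀ p, M.testBit (g.posNum p) = true ↔ p ∈ P := by
  obtain ⟨M, hM, h⟩ := exists_testBit_iff
    {i : Fin (g.input.length + g.output.length) | ∃ p ∈ P, g.posNum p = i}
  refine ⟨M, hM, fun p => (h ⟨g.posNum p, g.posNum_lt p⟩).trans ?_⟩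
  constructor
  · rintro ⟨p', hp', he⟩
    rwa [← g.posNum_injective he]
  · exact fun hp => ⟨p, hp, rfl⟩

theorem OGraph.exists_outputCode_eq {k m : ℕ} {u : List (Fin k)} (hu : u ≠ []) {out : List (ℕ × ℕ)}
    (hout : ∀ a ∈ out, a.1 < m ∧ a.2 < u.length) :
    ∃ g : OGraph (Fin k) (Fin m), g.input = u ∧ g.outputCode = out := by
  have hlt : ∀ q : Fin out.length, out[q].1 < m ∧ out[q].2 < u.length := fun q =>
    hout _ (List.getElem_mem _)
  let v : List (Fin m) := List.ofFn fun q => ⟨out[q].1, (hlt q).1⟩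
  have hv : v.length = out.length := List.length_ofFn
  refine ⟨⟨u, hu, v, fun q => ⟨_, (hlt (Fin.cast hv q)).2⟩⟩, rfl, ?_⟩
  refine List.ext_getElem (by rw [length_outputCode]; exact hv) fun i hi hi' => ?_
  simp [outputCode, v]

/-- The Gödel number `c` of an `∃L_T`-sentence defines an o-transduction whose input domain contains
`u`. The number `c` packs the sizes of the input and output alphabets, the number of second-order
variables and the Gödel number of the formula, which are `codeTag c`, `codeFst c`,
`codeTag (codeSnd c)` and `codeArg (codeSnd c)`. All parameters of `outputBound` are estimated by
`c`. -/
def InDomain (c : ℕ) (u : List ℕ) : Prop :=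
  u ≠ [] ∧ ∃ out ∈ listsUpTo ((List.range (codeFst c)).flatMap fun b =>
      (List.range u.length).map fun p => (b, p)) (outputBound u.length c c c),
    ∃ Xl ∈ listsUpTo (List.range (2 ^ (u.length + out.length))) (codeTag (codeSnd c)),
      LTNode.eval (closureCode (codeArg (codeSnd c)), (u, out), Xl, 0, 0) = true

theorem primrec_inDomain : PrimrecRel InDomain := by
  open Primrec in
  have hlen : Primrec fun a : ℕ × List ℕ => a.2.length := list_length.comp snd
  have hn : Primrec fun a : ℕ × List ℕ => codeTag (codeSnd a.1) :=
    primrec_codeTag.comp (primrec_codeSnd.comp fst)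
  have hφ : Primrec fun a : ℕ × List ℕ => closureCode (codeArg (codeSnd a.1)) :=
    primrec_closureCode.comp (primrec_codeArg.comp (primrec_codeSnd.comp fst))
  have hout : Primrec fun a : ℕ × List ℕ => listsUpTo ((List.range (codeFst a.1)).flatMap fun b =>
      (List.range a.2.length).map fun p => (b, p)) (outputBound a.2.length a.1 a.1 a.1) := by
    refine primrec_listsUpTo.comp (list_flatMap (list_range.comp (primrec_codeFst.comp fst)) ?_)
      (primrec_outputBound hlen fst fst fst)
    exact list_map (list_range.comp (hlen.comp fst)) ((snd.comp fst).pair snd)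
  have hsets : Primrec fun a : (ℕ × List ℕ) × List (ℕ × ℕ) =>
      listsUpTo (List.range (2 ^ (a.1.2.length + a.2.length))) (codeTag (codeSnd a.1.1)) :=
    primrec_listsUpTo.comp (list_range.comp (primrec_two_pow.comp
      (nat_add.comp (hlen.comp fst) (list_length.comp snd)))) (hn.comp fst)
  have heval : PrimrecRel fun (a : (ℕ × List ℕ) × List (ℕ × ℕ)) (Xl : List ℕ) =>
      LTNode.eval (closureCode (codeArg (codeSnd a.1.1)), (a.1.2, a.2), Xl, 0, 0) = true :=
    Primrec.eq.comp (LTNode.primrec_eval.comp ((hφ.comp (fst.comp fst)).pair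
      (((snd.comp (fst.comp fst)).pair (snd.comp fst)).pair
        (snd.pair (const (0, 0)))))) (const true)
  have hex : PrimrecRel fun (a : ℕ × List ℕ) (out : List (ℕ × ℕ)) =>
      ∃ Xl ∈ listsUpTo (List.range (2 ^ (a.2.length + out.length))) (codeTag (codeSnd a.1)),
        LTNode.eval (closureCode (codeArg (codeSnd a.1)), (a.2, out), Xl, 0, 0) = true :=
    heval.exists_mem hsets
  exact (Primrec.eq.comp snd (const [])).not.and (hex.exists_mem hout)

theorem le_sentenceCode {k m n φ c : ℕ} (hc : c = Nat.pair k (Nat.pair m (Nat.pair n φ))) :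
    m ≤ c ∧ n ≤ c ∧ φ ≤ c := by
  have h1 := Nat.add_le_pair k (Nat.pair m (Nat.pair n φ))
  have h2 := Nat.add_le_pair m (Nat.pair n φ)
  have h3 := Nat.add_le_pair n φ
  omega

theorem inDomain_iff {k m n c : ℕ} (φ : LTFormula (Fin k) (Fin m) n)
    (hc : c = Nat.pair k (Nat.pair m (Nat.pair n φ.code))) (u : List (Fin k)) :
    InDomain c (u.map Fin.val) ↔ u ∈ φ.domain := by
  have hm : codeFst c = m := by simp [hc]
  have hn : codeTag (codeSnd c) = n := by simp [hc]
  have hφ : codeArg (codeSnd c) = φ.code := by simp [hc]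
  obtain ⟨hlem, hlen, hleφ⟩ := le_sentenceCode hc
  simp only [InDomain, hm, hn, hφ, List.length_map, mem_listsUpTo, List.mem_flatMap, List.mem_map,
    List.mem_range, ne_eq, List.map_eq_nil_iff]
  constructor
  · rintro ⟨hu, out, ⟨-, hout⟩, Xl, -, he⟩
    obtain ⟨g, rfl, rfl⟩ := OGraph.exists_outputCode_eq (m := m) hu (out := out) (by
      intro a ha
      obtain ⟨b, hb, p, hp, rfl⟩ := hout a ha
      exact ⟨hb, hp⟩)
    exact ⟨g, fun i => {p | (Xl.getD i 0).testBit (g.posNum p) = true}, rfl,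
      (φ.eval_closureCode g _ fun _ _ => Iff.rfl).1 he⟩
  · intro hu
    obtain ⟨g, X, rfl, hlenout, hH⟩ := φ.exists_output_length_le hu
    choose M hM hbit using fun i => g.exists_testBit_posNum (X i)
    have hget : ∀ i : Fin n, (List.ofFn M).getD i 0 = M i := fun i => by
      rw [List.getD_eq_getElem _ _ (by simp), List.getElem_ofFn]
    refine ⟨g.input_ne, g.outputCode, ⟨?_, ?_⟩, List.ofFn M, ⟨?_, ?_⟩, ?_⟩
    · rw [g.length_outputCode]
      rw [Fintype.card_fin] at hlenout
      exact hlenout.trans (outputBound_mono (φ.length_subs_le.trans hleφ) hlen hlem)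
    · intro a ha
      obtain ⟨q, rfl⟩ := List.mem_ofFn.1 ha
      exact ⟨_, (g.output.get q).2, _, (g.origin q).2, rfl⟩
    · rw [List.length_ofFn]
    · intro a ha
      obtain ⟨i, rfl⟩ := List.mem_ofFn.1 ha
      rw [g.length_outputCode]
      exact hM i
    · exact (φ.eval_closureCode g X fun i p => by rw [hget]; exact hbit i p).2 hH

/-! ### Computation of automata -/

namespace AutomatonTable

/-- The list of the states that the automaton can reach by reading a word. -/
def run (T : AutomatonTable) (w : List ℕ) : List ℕ :=
  w.foldl (fun S a => (T.2.1.filter fun t => t.1 ∈ S ∧ t.2.1 = a).map fun t => t.2.2) T.1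

theorem mem_run (T : AutomatonTable) {k : ℕ} (w : List (Fin k)) (s : ℕ) :
    s ∈ T.run (w.map Fin.val) ↔ s ∈ (T.toNFA k).eval w := by
  induction w using List.reverseRecOn generalizing s with
  | nil => exact Iff.rfl
  | append_singleton w a ih =>
    rw [NFA.eval_append_singleton, NFA.mem_stepSet, List.map_append, run, List.foldl_append]
    change s ∈ ((T.2.1.filter fun t => t.1 ∈ T.run (w.map Fin.val) ∧ t.2.1 = (a : ℕ)).map
      fun t => t.2.2) ↔ _
    simp only [List.mem_map, List.mem_filter, decide_eq_true_eq, ih]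
    constructor
    · rintro ⟨⟨p, a', q⟩, ⟨ht, hp, rfl⟩, rfl⟩
      exact ⟨p, hp, ht⟩
    · rintro ⟨p, hp, ht⟩
      exact ⟨(p, (a : ℕ), s), ⟨ht, hp, rfl⟩, rfl⟩

/-- Acceptance of a word by the automaton. -/
def Accepts (T : AutomatonTable) (w : List ℕ) : Prop := ∃ s ∈ T.2.2, s ∈ T.run w

theorem accepts_map_iff (T : AutomatonTable) {k : ℕ} (w : List (Fin k)) :
    T.Accepts (w.map Fin.val) ↔ w ∈ (T.toNFA k).accepts := by
  simp only [Accepts, mem_run]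
  exact Iff.rfl

open Primrec

theorem primrec_run : Primrec₂ run := by
  have hR : PrimrecRel fun (t : ℕ × ℕ × ℕ) (b : List ℕ × ℕ) => t.1 ∈ b.1 ∧ t.2.1 = b.2 :=
    (list_mem (fst.comp fst) (fst.comp snd)).and
      (Primrec.eq.comp (fst.comp (snd.comp fst)) (snd.comp snd))
  refine list_foldl snd (fst.comp fst)
    (h := fun (a : AutomatonTable × List ℕ) (b : List ℕ × ℕ) =>
      (a.1.2.1.filter fun t => t.1 ∈ b.1 ∧ t.2.1 = b.2).map fun t => t.2.2) ?_
  refine list_map ?_ ((snd.comp (snd.comp snd)).to₂)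
  exact (PrimrecRel.listFilter hR).comp (fst.comp (snd.comp (fst.comp fst))) snd

theorem primrec_accepts : PrimrecRel Accepts := by
  have h : PrimrecRel fun (a : AutomatonTable × List ℕ) (s : ℕ) => s ∈ a.1.run a.2 :=
    list_mem snd (primrec_run.comp (fst.comp fst) (snd.comp fst))
  exact h.exists_mem (snd.comp (snd.comp fst))

theorem primrec_below : PrimrecRel Below := by
  have h1 : PrimrecRel fun (a : AutomatonTable × ℕ) (s : ℕ) => s < a.2 :=
    nat_lt.comp snd (snd.comp fst)
  have h2 : PrimrecRel fun (a : AutomatonTable × ℕ) (t : ℕ × ℕ × ℕ) => t.2.2 < a.2 :=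
    nat_lt.comp (snd.comp (snd.comp snd)) (snd.comp fst)
  exact (h1.forall_mem (fst.comp fst)).and (h2.forall_mem (fst.comp (snd.comp fst)))

end AutomatonTable

/-- A bound for the number of left quotients of the input domain that the sentence with Gödel number
`c` defines. -/
def stateBound (c : ℕ) : ℕ := quotientBound (tower c) c c c

/-- A sufficient criterion for an automaton to recognise the input domain that the sentence with
Gödel number `c` defines: it has few states, and it is correct on short words. -/
def IsAutomatonFor (c : ℕ) (T : AutomatonTable) : Prop :=
  T.Below (stateBound c) ∧
    ∀ w ∈ listsUpTo (List.range (codeTag c)) (stateBound c * 2 ^ stateBound c),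
      (InDomain c w ↔ T.Accepts w)

open Primrec in
theorem primrec_isAutomatonFor : PrimrecRel IsAutomatonFor := by
  have hN : Primrec fun a : ℕ × AutomatonTable => stateBound a.1 :=
    primrec_quotientBound (primrec_tower.comp fst) fst fst fst
  have h1 : PrimrecRel fun (a : ℕ × AutomatonTable) (w : List ℕ) => InDomain a.1 w :=
    primrec_inDomain.comp (fst.comp fst) snd
  have h2 : PrimrecRel fun (a : ℕ × AutomatonTable) (w : List ℕ) => a.2.Accepts w :=
    AutomatonTable.primrec_accepts.comp (snd.comp fst) snd
  have h : PrimrecRel fun (a : ℕ × AutomatonTable) (w : List ℕ) =>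
      (InDomain a.1 w ↔ a.2.Accepts w) :=
    PrimrecPred.of_eq ((PrimrecPred.and h1 h2).or ((PrimrecPred.not h1).and (PrimrecPred.not h2)))
      fun _ => iff_iff_and_or_not_and_not.symm
  exact (AutomatonTable.primrec_below.comp snd hN).and (h.forall_mem (primrec_listsUpTo.comp
    (list_range.comp (primrec_codeTag.comp fst))
    (nat_mul.comp hN (primrec_two_pow.comp hN))))

section

variable {k m n c : ℕ} (φ : LTFormula (Fin k) (Fin m) n)

theorem LTFormula.finIndex_stateBound (hc : c = Nat.pair k (Nat.pair m (Nat.pair n φ.code))) :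
    FinIndex (stateBound c) fun u v : List (Fin k) => u ++ v ∈ φ.domain := by
  obtain ⟨hm, hn, hφ⟩ := le_sentenceCode hc
  refine φ.finIndex_domain.mono (quotientBound_mono (φ.index_le_tower.trans (tower_mono hφ))
    (φ.length_subs_le.trans hφ) hn ?_)
  rwa [Fintype.card_fin]

/-- Both languages have few left quotients, so they are equal if they agree on short words. -/
theorem IsAutomatonFor.accepts_eq (hc : c = Nat.pair k (Nat.pair m (Nat.pair n φ.code)))
    {T : AutomatonTable} (hT : IsAutomatonFor c T) : (T.toNFA k).accepts = φ.domain := by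
  refine (Language.eq_of_finIndex (φ.finIndex_stateBound hc)
    (AutomatonTable.finIndex_accepts hT.1 k) fun w hw => ?_).symm
  rw [← inDomain_iff φ hc, ← T.accepts_map_iff]
  refine hT.2 _ (mem_listsUpTo.2 ⟨by rwa [List.length_map], fun a ha => ?_⟩)
  obtain ⟨i, -, rfl⟩ := List.mem_map.1 ha
  rw [hc, codeTag_pair]
  exact List.mem_range.2 i.2

theorem LTFormula.exists_isAutomatonFor (hc : c = Nat.pair k (Nat.pair m (Nat.pair n φ.code))) :
    ∃ T, IsAutomatonFor c T := by
  obtain ⟨T, hT, h⟩ := AutomatonTable.exists_table_of_finIndex (φ.finIndex_stateBound hc)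
  refine ⟨T, hT, fun w hw => ?_⟩
  obtain ⟨w, rfl⟩ : ∃ w' : List (Fin k), w'.map Fin.val = w := by
    have hlt : ∀ a ∈ w, a < k := fun a ha => by
      have := (mem_listsUpTo.1 hw).2 a ha
      rwa [hc, codeTag_pair, List.mem_range] at this
    exact ⟨w.pmap Fin.mk hlt, by rw [List.map_pmap]; exact List.pmap_eq_self.2 fun _ _ => rfl⟩
  rw [inDomain_iff φ hc, T.accepts_map_iff, h]

end

/-- The unbounded search for an automaton that recognises the input domain of a sentence. -/
noncomputable def searchAutomaton (c : ℕ) : Part AutomatonTable :=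
  open Classical in
  Nat.rfindOpt fun i => (Encodable.decode (α := AutomatonTable) i).bind fun T =>
    Option.guard (fun T => IsAutomatonFor c T) T

open Primrec in
theorem partrec_searchAutomaton : Partrec searchAutomaton := by
  classical
  refine Partrec.rfindOpt (Primrec.to_comp ?_)
  refine option_bind (Primrec.decode.comp snd) ?_
  have h : PrimrecRel fun (a : (ℕ × ℕ) × AutomatonTable) (T : AutomatonTable) =>
      IsAutomatonFor a.1.1 T := primrec_isAutomatonFor.comp (fst.comp (fst.comp fst)) snd
  exact option_guard h snd

theorem LTFormula.exists_mem_searchAutomaton {k m n c : ℕ} (φ : LTFormula (Fin k) (Fin m) n)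
    (hc : c = Nat.pair k (Nat.pair m (Nat.pair n φ.code))) :
    ∃ T ∈ searchAutomaton c, (T.toNFA k).accepts = φ.domain := by
  classical
  obtain ⟨T₀, h₀⟩ := φ.exists_isAutomatonFor hc
  have hdom : (searchAutomaton c).Dom := Nat.rfindOpt_dom.2
    ⟨Encodable.encode T₀, T₀, by
      rw [Encodable.encodek]
      refine (Option.guard_eq_some_iff (p := fun T => decide (IsAutomatonFor c T))).2 ⟨rfl, ?_⟩
      exact decide_eq_true h₀⟩
  obtain ⟨T, hT⟩ := Part.dom_iff_mem.1 hdom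
  refine ⟨T, hT, ?_⟩
  obtain ⟨i, hi⟩ := Nat.rfindOpt_spec hT
  obtain ⟨T', -, hT'⟩ := Option.bind_eq_some_iff.1 hi
  obtain ⟨rfl, h⟩ := Option.guard_eq_some_iff.1 hT'
  exact IsAutomatonFor.accepts_eq φ hc (by simpa using h)

theorem ELTSentence.inputDomain_eq {A B : Type*} (φ : ELTSentence A B) :
    inputDomain φ.oTransduction = φ.formula.domain := by
  ext u
  constructor
  · rintro ⟨g, ⟨X, hX⟩, hu⟩
    exact ⟨g, X, hu, hX⟩
  · rintro ⟨g, X, hu, hX⟩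
    exact ⟨g, ⟨X, hX⟩, hu⟩

theorem LTSentence.inputDomain_eq {A B : Type*} (φ : LTSentence A B) :
    inputDomain φ.oTransduction = φ.formula.domain := by
  ext u
  constructor
  · rintro ⟨g, hg, hu⟩
    exact ⟨g, Fin.elim0, hu, hg⟩
  · rintro ⟨g, X, hu, hX⟩
    obtain rfl : X = Fin.elim0 := Subsingleton.elim _ _
    exact ⟨g, hX, hu⟩

theorem LTFormula.isRegular_domain {A B : Type*} [Finite B] {n : ℕ} (φ : LTFormula A B n) :
    φ.domain.IsRegular :=
  have := Fintype.ofFinite B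
  Language.isRegular_of_finIndex φ.finIndex_domain

theorem mainTheorem4 :
    (∀ (A B : Type*) [Finite A] [Finite B] (φ : LTSentence A B),
      (inputDomain φ.oTransduction).IsRegular) ∧
    (∀ (A B : Type*) [Finite A] [Finite B] (φ : ELTSentence A B),
      (inputDomain φ.oTransduction).IsRegular) ∧
    (∃ f : ℕ →. AutomatonTable, Partrec f ∧
      ∀ (k m : ℕ) (φ : LTSentence (Fin k) (Fin m)), ∃ T ∈ f φ.code,
        (T.toNFA k).accepts = inputDomain φ.oTransduction) ∧
    (∃ f : ℕ →. AutomatonTable, Partrec f ∧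
      ∀ (k m : ℕ) (φ : ELTSentence (Fin k) (Fin m)), ∃ T ∈ f φ.code,
        (T.toNFA k).accepts = inputDomain φ.oTransduction) := by
  refine ⟨fun A B _ _ φ => φ.inputDomain_eq ▸ φ.formula.isRegular_domain,
    fun A B _ _ φ => φ.inputDomain_eq ▸ φ.formula.isRegular_domain, ?_, ?_⟩
  · -- A sentence without second-order variables is recoded with their number `0`.
    refine ⟨fun c => searchAutomaton
      (Nat.pair (codeTag c) (Nat.pair (codeFst c) (Nat.pair 0 (codeSnd c)))), ?_, ?_⟩
    · exact partrec_searchAutomaton.comp (Primrec₂.natPair.comp primrec_codeTag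
        (Primrec₂.natPair.comp primrec_codeFst
          (Primrec₂.natPair.comp (Primrec.const 0) primrec_codeSnd))).to_comp
    · intro k m φ
      rw [φ.inputDomain_eq]
      exact φ.formula.exists_mem_searchAutomaton (by simp [LTSentence.code])
  · refine ⟨searchAutomaton, partrec_searchAutomaton, fun k m φ => ?_⟩
    rw [φ.inputDomain_eq]
    exact φ.formula.exists_mem_searchAutomaton rfl
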